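/- **Stacks.** We consider disjoint unions $\mathfrak{X}=\bigsqcup_{i\in I}X_i/G_i$ of quotient stacks (for the étale topology, on schemes over $\mathbb{C}$), where $I$ is any set, $X_i$ is a scheme of finite type over $\mathbb{C}$ and $G_i$ is a linear algebraic group acting on $X_i$ from the right. A 1-morphism $u:\bigsqcup_i X_i/G_i\to\bigsqcup_j Y_j/H_j$ is *of finite type* if the preimage of each $Y_j/H_j$ meets only finitely many of the $X_i/G_i$. **Motivic theories.** A (stacky) motivic theory $R$ assigns to every such $\mathfrak{X}$ an abelian group $R(\mathfrak{X})$, to every 1-morphism $u:\mathfrak{X}\to\mathfrak{Y}$ a homomorphism $u^*:R(\mathfrak{Y})\to R(\mathfrak{X})$ and, if $u$ is of finite type, a homomorphism $u_!:R(\mathfrak{X})\to R(\mathfrak{Y})$, both functorial and depending only on the 2-isomorphism class of $u$, together with a biadditive exterior product $\boxtimes:R(\mathfrak{X})\times R(\mathfrak{Y})\to R(\mathfrak{X}\times\mathfrak{Y})$ which is associative, symmetric (i.e. $\tau^*(b\boxtimes a)=a\boxtimes b$ for the transposition $\tau$) and has a unit $1\in R(\operatorname{Spec}\mathbb{C})$,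 such that: 1. restriction to the components is an isomorphism $R(\bigsqcup_i X_i/G_i)\to\prod_i R(X_i/G_i)$; 2. for every (2-)cartesian square with $f:\mathfrak{X}\to\mathfrak{Z}$ of finite type, $g:\mathfrak{Y}\to\mathfrak{Z}$, and projections $p:\mathfrak{W}\to\mathfrak{X}$, $q:\mathfrak{W}\to\mathfrak{Y}$, one has $g^*f_!=q_!p^*$; 3. $(u\times v)^*(a\boxtimes b)=u^*(a)\boxtimes v^*(b)$ and, if $u,v$ are of finite type, $(u\times v)_!(a\boxtimes b)=u_!(a)\boxtimes v_!(b)$; 4. if $i$ is the inclusion of a closed substack (given by $G_i$-invariant closed subschemes of the $X_i$) and $j$ the inclusion of its open complement, then $i^*i_!=\mathrm{id}$, $j^*j_!=\mathrm{id}$, $j^*i_!=0$, $i^*j_!=0$ and $a=i_!i^*(a)+j_!j^*(a)$ for all $a$. (Operations $\sigma^n$ on the groups of schemes, which are often part of the definition, are not required.) Using $\operatorname{Spec}\mathbb{C}\times\mathfrak{X}\cong\mathfrak{X}$, the exterior product defines a multiplication on $R(\operatorname{Spec}\mathbb{C})$ and an action of $R(\operatorname{Spec}\mathbb{C})$ on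 every $R(\mathfrak{X})$. **Quiver representations.** Let $Q$ be a quiver with finite vertex set $Q_0$ and finite arrow set $Q_1$. For $d\in\mathbb{N}^{Q_0}$ let $X_d=\prod_{\alpha:i\to j}\operatorname{Hom}(\mathbb{C}^{d_i},\mathbb{C}^{d_j})$ and $G_d=\prod_{i}\mathrm{GL}(d_i)$, acting by $(M\cdot g)_\alpha=g_j^{-1}M_\alpha g_i$ for $\alpha:i\to j$, and let $\mathfrak{M}=\bigsqcup_d X_d/G_d$ be the stack of representations of $Q$. For $d,d'\in\mathbb{N}^{Q_0}$ let $X_{d,d'}\subseteq X_{d+d'}$ and $G_{d,d'}\subseteq G_{d+d'}$ be the closed subscheme and subgroup preserving the subspaces $\mathbb{C}^{d_i}\subseteq\mathbb{C}^{d_i}\oplus\mathbb{C}^{d'_i}$, and let $\mathfrak{Exact}=\bigsqcup_{d,d'}X_{d,d'}/G_{d,d'}$ be the stack of short exact sequences $0\to V^{(1)}\to V^{(2)}\to V^{(3)}\to0$ of representations ($\dim V^{(1)}=d$, $\dim V^{(3)}=d'$). Let $\pi_k:\mathfrak{Exact}\to\mathfrak{M}$ map a sequence to its $k$-th term (so $\pi_1$,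 $\pi_2$, $\pi_3$ take the restriction to the subspaces, the representation itself, and the induced maps on the quotients), and let $0:\operatorname{Spec}\mathbb{C}\to\mathfrak{M}$ be given by the zero representation. The morphisms $\pi_2$ and $0$ are of finite type. **Statement.** Let $R$ be a motivic theory in the above sense. Then $R(\operatorname{Spec}\mathbb{C})$ is a commutative ring with unit $1$, $R(\mathfrak{M})$ is a (unital) module over it, and the Ringel–Hall product $$a*b:=\pi_{2\,!}\,(\pi_1\times\pi_3)^*(a\boxtimes b),\qquad a,b\in R(\mathfrak{M}),$$ is $R(\operatorname{Spec}\mathbb{C})$-bilinear and associative, and has the two-sided unit $1_0:=0_!(1)$. In other words, the Ringel–Hall algebra $(R(\mathfrak{M}),*)$ is an associative $R(\operatorname{Spec}\mathbb{C})$-algebra with unit $1_0$. -/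

import Mathlib

open CategoryTheory AlgebraicGeometry Opposite Limits

namespace RingelHall

noncomputable section

/-- Schemes over the complex numbers. -/
abbrev SchC : Type 1 := Over (Spec (CommRingCat.of ℂ))

/-- The ring of global regular functions on a scheme `T` over `ℂ`. -/
abbrev Reg (T : SchC) : CommRingCat := Γ(T.left, ⊤)

/-- Pull-back of regular functions along a morphism. -/
def funMap {S T : SchC} (f : S ⟶ T) : Reg T →+* Reg S := f.left.appTop.hom

lemma funMap_id (T : SchC) (x : Reg T) : funMap (𝟙 T) x = x := by
  simp [funMap]

lemma funMap_comp {S T U : SchC} (f : S ⟶ T) (g : T ⟶ U) (x : Reg U) :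
    funMap (f ≫ g) x = funMap f (funMap g x) := by
  simp only [funMap, Over.comp_left, Scheme.Hom.comp_appTop]
  rfl

/-- The structure map from `ℂ` to the regular functions on `T`. -/
def scalars (T : SchC) : ℂ →+* Reg T :=
  ((Scheme.ΓSpecIso (CommRingCat.of ℂ)).inv ≫ T.hom.appTop).hom

lemma funMap_scalars {S T : SchC} (f : S ⟶ T) : (funMap f).comp (scalars T) = scalars S := by
  have h := Over.w f
  simp only [scalars, funMap, ← h, Scheme.Hom.comp_appTop]
  rfl

/-- The functor of points `F` is represented by an affine scheme of finite type over `ℂ`. -/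
def IsAffineFiniteType (F : SchCᵒᵖ ⥤ Type) : Prop :=
  ∃ Y : SchC, IsAffine Y.left ∧ LocallyOfFiniteType Y.hom ∧ Nonempty (F.RepresentableBy Y)

/-- The functor of points `F` is represented by a scheme of finite type over `ℂ`. -/
def IsFiniteType (F : SchCᵒᵖ ⥤ Type) : Prop :=
  ∃ Y : SchC, LocallyOfFiniteType Y.hom ∧ QuasiCompact Y.hom ∧ Nonempty (F.RepresentableBy Y)

lemma IsAffineFiniteType.isFiniteType {F : SchCᵒᵖ ⥤ Type} (h : IsAffineFiniteType F) :
    IsFiniteType F := by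
  obtain ⟨Y, h1, h2, h3⟩ := h
  refine ⟨Y, h2, ?_, h3⟩
  have : IsAffineHom Y.hom := isAffineHom_of_isAffine Y.hom
  infer_instance

/-- Morphisms from `T` to the spectrum of a `ℂ`-algebra `A` are the `ℂ`-algebra homomorphisms
from `A` to the regular functions on `T`. -/
def specEquiv (A : CommRingCat.{0}) (φ : CommRingCat.of ℂ ⟶ A) (T : SchC) :
    (T ⟶ Over.mk (Spec.map φ)) ≃ {ψ : A ⟶ Reg T // φ ≫ ψ = CommRingCat.ofHom (scalars T)} where
  toFun f := ⟨(Scheme.ΓSpecIso A).inv ≫ f.left.appTop, by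
    have h := Over.w f
    simp only [scalars, CommRingCat.ofHom_hom, ← h, Over.mk_hom, Scheme.Hom.comp_appTop,
      ← Category.assoc]
    rw [Scheme.ΓSpecIso_inv_naturality]⟩
  invFun ψ := Over.homMk (T.left.toSpecΓ ≫ Spec.map ψ.1) (by
    have := ψ.2
    simp only [Over.mk_hom, Category.assoc, ← Spec.map_comp, this]
    simp only [scalars, CommRingCat.ofHom_hom, Spec.map_comp]
    rw [← Scheme.toSpecΓ_naturality_assoc]
    simp)
  left_inv f := by
    ext1
    simp only [Over.mk_left, Over.homMk_left, Spec.map_comp]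
    rw [← Scheme.toSpecΓ_naturality_assoc]
    simp
  right_inv ψ := by
    ext1
    simp only [Over.mk_left, Over.homMk_left, Scheme.Hom.comp_appTop, Scheme.toSpecΓ_appTop]
    rw [← Scheme.ΓSpecIso_inv_naturality_assoc]
    simp

/-- A functor whose `T`-points are the solutions of a system of polynomial equations in finitely
many unknowns is represented by an affine scheme of finite type. -/
lemma isAffineFiniteType_of_equations {N : Type} [Finite N] (E : Set (MvPolynomial N ℂ))
    (F : SchCᵒᵖ ⥤ Type)
    (e : ∀ T : SchC, F.obj (op T) ≃
      {v : N → Reg T // ∀ p ∈ E, MvPolynomial.eval₂ (scalars T) v p = 0})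
    (he : ∀ {S T : SchC} (f : S ⟶ T) (x : F.obj (op T)) (n : N),
      (e S (F.map f.op x)).1 n = funMap f ((e T x).1 n)) :
    IsAffineFiniteType F := by
  let A : CommRingCat := CommRingCat.of (MvPolynomial N ℂ ⧸ Ideal.span E)
  let φ : CommRingCat.of ℂ ⟶ A := CommRingCat.ofHom (algebraMap ℂ (MvPolynomial N ℂ ⧸ Ideal.span E))
  let q : MvPolynomial N ℂ →+* A := Ideal.Quotient.mk (Ideal.span E)
  have hq : ∀ (T : SchC) (ψ : A ⟶ Reg T), φ ≫ ψ = CommRingCat.ofHom (scalars T) →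
      ∀ p, ψ.hom (q p) = MvPolynomial.eval₂ (scalars T) (fun n => ψ.hom (q (.X n))) p := by
    intro T ψ h p
    have : ψ.hom.comp q = MvPolynomial.eval₂Hom (scalars T) (fun n => ψ.hom (q (.X n))) := by
      apply MvPolynomial.ringHom_ext
      · intro r
        have := congrArg (fun g => g.hom r) h
        rw [RingHom.comp_apply, MvPolynomial.coe_eval₂Hom, MvPolynomial.eval₂_C]
        exact this
      · intro n; simp
    exact congrArg (fun g => g p) this
  let d : ∀ T : SchC, {ψ : A ⟶ Reg T // φ ≫ ψ = CommRingCat.ofHom (scalars T)} ≃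
      {v : N → Reg T // ∀ p ∈ E, MvPolynomial.eval₂ (scalars T) v p = 0} := fun T =>
    { toFun := fun ψ => ⟨fun n => ψ.1.hom (q (.X n)), fun p hp => by
        rw [← hq T ψ.1 ψ.2]
        have : q p = 0 := Ideal.Quotient.eq_zero_iff_mem.2 (Ideal.subset_span hp)
        rw [this, map_zero]⟩
      invFun := fun v => ⟨CommRingCat.ofHom (Ideal.Quotient.lift (Ideal.span E)
          (MvPolynomial.eval₂Hom (scalars T) v.1) (by
            intro p hp
            have : Ideal.span E ≤ RingHom.ker (MvPolynomial.eval₂Hom (scalars T) v.1) :=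
              Ideal.span_le.2 fun p hp => v.2 p hp
            exact this hp)), by
          ext r
          change MvPolynomial.eval₂Hom (scalars T) v.1 (MvPolynomial.C r) = _
          simp⟩
      left_inv := fun ψ => by
        refine Subtype.ext (CommRingCat.hom_ext (RingHom.ext fun x => ?_))
        obtain ⟨p, rfl⟩ := Ideal.Quotient.mk_surjective x
        exact (hq T ψ.1 ψ.2 p).symm
      right_inv := fun v => by
        ext n
        change MvPolynomial.eval₂Hom (scalars T) v.1 (MvPolynomial.X n) = _
        simp }
  refine ⟨Over.mk (Spec.map φ), ?_, ?_, ⟨⟨fun {T} => (specEquiv A φ T).trans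
    ((d T).trans (e T).symm), ?_⟩⟩⟩
  · dsimp; infer_instance
  · change LocallyOfFiniteType (Spec.map φ)
    rw [HasRingHomProperty.Spec_iff (P := @LocallyOfFiniteType)]
    change (algebraMap ℂ (MvPolynomial N ℂ ⧸ Ideal.span E)).FiniteType
    rw [RingHom.finiteType_algebraMap]
    infer_instance
  · intro S T f g
    simp only [Equiv.trans_apply]
    rw [Equiv.symm_apply_eq]
    ext n
    rw [he]
    simp only [Equiv.apply_symm_apply]
    simp only [d, specEquiv, funMap, Equiv.coe_fn_mk, Over.comp_left, Scheme.Hom.comp_appTop]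
    rfl



lemma isSheafFor_etale_cover (T Y : Scheme.{0}) {B : Type} (W : B → Scheme.{0}) (p : ∀ b, W b ⟶ T)
    (etale : ∀ b, Etale (p b)) (surj : ∀ t : T, ∃ b, t ∈ Set.range (p b)) :
    Presieve.IsSheafFor (yoneda.obj Y) (Presieve.ofArrows W p) := by
  have h : Presieve.ofArrows W p ∈ Scheme.etalePrecoverage T := by
    refine (Scheme.ofArrows_mem_precoverage_iff (P := @Etale)).2 ⟨surj, etale⟩
  have hs : Scheme.etaleTopology.Subcanonical := .of_le
    (Scheme.etaleTopology_le_proetaleTopology.trans Scheme.proetaleTopology_le_fpqcTopology)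
  rw [Presieve.isSheafFor_iff_generate]
  exact (GrothendieckTopology.Subcanonical.isSheaf_of_isRepresentable
    (J := Scheme.etaleTopology) (yoneda.obj Y)) _ (Precoverage.generate_mem_toGrothendieck h)

lemma glue_unique {F : SchCᵒᵖ ⥤ Type} {Y : SchC} (r : F.RepresentableBy Y) {S T : SchC} {B : Type}
    (cov : B → SchC) (proj : ∀ b, cov b ⟶ S) (etale : ∀ b, Etale (proj b).left)
    (surj : ∀ s : S.left, ∃ b, s ∈ Set.range (proj b).left) (s : T ⟶ S) (t t' : F.obj (op T))
    (h : ∀ {b : B} {Z : SchC} (p : Z ⟶ T) (v : Z ⟶ cov b), Nonempty Z.left →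
      p ≫ s = v ≫ proj b → F.map p.op t = F.map p.op t') : t = t' := by
  apply r.homEquiv.symm.injective
  ext1
  let B' := {b : B // Nonempty ↥(pullback s.left (proj b).left)}
  let W : B' → Scheme := fun b => pullback s.left (proj b.1).left
  let p : ∀ b, W b ⟶ T.left := fun b => pullback.fst _ _
  have hW := isSheafFor_etale_cover T.left Y.left W p
    (fun b => by dsimp only [p]; have := etale b.1; infer_instance) (fun x => by
      obtain ⟨b, y, hy⟩ := surj (s.left x)
      obtain ⟨z, hz, -⟩ := Scheme.Pullback.exists_preimage_pullback x y hy.symm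
      exact ⟨⟨b, ⟨z⟩⟩, z, hz⟩)
  refine (hW.isSeparatedFor.ext ?_)
  rintro _ _ ⟨b⟩
  let Z : SchC := Over.mk (p b ≫ T.hom)
  let P : Z ⟶ T := Over.homMk (p b)
  let V : Z ⟶ cov b.1 := Over.homMk (pullback.snd _ _) (by
    simp only [Z, p, Over.mk_hom, ← Over.w (proj b.1), ← pullback.condition_assoc, Over.w s])
  have := h P V b.2 (by ext1; exact pullback.condition)
  have h2 := congrArg (fun x => (r.homEquiv.symm x).left) this
  simp only [← r.comp_homEquiv_symm, Over.comp_left] at h2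
  exact h2

lemma exists_glue {F : SchCᵒᵖ ⥤ Type} {Y : SchC} (r : F.RepresentableBy Y) {S T : SchC} {B : Type}
    (cov : B → SchC) (proj : ∀ b, cov b ⟶ S) (etale : ∀ b, Etale (proj b).left)
    (surj : ∀ s : S.left, ∃ b, s ∈ Set.range (proj b).left) (s : T ⟶ S)
    (w : ∀ {b : B} {Z : SchC} (p : Z ⟶ T) (v : Z ⟶ cov b), Nonempty Z.left →
      p ≫ s = v ≫ proj b → F.obj (op Z))
    (w_map : ∀ {b : B} {Z Z' : SchC} (f : Z' ⟶ Z) (p : Z ⟶ T) (v : Z ⟶ cov b)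
      (hZ : Nonempty Z.left) (hZ' : Nonempty Z'.left) (h : p ≫ s = v ≫ proj b),
      F.map f.op (w p v hZ h) = w (f ≫ p) (f ≫ v) hZ' (by simp [h]))
    (w_eq : ∀ {b b' : B} {Z : SchC} (p : Z ⟶ T) (v : Z ⟶ cov b) (v' : Z ⟶ cov b')
      (hZ : Nonempty Z.left) (h : p ≫ s = v ≫ proj b) (h' : p ≫ s = v' ≫ proj b'),
      w p v hZ h = w p v' hZ h') :
    ∃ t : F.obj (op T), ∀ {b : B} {Z : SchC} (p : Z ⟶ T) (v : Z ⟶ cov b) (hZ : Nonempty Z.left)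
      (h : p ≫ s = v ≫ proj b), F.map p.op t = w p v hZ h := by
  have w_eq' : ∀ {b b' : B} {Z : SchC} (p p' : Z ⟶ T) (v : Z ⟶ cov b) (v' : Z ⟶ cov b')
      (hZ : Nonempty Z.left) (h : p ≫ s = v ≫ proj b) (h' : p' ≫ s = v' ≫ proj b'), p = p' →
      w p v hZ h = w p' v' hZ h' := by
    rintro b b' Z p _ v v' hZ h h' rfl
    exact w_eq _ _ _ _ _ _
  let B' := {b : B // Nonempty ↥(pullback s.left (proj b).left)}
  let W : B' → Scheme := fun b => pullback s.left (proj b.1).left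
  let p : ∀ b, W b ⟶ T.left := fun b => pullback.fst _ _
  have hp : ∀ x : T.left, ∃ b, x ∈ Set.range (p b) := fun x => by
    obtain ⟨b, y, hy⟩ := surj (s.left x)
    obtain ⟨z, hz, -⟩ := Scheme.Pullback.exists_preimage_pullback x y hy.symm
    exact ⟨⟨b, ⟨z⟩⟩, z, hz⟩
  have he : ∀ b, Etale (p b) := fun b => by
    dsimp only [p]; have := etale b.1; infer_instance
  let Z : B' → SchC := fun b => Over.mk (p b ≫ T.hom)
  let P : ∀ b, Z b ⟶ T := fun b => Over.homMk (p b)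
  let V : ∀ b : B', Z b ⟶ cov b.1 := fun b => Over.homMk (pullback.snd _ _) (by
    simp only [Z, p, Over.mk_hom, ← Over.w (proj b.1), ← pullback.condition_assoc, Over.w s])
  have hPV : ∀ b, P b ≫ s = V b ≫ proj b.1 := fun b => by ext1; exact pullback.condition
  let φ : ∀ b, Z b ⟶ Y := fun b => r.homEquiv.symm (w (P b) (V b) b.2 (hPV b))
  obtain ⟨t, ht, -⟩ := Presieve.isSheafFor_arrows_iff _ _ |>.1
    (isSheafFor_etale_cover T.left Y.left W p he hp) (fun b => (φ b).left) (by
      intro b b' Q g g' hg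
      change g ≫ (φ b).left = g' ≫ (φ b').left
      by_cases hQ : Nonempty Q
      · let Q' : SchC := Over.mk (g ≫ p b ≫ T.hom)
        let G : Q' ⟶ Z b := Over.homMk g
        let G' : Q' ⟶ Z b' := Over.homMk g' (by
          simp only [Z, Q', Over.mk_hom]; rw [← Category.assoc, ← Category.assoc, hg])
        have hGP : G ≫ P b = G' ≫ P b' := by ext1; exact hg
        have : G ≫ φ b = G' ≫ φ b' := by
          simp only [φ, r.comp_homEquiv_symm]
          rw [w_map G _ _ _ hQ, w_map G' _ _ _ hQ]
          congr 1
          exact w_eq' _ _ _ _ _ _ _ hGP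
        exact congrArg (fun f => f.left) this
      · have : IsEmpty Q := not_nonempty_iff.1 hQ
        exact (isInitialOfIsEmpty (X := Q)).hom_ext _ _)
  have ht' : ∀ b, p b ≫ t = (φ b).left := ht
  have key : ∀ b, p b ≫ t ≫ Y.hom = p b ≫ T.hom := fun b => by
    rw [← Category.assoc, ht', Over.w]
    rfl
  have hover : t ≫ Y.hom = T.hom := by
    refine ((isSheafFor_etale_cover T.left (Spec (CommRingCat.of ℂ)) W p he hp).isSeparatedFor.ext ?_)
    rintro _ _ ⟨b⟩
    exact key b
  refine ⟨r.homEquiv (Over.homMk t hover), fun {b Q} q v hQ h => ?_⟩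
  refine glue_unique r cov proj etale surj (q ≫ s) _ _ fun {b' R} f v' hR h' => ?_
  have hcond : (f ≫ q).left ≫ s.left = v'.left ≫ (proj b').left := by
    rw [← Over.comp_left, ← Over.comp_left, Category.assoc, h']
  let y : R.left ⟶ pullback s.left (proj b').left := pullback.lift (f ≫ q).left v'.left hcond
  let b'' : B' := ⟨b', hR.map y⟩
  let y' : R ⟶ Z b'' := Over.homMk y (by
    simp only [Z, p, y, Over.mk_hom, W, b'']
    rw [pullback.lift_fst_assoc, Over.w])
  have e1 : y' ≫ P b'' = f ≫ q := by
    ext1; exact pullback.lift_fst _ _ _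
  have e2 : y' ≫ V b'' = v' := by
    ext1; exact pullback.lift_snd _ _ _
  have e3 : P b'' ≫ Over.homMk t hover = φ b'' := by ext1; exact ht' b''
  have e4 : F.map (P b'').op (r.homEquiv (Over.homMk t hover)) =
      w (P b'') (V b'') b''.2 (hPV b'') := by
    rw [← r.homEquiv_comp, e3]
    simp [φ]
  rw [w_map f q v hQ hR h, ← Functor.map_comp_apply, ← op_comp,
    show (f ≫ q).op = (P b'').op ≫ y'.op by rw [← e1]; rfl,
    Functor.map_comp_apply, e4, w_map y' _ _ _ hR]
  exact w_eq' _ _ _ _ _ _ _ e1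


/-- A disjoint union `⊔ᵢ Xᵢ/Gᵢ` of quotient stacks over `ℂ`, given by a family of schemes `Xᵢ` of
finite type and linear algebraic groups `Gᵢ` (affine group schemes of finite type) with a right
action of `Gᵢ` on `Xᵢ`. Schemes, groups and actions are written on the level of functors of points.
The stack itself is `QStack.toStack`. -/
structure QStack : Type 1 where
  ι : Type
  X : ι → SchCᵒᵖ ⥤ Type
  G : ι → SchCᵒᵖ ⥤ GrpCat.{0}
  X_finite : ∀ i, IsFiniteType (X i)
  G_linear : ∀ i, IsAffineFiniteType (G i ⋙ forget GrpCat)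
  act : ∀ (i : ι) {T : SchC}, (X i).obj (op T) → (G i).obj (op T) → (X i).obj (op T)
  act_one : ∀ (i : ι) {T : SchC} (x : (X i).obj (op T)), act i x 1 = x
  act_mul : ∀ (i : ι) {T : SchC} (x : (X i).obj (op T)) (g h : (G i).obj (op T)),
    act i x (g * h) = act i (act i x g) h
  act_map : ∀ (i : ι) {S T : SchC} (f : S ⟶ T) (x : (X i).obj (op T)) (g : (G i).obj (op T)),
    (X i).map f.op (act i x g) = act i ((X i).map f.op x) ((G i).map f.op g)

namespace QStack

/-- Restriction of a section along `u`, after identifying the indices `j` and `i`. -/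
def res (𝔛 : QStack) {j i : 𝔛.ι} (h : j = i) {U T : SchC} (u : T ⟶ U)
    (x : (𝔛.X j).obj (op U)) : (𝔛.X i).obj (op T) :=
  (𝔛.X i).map u.op (h ▸ x)

/-- An object of the stack `⊔ᵢ Xᵢ/Gᵢ` over the scheme `base`, i.e. a decomposition of `base` by
indices together with an étale locally trivial principal bundle and an equivariant map to `Xᵢ`,
written as étale descent data: an étale covering family `cov a ⟶ base`, for every `a` an index
`idx a` and a section `sec a` of `X (idx a)` over `cov a`, and on (nonempty) overlaps transition
elements `tr` of the group which move one section to the other and satisfy the cocycle condition.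
In `tr` the overlap of `cov a` and `cov b` is tested on all its points `(u, v) : T ⟶ cov a, cov b`. -/
structure Obj (𝔛 : QStack) : Type 1 where
  base : SchC
  A : Type
  cov : A → SchC
  proj : ∀ a, cov a ⟶ base
  etale : ∀ a, Etale (proj a).left
  surj : ∀ s : base.left, ∃ a, s ∈ Set.range (proj a).left
  idx : A → 𝔛.ι
  sec : ∀ a, (𝔛.X (idx a)).obj (op (cov a))
  idx_eq : ∀ {a b : A} {T : SchC} (u : T ⟶ cov a) (v : T ⟶ cov b), Nonempty T.left →
    u ≫ proj a = v ≫ proj b → idx a = idx b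
  tr : ∀ {i : 𝔛.ι} {a b : A} (_ : idx a = i) (_ : idx b = i) {T : SchC} (u : T ⟶ cov a)
    (v : T ⟶ cov b), Nonempty T.left → u ≫ proj a = v ≫ proj b → (𝔛.G i).obj (op T)
  tr_map : ∀ {i : 𝔛.ι} {a b : A} (ha : idx a = i) (hb : idx b = i) {S T : SchC} (f : S ⟶ T)
    (u : T ⟶ cov a) (v : T ⟶ cov b) (hS : Nonempty S.left) (hT : Nonempty T.left)
    (h : u ≫ proj a = v ≫ proj b),
    (𝔛.G i).map f.op (tr ha hb u v hT h) = tr ha hb (f ≫ u) (f ≫ v) hS (by simp [h])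
  act_tr : ∀ {i : 𝔛.ι} {a b : A} (ha : idx a = i) (hb : idx b = i) {T : SchC} (u : T ⟶ cov a)
    (v : T ⟶ cov b) (hT : Nonempty T.left) (h : u ≫ proj a = v ≫ proj b),
    𝔛.act i (𝔛.res ha u (sec a)) (tr ha hb u v hT h) = 𝔛.res hb v (sec b)
  tr_mul : ∀ {i : 𝔛.ι} {a b c : A} (ha : idx a = i) (hb : idx b = i) (hc : idx c = i) {T : SchC}
    (u : T ⟶ cov a) (v : T ⟶ cov b) (w : T ⟶ cov c) (hT : Nonempty T.left)
    (h : u ≫ proj a = v ≫ proj b) (h' : v ≫ proj b = w ≫ proj c),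
    tr ha hb u v hT h * tr hb hc v w hT h' = tr ha hc u w hT (h.trans h')

variable {𝔛 : QStack}

/-- A morphism of the stack `⊔ᵢ Xᵢ/Gᵢ` over a morphism `base` of schemes: a morphism of descent
data, given by elements `k` of the groups on the (nonempty) overlaps of the covering of the source
with the pull-back of the covering of the target. -/
structure Hom (x y : Obj 𝔛) : Type 1 where
  base : x.base ⟶ y.base
  idx_eq : ∀ {a : x.A} {b : y.A} {T : SchC} (u : T ⟶ x.cov a) (v : T ⟶ y.cov b),
    Nonempty T.left → u ≫ x.proj a ≫ base = v ≫ y.proj b → x.idx a = y.idx b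
  k : ∀ {i : 𝔛.ι} {a : x.A} {b : y.A} (_ : x.idx a = i) (_ : y.idx b = i) {T : SchC}
    (u : T ⟶ x.cov a) (v : T ⟶ y.cov b), Nonempty T.left →
    u ≫ x.proj a ≫ base = v ≫ y.proj b → (𝔛.G i).obj (op T)
  k_map : ∀ {i : 𝔛.ι} {a : x.A} {b : y.A} (ha : x.idx a = i) (hb : y.idx b = i) {S T : SchC}
    (f : S ⟶ T) (u : T ⟶ x.cov a) (v : T ⟶ y.cov b) (hS : Nonempty S.left)
    (hT : Nonempty T.left) (h : u ≫ x.proj a ≫ base = v ≫ y.proj b),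
    (𝔛.G i).map f.op (k ha hb u v hT h) = k ha hb (f ≫ u) (f ≫ v) hS (by simp [h])
  act_k : ∀ {i : 𝔛.ι} {a : x.A} {b : y.A} (ha : x.idx a = i) (hb : y.idx b = i) {T : SchC}
    (u : T ⟶ x.cov a) (v : T ⟶ y.cov b) (hT : Nonempty T.left)
    (h : u ≫ x.proj a ≫ base = v ≫ y.proj b),
    𝔛.act i (𝔛.res ha u (x.sec a)) (k ha hb u v hT h) = 𝔛.res hb v (y.sec b)
  tr_k : ∀ {i : 𝔛.ι} {a a' : x.A} {b : y.A} (ha : x.idx a = i) (ha' : x.idx a' = i)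
    (hb : y.idx b = i) {T : SchC} (u : T ⟶ x.cov a) (u' : T ⟶ x.cov a') (v : T ⟶ y.cov b)
    (hT : Nonempty T.left) (h : u ≫ x.proj a = u' ≫ x.proj a')
    (h' : u' ≫ x.proj a' ≫ base = v ≫ y.proj b),
    x.tr ha ha' u u' hT h * k ha' hb u' v hT h' =
      k ha hb u v hT (by rw [← Category.assoc, h, Category.assoc, h'])
  k_tr : ∀ {i : 𝔛.ι} {a : x.A} {b b' : y.A} (ha : x.idx a = i) (hb : y.idx b = i)
    (hb' : y.idx b' = i) {T : SchC} (u : T ⟶ x.cov a) (v : T ⟶ y.cov b) (v' : T ⟶ y.cov b')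
    (hT : Nonempty T.left) (h : u ≫ x.proj a ≫ base = v ≫ y.proj b)
    (h' : v ≫ y.proj b = v' ≫ y.proj b'),
    k ha hb u v hT h * y.tr hb hb' v v' hT h' = k ha hb' u v' hT (h.trans h')

lemma Hom.ext' {x y : Obj 𝔛} (f g : Hom x y) (hbase : f.base = g.base)
    (hk : ∀ {i : 𝔛.ι} {a : x.A} {b : y.A} (ha : x.idx a = i) (hb : y.idx b = i) {T : SchC}
      (u : T ⟶ x.cov a) (v : T ⟶ y.cov b) (hT : Nonempty T.left)
      (h : u ≫ x.proj a ≫ f.base = v ≫ y.proj b)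
      (h' : u ≫ x.proj a ≫ g.base = v ≫ y.proj b), f.k ha hb u v hT h = g.k ha hb u v hT h') :
    f = g := by
  obtain ⟨fb, _, fk, _, _, _, _⟩ := f
  obtain ⟨gb, _, gk, _, _, _, _⟩ := g
  obtain rfl : fb = gb := hbase
  have : @fk = @gk := by
    funext i a b ha hb T u v hT h
    exact hk ha hb u v hT h h
  subst this
  rfl

/-- The identity morphism. -/
def idHom (x : Obj 𝔛) : Hom x x where
  base := 𝟙 _
  idx_eq u v hT h := x.idx_eq u v hT (by simpa using h)
  k ha hb _ u v hT h := x.tr ha hb u v hT (by simpa using h)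
  k_map ha hb _ _ f u v hS hT h := x.tr_map ha hb f u v hS hT _
  act_k ha hb _ u v hT h := x.act_tr ha hb u v hT _
  tr_k ha ha' hb _ u u' v hT h h' := x.tr_mul ha ha' hb u u' v hT h _
  k_tr ha hb hb' _ u v v' hT h h' := x.tr_mul ha hb hb' u v v' hT _ h'

lemma exists_comp {x y z : Obj 𝔛} (f : Hom x y) (g : Hom y z) {i : 𝔛.ι} {a : x.A} {c : z.A}
    (ha : x.idx a = i) (hc : z.idx c = i) {T : SchC} (u : T ⟶ x.cov a) (w : T ⟶ z.cov c)
    (h : u ≫ x.proj a ≫ f.base ≫ g.base = w ≫ z.proj c) :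
    ∃ t : (𝔛.G i).obj (op T), ∀ {b : y.A} (hb : y.idx b = i) {Z : SchC} (p : Z ⟶ T)
      (v : Z ⟶ y.cov b) (hZ : Nonempty Z.left)
      (h1 : (p ≫ u) ≫ x.proj a ≫ f.base = v ≫ y.proj b)
      (h2 : v ≫ y.proj b ≫ g.base = (p ≫ w) ≫ z.proj c),
      (𝔛.G i).map p.op t = f.k ha hb (p ≫ u) v hZ h1 * g.k hb hc v (p ≫ w) hZ h2 := by
  obtain ⟨Y, -, -, ⟨r⟩⟩ := 𝔛.G_linear i
  have hb : ∀ {b : y.A} {Z : SchC} (p : Z ⟶ T) (v : Z ⟶ y.cov b), Nonempty Z.left →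
      p ≫ u ≫ x.proj a ≫ f.base = v ≫ y.proj b → y.idx b = i := by
    intro b Z p v hZ hp
    rw [← ha]
    exact (f.idx_eq (p ≫ u) v hZ (by simpa using hp)).symm
  have h2 : ∀ {b : y.A} {Z : SchC} (p : Z ⟶ T) (v : Z ⟶ y.cov b),
      p ≫ u ≫ x.proj a ≫ f.base = v ≫ y.proj b →
      v ≫ y.proj b ≫ g.base = (p ≫ w) ≫ z.proj c := by
    intro b Z p v hp
    rw [Category.assoc, ← h, ← Category.assoc, ← hp]
    simp
  obtain ⟨t, ht⟩ := exists_glue r y.cov y.proj y.etale y.surj (u ≫ x.proj a ≫ f.base)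
    (fun {b Z} p v hZ hp => (f.k ha (hb p v hZ hp) (p ≫ u) v hZ (by simpa using hp) *
      g.k (hb p v hZ hp) hc v (p ≫ w) hZ (h2 p v hp) : (𝔛.G i).obj (op Z)))
    (by
      intro b Z Z' q p v hZ hZ' hp
      have := hb p v hZ hp
      change (𝔛.G i).map q.op (_ * _) = _
      rw [map_mul, f.k_map _ _ _ _ _ hZ', g.k_map _ _ _ _ _ hZ']
      simp only [Category.assoc])
    (by
      intro b b' Z p v v' hZ hp hp'
      have e := hb p v hZ hp
      have e' := hb p v' hZ hp'
      rw [← f.k_tr ha e e' (p ≫ u) v v' hZ (by simpa using hp) (hp.symm.trans hp'),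
        ← g.tr_k e e' hc v v' (p ≫ w) hZ (hp.symm.trans hp') (h2 p v' hp'), mul_assoc])
  exact ⟨t, fun {b} hb Z p v hZ h1 h2 => ht p v hZ (by simpa using h1)⟩

lemma glue_eq {y : Obj 𝔛} {i : 𝔛.ι} {T : SchC} (s : T ⟶ y.base)
    (t t' : (𝔛.G i).obj (op T))
    (h : ∀ {b : y.A} {Z : SchC} (p : Z ⟶ T) (v : Z ⟶ y.cov b), Nonempty Z.left →
      p ≫ s = v ≫ y.proj b → (𝔛.G i).map p.op t = (𝔛.G i).map p.op t') : t = t' := by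
  obtain ⟨Y, -, -, ⟨r⟩⟩ := 𝔛.G_linear i
  exact glue_unique r y.cov y.proj y.etale y.surj s t t' h

lemma exists_local (y : Obj 𝔛) {T : SchC} (hT : Nonempty T.left) (s : T ⟶ y.base) :
    ∃ (b : y.A) (Z : SchC) (p : Z ⟶ T) (v : Z ⟶ y.cov b), Nonempty Z.left ∧
      p ≫ s = v ≫ y.proj b := by
  obtain ⟨x⟩ := hT
  obtain ⟨b, w, hw⟩ := y.surj (s.left x)
  obtain ⟨z, -, -⟩ := Scheme.Pullback.exists_preimage_pullback x w hw.symm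
  let Z : SchC := Over.mk (pullback.fst s.left (y.proj b).left ≫ T.hom)
  let P : Z ⟶ T := Over.homMk (pullback.fst s.left (y.proj b).left)
  let V : Z ⟶ y.cov b := Over.homMk (pullback.snd s.left (y.proj b).left) (by
    simp only [Z, Over.mk_hom, ← Over.w (y.proj b), ← pullback.condition_assoc, Over.w s])
  exact ⟨b, Z, P, V, ⟨z⟩, by ext1; exact pullback.condition⟩

/-- Composition of morphisms of descent data: locally the product of the group elements, glued
by étale descent. -/
def compHom {x y z : Obj 𝔛} (f : Hom x y) (g : Hom y z) : Hom x z where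
  base := f.base ≫ g.base
  idx_eq := by
    intro a c T u w hT h
    obtain ⟨b, Z, p, v, hZ, e⟩ := exists_local y hT (u ≫ x.proj a ≫ f.base)
    refine (f.idx_eq (p ≫ u) v hZ (by simpa using e)).trans (g.idx_eq v (p ≫ w) hZ ?_)
    rw [← reassoc_of% e, h]
    simp
  k ha hc _ u w _ h := (exists_comp f g ha hc u w h).choose
  k_map := by
    intro i a c ha hc S T q u w hS hT h
    refine glue_eq (y := y) (q ≫ u ≫ x.proj a ≫ f.base) _ _ fun {b Z} p v hZ hp => ?_
    have hb : y.idx b = i := by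
      rw [← ha]; exact (f.idx_eq ((p ≫ q) ≫ u) v hZ (by simpa using hp)).symm
    rw [← Functor.map_comp_apply, ← op_comp]
    have h1 : ((p ≫ q) ≫ u) ≫ x.proj a ≫ f.base = v ≫ y.proj b := by simpa using hp
    have h2 : v ≫ y.proj b ≫ g.base = ((p ≫ q) ≫ w) ≫ z.proj c := by
      rw [← reassoc_of% h1, h]; simp
    rw [(exists_comp f g ha hc u w h).choose_spec hb (p ≫ q) v hZ h1 h2,
      (exists_comp f g ha hc (q ≫ u) (q ≫ w) (by simp [h])).choose_spec hb p v hZ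
        (by simpa using hp) (by simpa using h2)]
    simp only [Category.assoc]
  act_k := by
    intro i a c ha hc T u w hT h
    obtain ⟨Y, -, -, ⟨r⟩⟩ := 𝔛.X_finite i
    refine glue_unique r y.cov y.proj y.etale y.surj (u ≫ x.proj a ≫ f.base) _ _
      fun {b Z} p v hZ hp => ?_
    have hb : y.idx b = i := by
      rw [← ha]; exact (f.idx_eq (p ≫ u) v hZ (by simpa using hp)).symm
    have h1 : (p ≫ u) ≫ x.proj a ≫ f.base = v ≫ y.proj b := by simpa using hp
    have h2 : v ≫ y.proj b ≫ g.base = (p ≫ w) ≫ z.proj c := by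
      rw [← reassoc_of% h1, h]; simp
    rw [𝔛.act_map, (exists_comp f g ha hc u w h).choose_spec hb p v hZ h1 h2, 𝔛.act_mul]
    have e1 := f.act_k ha hb (p ≫ u) v hZ h1
    have e2 := g.act_k hb hc v (p ≫ w) hZ h2
    simp only [res, op_comp, Functor.map_comp_apply] at e1 e2 ⊢
    rw [e1, e2]
  tr_k := by
    intro i a a' c ha ha' hc T u u' w hT h h'
    refine glue_eq (y := y) (u ≫ x.proj a ≫ f.base) _ _ fun {b Z} p v hZ hp => ?_
    have hb : y.idx b = i := by
      rw [← ha]; exact (f.idx_eq (p ≫ u) v hZ (by simpa using hp)).symm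
    have h1 : (p ≫ u) ≫ x.proj a ≫ f.base = v ≫ y.proj b := by simpa using hp
    have h1' : (p ≫ u') ≫ x.proj a' ≫ f.base = v ≫ y.proj b := by
      rw [← h1]; simp only [Category.assoc]; rw [reassoc_of% h]
    have h2 : v ≫ y.proj b ≫ g.base = (p ≫ w) ≫ z.proj c := by
      rw [← reassoc_of% h1', h']; simp
    rw [map_mul, x.tr_map _ _ _ _ _ hZ,
      (exists_comp f g ha' hc u' w h').choose_spec hb p v hZ h1' h2,
      (exists_comp f g ha hc u w (by rw [reassoc_of% h, h'])).choose_spec hb p v hZ h1 h2, ← mul_assoc,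
      f.tr_k ha ha' hb (p ≫ u) (p ≫ u') v hZ (by simp [h]) h1']
  k_tr := by
    intro i a c c' ha hc hc' T u w w' hT h h'
    refine glue_eq (y := y) (u ≫ x.proj a ≫ f.base) _ _ fun {b Z} p v hZ hp => ?_
    have hb : y.idx b = i := by
      rw [← ha]; exact (f.idx_eq (p ≫ u) v hZ (by simpa using hp)).symm
    have h1 : (p ≫ u) ≫ x.proj a ≫ f.base = v ≫ y.proj b := by simpa using hp
    have h2 : v ≫ y.proj b ≫ g.base = (p ≫ w) ≫ z.proj c := by
      rw [← reassoc_of% h1, h]; simp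
    have h2' : v ≫ y.proj b ≫ g.base = (p ≫ w') ≫ z.proj c' := by
      rw [h2]; simp [h']
    rw [map_mul, z.tr_map _ _ _ _ _ hZ,
      (exists_comp f g ha hc u w h).choose_spec hb p v hZ h1 h2,
      (exists_comp f g ha hc' u w' (h.trans h')).choose_spec hb p v hZ h1 h2', mul_assoc,
      g.k_tr hb hc hc' v (p ≫ w) (p ≫ w') hZ h2 (by simp [h'])]

lemma compHom_k {x y z : Obj 𝔛} (f : Hom x y) (g : Hom y z) {i : 𝔛.ι} {a : x.A} {b : y.A}
    {c : z.A} (ha : x.idx a = i) (hb : y.idx b = i) (hc : z.idx c = i) {T : SchC}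
    (u : T ⟶ x.cov a) (v : T ⟶ y.cov b) (w : T ⟶ z.cov c) (hT : Nonempty T.left)
    (h1 : u ≫ x.proj a ≫ f.base = v ≫ y.proj b) (h2 : v ≫ y.proj b ≫ g.base = w ≫ z.proj c)
    (h : u ≫ x.proj a ≫ (compHom f g).base = w ≫ z.proj c) :
    (compHom f g).k ha hc u w hT h = f.k ha hb u v hT h1 * g.k hb hc v w hT h2 := by
  have := (exists_comp f g ha hc u w h).choose_spec hb (𝟙 T) v hT (by simpa using h1)
    (by simpa using h2)
  simp only [op_id, Category.id_comp] at this
  rw [(𝔛.G i).map_id] at this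
  exact this

lemma idHom_comp {x y : Obj 𝔛} (f : Hom x y) : compHom (idHom x) f = f := by
  refine Hom.ext' _ _ (Category.id_comp _) fun {i a c} ha hc T u w hT h h' => ?_
  refine (compHom_k (idHom x) f ha ha hc u u w hT (by simp [idHom]) h' h).trans ?_
  exact f.tr_k ha ha hc u u w hT rfl h'

lemma comp_idHom {x y : Obj 𝔛} (f : Hom x y) : compHom f (idHom y) = f := by
  refine Hom.ext' _ _ (Category.comp_id _) fun {i a c} ha hc T u w hT h h' => ?_
  refine (compHom_k f (idHom y) ha hc hc u w w hT h' (by simp [idHom]) h).trans ?_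
  exact f.k_tr ha hc hc u w w hT h' rfl

lemma compHom_assoc {x y z t : Obj 𝔛} (f : Hom x y) (g : Hom y z) (l : Hom z t) :
    compHom (compHom f g) l = compHom f (compHom g l) := by
  refine Hom.ext' _ _ (Category.assoc _ _ _) fun {i a d} ha hd T u w hT h h' => ?_
  have h0 : u ≫ x.proj a ≫ f.base ≫ g.base ≫ l.base = w ≫ t.proj d := h'
  refine glue_eq (y := y) (u ≫ x.proj a ≫ f.base) _ _ fun {b Z} p v hZ hp => ?_
  rw [(compHom (compHom f g) l).k_map _ _ _ _ _ hZ, (compHom f (compHom g l)).k_map _ _ _ _ _ hZ]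
  have hb : y.idx b = i := by
    rw [← ha]; exact (f.idx_eq (p ≫ u) v hZ (by simpa using hp)).symm
  refine glue_eq (y := z) (v ≫ y.proj b ≫ g.base) _ _ fun {c Z'} p' v' hZ' hp' => ?_
  rw [(compHom (compHom f g) l).k_map _ _ _ _ _ hZ', (compHom f (compHom g l)).k_map _ _ _ _ _ hZ']
  have hc : z.idx c = i := by
    rw [← hb]; exact (g.idx_eq (p' ≫ v) v' hZ' (by simpa using hp')).symm
  have e1 : (p' ≫ p ≫ u) ≫ x.proj a ≫ f.base = (p' ≫ v) ≫ y.proj b := by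
    simp [hp]
  have e2 : (p' ≫ v) ≫ y.proj b ≫ g.base = v' ≫ z.proj c := by simpa using hp'
  have e3 : v' ≫ z.proj c ≫ l.base = (p' ≫ p ≫ w) ≫ t.proj d := by
    rw [← reassoc_of% e2, ← reassoc_of% hp, h0]; simp
  have e12 : (p' ≫ p ≫ u) ≫ x.proj a ≫ (compHom f g).base = v' ≫ z.proj c := by
    change (p' ≫ p ≫ u) ≫ x.proj a ≫ f.base ≫ g.base = _
    simp only [Category.assoc]
    rw [reassoc_of% hp, hp']
  have e23 : (p' ≫ v) ≫ y.proj b ≫ (compHom g l).base = (p' ≫ p ≫ w) ≫ t.proj d := by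
    change (p' ≫ v) ≫ y.proj b ≫ g.base ≫ l.base = _
    simp only [Category.assoc]
    rw [reassoc_of% hp', e3, Category.assoc, Category.assoc]
  rw [compHom_k (compHom f g) l ha hc hd _ v' _ hZ' e12 e3,
    compHom_k f g ha hb hc _ (p' ≫ v) _ hZ' e1 e2,
    compHom_k f (compHom g l) ha hb hd _ (p' ≫ v) _ hZ' e1 e23,
    compHom_k g l hb hc hd _ v' _ hZ' e2 e3, mul_assoc]

instance : Category.{1} (Obj 𝔛) where
  Hom := Hom
  id := idHom
  comp := compHom
  id_comp := idHom_comp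
  comp_id := comp_idHom
  assoc := compHom_assoc

/-- The stack `⊔ᵢ Xᵢ/Gᵢ`, as a category fibred in groupoids over the category of schemes
over `ℂ`. -/
def toStack (𝔛 : QStack) : BasedCategory.{1, 1} SchC where
  obj := Obj 𝔛
  p := { obj := Obj.base, map := Hom.base }

/-- 1-morphisms between (disjoint unions of) quotient stacks: functors between the fibred
categories which commute with the projections to the category of schemes. The 2-morphisms between
them are the isomorphisms in the category `𝔛.toStack ⥤ᵇ 𝔜.toStack`. -/
abbrev Mor (𝔛 𝔜 : QStack) := 𝔛.toStack ⥤ᵇ 𝔜.toStack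

/-- Equivariant maps between presentations: a map of index sets together with morphisms
`Xᵢ ⟶ Y_{idx i}` which are equivariant with respect to homomorphisms `Gᵢ ⟶ H_{idx i}`. They induce
1-morphisms of stacks, but not every 1-morphism is of this form. -/
structure EqMap (𝔛 𝔜 : QStack) where
  idx : 𝔛.ι → 𝔜.ι
  onX : ∀ (i : 𝔛.ι) {T : SchC}, (𝔛.X i).obj (op T) → (𝔜.X (idx i)).obj (op T)
  onG : ∀ (i : 𝔛.ι) {T : SchC}, (𝔛.G i).obj (op T) → (𝔜.G (idx i)).obj (op T)
  onX_map : ∀ (i : 𝔛.ι) {S T : SchC} (f : S ⟶ T) (x : (𝔛.X i).obj (op T)),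
    (𝔜.X (idx i)).map f.op (onX i x) = onX i ((𝔛.X i).map f.op x)
  onG_map : ∀ (i : 𝔛.ι) {S T : SchC} (f : S ⟶ T) (g : (𝔛.G i).obj (op T)),
    (𝔜.G (idx i)).map f.op (onG i g) = onG i ((𝔛.G i).map f.op g)
  onG_mul : ∀ (i : 𝔛.ι) {T : SchC} (g h : (𝔛.G i).obj (op T)),
    onG i (g * h) = onG i g * onG i h
  onX_act : ∀ (i : 𝔛.ι) {T : SchC} (x : (𝔛.X i).obj (op T)) (g : (𝔛.G i).obj (op T)),
    onX i (𝔛.act i x g) = 𝔜.act (idx i) (onX i x) (onG i g)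

namespace EqMap

variable {𝔛 𝔜 ℨ : QStack}

def id (𝔛 : QStack) : EqMap 𝔛 𝔛 where
  idx i := i
  onX _ _ x := x
  onG _ _ g := g
  onX_map _ _ _ _ _ := rfl
  onG_map _ _ _ _ _ := rfl
  onG_mul _ _ _ _ := rfl
  onX_act _ _ _ _ := rfl

def comp (φ : EqMap 𝔛 𝔜) (ψ : EqMap 𝔜 ℨ) : EqMap 𝔛 ℨ where
  idx i := ψ.idx (φ.idx i)
  onX i _ x := ψ.onX _ (φ.onX i x)
  onG i _ g := ψ.onG _ (φ.onG i g)
  onX_map i _ _ f x := by rw [ψ.onX_map, φ.onX_map]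
  onG_map i _ _ f g := by rw [ψ.onG_map, φ.onG_map]
  onG_mul i _ g h := by rw [φ.onG_mul, ψ.onG_mul]
  onX_act i _ x g := by rw [φ.onX_act, ψ.onX_act]

variable (φ : EqMap 𝔛 𝔜)

/-- The homomorphism `onG i` with target rewritten along an equality of indices. -/
def onG' {i : 𝔛.ι} {j : 𝔜.ι} (h : φ.idx i = j) {T : SchC} (g : (𝔛.G i).obj (op T)) :
    (𝔜.G j).obj (op T) :=
  h ▸ φ.onG i g

lemma onG'_map {i : 𝔛.ι} {j : 𝔜.ι} (h : φ.idx i = j) {S T : SchC} (f : S ⟶ T)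
    (g : (𝔛.G i).obj (op T)) :
    (𝔜.G j).map f.op (φ.onG' h g) = φ.onG' h ((𝔛.G i).map f.op g) := by
  subst h; exact φ.onG_map i f g

lemma onG'_mul {i : 𝔛.ι} {j : 𝔜.ι} (h : φ.idx i = j) {T : SchC} (g g' : (𝔛.G i).obj (op T)) :
    φ.onG' h (g * g') = φ.onG' h g * φ.onG' h g' := by
  subst h; exact φ.onG_mul i g g'

lemma res_act_onG' {i i₁ i₂ : 𝔛.ι} {j : 𝔜.ι} (h : φ.idx i = j) (h₁ : i₁ = i) (h₂ : i₂ = i)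
    (h₁' : φ.idx i₁ = j) (h₂' : φ.idx i₂ = j) {U₁ U₂ T : SchC} (u₁ : T ⟶ U₁) (u₂ : T ⟶ U₂)
    (x₁ : (𝔛.X i₁).obj (op U₁)) (x₂ : (𝔛.X i₂).obj (op U₂)) (g : (𝔛.G i).obj (op T))
    (e : 𝔛.act i (𝔛.res h₁ u₁ x₁) g = 𝔛.res h₂ u₂ x₂) :
    𝔜.act j (𝔜.res h₁' u₁ (φ.onX i₁ x₁)) (φ.onG' h g) = 𝔜.res h₂' u₂ (φ.onX i₂ x₂) := by
  subst h h₁ h₂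
  simp only [res, onG'] at e ⊢
  rw [φ.onX_map, φ.onX_map, ← e, φ.onX_act]

/-- The transition elements of the image of `x`. -/
def mapTr (x : Obj 𝔛) {j : 𝔜.ι} {a b : x.A} (ha : φ.idx (x.idx a) = j) {T : SchC}
    (u : T ⟶ x.cov a) (v : T ⟶ x.cov b) (hT : Nonempty T.left)
    (h : u ≫ x.proj a = v ≫ x.proj b) : (𝔜.G j).obj (op T) :=
  φ.onG' ha (x.tr rfl (x.idx_eq u v hT h).symm u v hT h)

lemma mapTr_eq (x : Obj 𝔛) {i : 𝔛.ι} {j : 𝔜.ι} {a b : x.A} (ha : φ.idx (x.idx a) = j) {T : SchC}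
    (u : T ⟶ x.cov a) (v : T ⟶ x.cov b) (hT : Nonempty T.left)
    (h : u ≫ x.proj a = v ≫ x.proj b) (hi : φ.idx i = j) (hai : x.idx a = i)
    (hbi : x.idx b = i) : φ.mapTr x ha u v hT h = φ.onG' hi (x.tr hai hbi u v hT h) := by
  subst hai; rfl

/-- The image of an object under an equivariant map. -/
def mapObj (x : Obj 𝔛) : Obj 𝔜 where
  base := x.base
  A := x.A
  cov := x.cov
  proj := x.proj
  etale := x.etale
  surj := x.surj
  idx a := φ.idx (x.idx a)
  sec a := φ.onX _ (x.sec a)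
  idx_eq u v hT h := congrArg φ.idx (x.idx_eq u v hT h)
  tr ha _ _ u v hT h := φ.mapTr x ha u v hT h
  tr_map ha hb S T f u v hS hT h := by
    rw [mapTr, φ.onG'_map, x.tr_map _ _ _ _ _ hS]; rfl
  act_tr ha hb T u v hT h := φ.res_act_onG' _ _ _ _ _ _ _ _ _ _ (x.act_tr rfl _ u v hT h)
  tr_mul {i a b c} ha hb hc T u v w hT h h' := by
    have hab := x.idx_eq u v hT h
    have hbc := x.idx_eq v w hT h'
    rw [φ.mapTr_eq x ha u v hT h ha rfl hab.symm,
      φ.mapTr_eq x hb v w hT h' ha hab.symm (hab.trans hbc).symm,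
      φ.mapTr_eq x ha u w hT (h.trans h') ha rfl (hab.trans hbc).symm,
      ← φ.onG'_mul, x.tr_mul]

variable {φ}

/-- The group elements of the image of `f`. -/
def mapK {x y : Obj 𝔛} (f : Hom x y) {j : 𝔜.ι} {a : x.A} {b : y.A} (ha : φ.idx (x.idx a) = j)
    {T : SchC} (u : T ⟶ x.cov a) (v : T ⟶ y.cov b) (hT : Nonempty T.left)
    (h : u ≫ x.proj a ≫ f.base = v ≫ y.proj b) : (𝔜.G j).obj (op T) :=
  φ.onG' ha (f.k rfl (f.idx_eq u v hT h).symm u v hT h)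

lemma mapK_eq {x y : Obj 𝔛} (f : Hom x y) {i : 𝔛.ι} {j : 𝔜.ι} {a : x.A} {b : y.A}
    (ha : φ.idx (x.idx a) = j) {T : SchC} (u : T ⟶ x.cov a) (v : T ⟶ y.cov b)
    (hT : Nonempty T.left) (h : u ≫ x.proj a ≫ f.base = v ≫ y.proj b) (hi : φ.idx i = j)
    (hai : x.idx a = i) (hbi : y.idx b = i) :
    mapK f ha u v hT h = φ.onG' hi (f.k hai hbi u v hT h) := by
  subst hai; rfl

lemma mapK_map {x y : Obj 𝔛} (f : Hom x y) {j : 𝔜.ι} {a : x.A} {b : y.A}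
    (ha : φ.idx (x.idx a) = j) {S T : SchC} (q : S ⟶ T) (u : T ⟶ x.cov a) (v : T ⟶ y.cov b)
    (hS : Nonempty S.left) (hT : Nonempty T.left) (h : u ≫ x.proj a ≫ f.base = v ≫ y.proj b) :
    (𝔜.G j).map q.op (mapK f ha u v hT h) = mapK f ha (q ≫ u) (q ≫ v) hS (by simp [h]) := by
  rw [mapK, φ.onG'_map, f.k_map _ _ _ _ _ hS]; rfl

lemma tr_mapK {x y : Obj 𝔛} (f : Hom x y) {j : 𝔜.ι} {a a' : x.A} {b : y.A}
    (ha : φ.idx (x.idx a) = j) (ha' : φ.idx (x.idx a') = j) {T : SchC} (u : T ⟶ x.cov a)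
    (u' : T ⟶ x.cov a') (v : T ⟶ y.cov b) (hT : Nonempty T.left)
    (h : u ≫ x.proj a = u' ≫ x.proj a') (h' : u' ≫ x.proj a' ≫ f.base = v ≫ y.proj b)
    (h'' : u ≫ x.proj a ≫ f.base = v ≫ y.proj b) :
    φ.mapTr x ha u u' hT h * mapK f ha' u' v hT h' = mapK f ha u v hT h'' := by
  have hab := x.idx_eq u u' hT h
  have hbc := f.idx_eq u' v hT h'
  rw [φ.mapTr_eq x ha u u' hT h ha rfl hab.symm,
    mapK_eq f ha' u' v hT h' ha hab.symm (hab.trans hbc).symm,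
    mapK_eq f ha u v hT h'' ha rfl (hab.trans hbc).symm, ← φ.onG'_mul, f.tr_k]

lemma mapK_tr {x y : Obj 𝔛} (f : Hom x y) {j : 𝔜.ι} {a : x.A} {b b' : y.A}
    (ha : φ.idx (x.idx a) = j) (hb : φ.idx (y.idx b) = j) {T : SchC} (u : T ⟶ x.cov a)
    (v : T ⟶ y.cov b) (v' : T ⟶ y.cov b') (hT : Nonempty T.left)
    (h : u ≫ x.proj a ≫ f.base = v ≫ y.proj b) (h' : v ≫ y.proj b = v' ≫ y.proj b')
    (h'' : u ≫ x.proj a ≫ f.base = v' ≫ y.proj b') :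
    mapK f ha u v hT h * φ.mapTr y hb v v' hT h' = mapK f ha u v' hT h'' := by
  have hab := f.idx_eq u v hT h
  have hbc := y.idx_eq v v' hT h'
  rw [mapK_eq f ha u v hT h ha rfl hab.symm,
    φ.mapTr_eq y hb v v' hT h' ha hab.symm (hab.trans hbc).symm,
    mapK_eq f ha u v' hT h'' ha rfl (hab.trans hbc).symm, ← φ.onG'_mul, f.k_tr]

lemma mapK_mul {x y z : Obj 𝔛} (f : Hom x y) (g : Hom y z) {j : 𝔜.ι} {a : x.A} {b : y.A}
    {c : z.A} (ha : φ.idx (x.idx a) = j) (hb : φ.idx (y.idx b) = j) {T : SchC}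
    (u : T ⟶ x.cov a) (v : T ⟶ y.cov b) (w : T ⟶ z.cov c) (hT : Nonempty T.left)
    (h1 : u ≫ x.proj a ≫ f.base = v ≫ y.proj b) (h2 : v ≫ y.proj b ≫ g.base = w ≫ z.proj c)
    (h : u ≫ x.proj a ≫ (compHom f g).base = w ≫ z.proj c) :
    mapK (compHom f g) ha u w hT h = mapK f ha u v hT h1 * mapK g hb v w hT h2 := by
  have hab := f.idx_eq u v hT h1
  have hbc := g.idx_eq v w hT h2
  rw [mapK_eq f ha u v hT h1 ha rfl hab.symm,
    mapK_eq g hb v w hT h2 ha hab.symm (hab.trans hbc).symm,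
    mapK_eq (compHom f g) ha u w hT h ha rfl (hab.trans hbc).symm, ← φ.onG'_mul,
    compHom_k f g rfl hab.symm _ u v w hT h1 h2]

variable (φ)

/-- The image of a morphism under an equivariant map. -/
def mapHom {x y : Obj 𝔛} (f : Hom x y) : Hom (φ.mapObj x) (φ.mapObj y) where
  base := f.base
  idx_eq u v hT h := congrArg φ.idx (f.idx_eq u v hT h)
  k ha _ _ u v hT h := mapK f ha u v hT h
  k_map ha _ _ _ q u v hS hT h := mapK_map f ha q u v hS hT h
  act_k _ _ _ u v hT h := φ.res_act_onG' _ _ _ _ _ _ _ _ _ _ (f.act_k rfl _ u v hT h)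
  tr_k ha ha' _ _ u u' v hT h h' := tr_mapK f ha ha' u u' v hT h h' _
  k_tr ha hb _ _ u v v' hT h h' := mapK_tr f ha hb u v v' hT h h' _

lemma aux_comp {x y z : Obj 𝔛} (f : Hom x y) (g : Hom y z) {a : x.A} {b : y.A} {c : z.A}
    {T Z : SchC} (u : T ⟶ x.cov a) (w : T ⟶ z.cov c) (p : Z ⟶ T) (v : Z ⟶ y.cov b)
    (h : u ≫ x.proj a ≫ f.base ≫ g.base = w ≫ z.proj c)
    (hp : p ≫ u ≫ x.proj a ≫ f.base = v ≫ y.proj b) :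
    v ≫ y.proj b ≫ g.base = (p ≫ w) ≫ z.proj c := by
  rw [← reassoc_of% hp, h, Category.assoc]

lemma mapHom_comp {x y z : Obj 𝔛} (f : Hom x y) (g : Hom y z) :
    φ.mapHom (compHom f g) = compHom (φ.mapHom f) (φ.mapHom g) := by
  refine Hom.ext' _ _ rfl fun {j a c} ha hc T u w hT h h' => ?_
  refine glue_eq (y := φ.mapObj y) (u ≫ x.proj a ≫ f.base) _ _ fun {b Z} p v hZ hp => ?_
  have hp' : p ≫ u ≫ x.proj a ≫ f.base = v ≫ y.proj b := hp
  have h1 : (p ≫ u) ≫ x.proj a ≫ f.base = v ≫ y.proj b := by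
    rw [Category.assoc]; exact hp'
  have h0 : u ≫ x.proj a ≫ f.base ≫ g.base = w ≫ z.proj c := h
  have h2 := aux_comp f g u w p v h0 hp'
  have h3 : (p ≫ u) ≫ x.proj a ≫ f.base ≫ g.base = (p ≫ w) ≫ z.proj c := by
    rw [Category.assoc, h0]; exact (Category.assoc _ _ _).symm
  have hab := f.idx_eq (p ≫ u) v hZ h1
  have hb : φ.idx (y.idx b) = j := by rw [← hab]; exact ha
  refine (mapK_map (compHom f g) ha p u w hZ hT h).trans
    ((mapK_mul f g ha hb _ v _ hZ h1 h2 h3).trans ?_)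
  refine Eq.trans ?_ ((compHom (φ.mapHom f) (φ.mapHom g)).k_map ha hc p u w hZ hT h').symm
  exact (compHom_k (φ.mapHom f) (φ.mapHom g) ha hb hc _ v _ hZ h1 h2 h3).symm

/-- The 1-morphism of stacks induced by an equivariant map. -/
def mor : Mor 𝔛 𝔜 where
  obj := φ.mapObj
  map := φ.mapHom
  map_id _ := rfl
  map_comp := φ.mapHom_comp

end EqMap

end QStack

lemma representableBy_prod {F₁ F₂ F : SchCᵒᵖ ⥤ Type} {Y₁ Y₂ : SchC} (r₁ : F₁.RepresentableBy Y₁)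
    (r₂ : F₂.RepresentableBy Y₂) (e : ∀ T : SchC, F.obj (op T) ≃ F₁.obj (op T) × F₂.obj (op T))
    (he : ∀ {S T : SchC} (f : S ⟶ T) (x : F.obj (op T)),
      e S (F.map f.op x) = (F₁.map f.op (e T x).1, F₂.map f.op (e T x).2)) :
    Nonempty (F.RepresentableBy
      (Over.mk (pullback.fst Y₁.hom Y₂.hom ≫ Y₁.hom) : SchC)) := by
  let P : SchC := Over.mk (pullback.fst Y₁.hom Y₂.hom ≫ Y₁.hom)
  let p₁ : P ⟶ Y₁ := Over.homMk (pullback.fst Y₁.hom Y₂.hom)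
  let p₂ : P ⟶ Y₂ := Over.homMk (pullback.snd Y₁.hom Y₂.hom) pullback.condition.symm
  let d : ∀ T : SchC, (T ⟶ P) ≃ (T ⟶ Y₁) × (T ⟶ Y₂) := fun T =>
    { toFun := fun f => (f ≫ p₁, f ≫ p₂)
      invFun := fun q => Over.homMk (pullback.lift q.1.left q.2.left (by simp)) (by
        dsimp only [P, Over.mk_hom]
        rw [← Category.assoc, pullback.lift_fst, Over.w])
      left_inv := fun f => by
        ext1
        apply pullback.hom_ext
        · exact pullback.lift_fst _ _ _
        · exact pullback.lift_snd _ _ _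
      right_inv := fun q => by
        ext1 <;> ext1
        · exact pullback.lift_fst _ _ _
        · exact pullback.lift_snd _ _ _ }
  refine ⟨⟨fun {T} => (d T).trans ((r₁.homEquiv.prodCongr r₂.homEquiv).trans (e T).symm), ?_⟩⟩
  intro S T f g
  simp only [Equiv.trans_apply]
  rw [Equiv.symm_apply_eq, he]
  simp only [Equiv.apply_symm_apply]
  simp [d, Equiv.prodCongr, r₁.homEquiv_comp, r₂.homEquiv_comp]

lemma isFiniteType_prod {F₁ F₂ F : SchCᵒᵖ ⥤ Type} (h₁ : IsFiniteType F₁) (h₂ : IsFiniteType F₂)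
    (e : ∀ T : SchC, F.obj (op T) ≃ F₁.obj (op T) × F₂.obj (op T))
    (he : ∀ {S T : SchC} (f : S ⟶ T) (x : F.obj (op T)),
      e S (F.map f.op x) = (F₁.map f.op (e T x).1, F₂.map f.op (e T x).2)) :
    IsFiniteType F := by
  obtain ⟨Y₁, _, _, ⟨r₁⟩⟩ := h₁
  obtain ⟨Y₂, _, _, ⟨r₂⟩⟩ := h₂
  refine ⟨_, ?_, ?_, representableBy_prod r₁ r₂ e he⟩ <;> dsimp only [Over.mk_hom] <;>
    infer_instance

lemma isAffineFiniteType_prod {F₁ F₂ F : SchCᵒᵖ ⥤ Type} (h₁ : IsAffineFiniteType F₁)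
    (h₂ : IsAffineFiniteType F₂)
    (e : ∀ T : SchC, F.obj (op T) ≃ F₁.obj (op T) × F₂.obj (op T))
    (he : ∀ {S T : SchC} (f : S ⟶ T) (x : F.obj (op T)),
      e S (F.map f.op x) = (F₁.map f.op (e T x).1, F₂.map f.op (e T x).2)) :
    IsAffineFiniteType F := by
  obtain ⟨Y₁, _, _, ⟨r₁⟩⟩ := h₁
  obtain ⟨Y₂, _, _, ⟨r₂⟩⟩ := h₂
  refine ⟨_, ?_, ?_, representableBy_prod r₁ r₂ e he⟩
  · have : IsAffine ((Functor.fromPUnit (Spec (CommRingCat.of ℂ))).obj Y₂.right) := by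
      dsimp; infer_instance
    dsimp only [Over.mk_left]
    infer_instance
  · dsimp only [Over.mk_hom]; infer_instance

lemma isAffineFiniteType_of_unique (F : SchCᵒᵖ ⥤ Type) (h : ∀ T : SchC, Unique (F.obj (op T))) :
    IsAffineFiniteType F := by
  refine isAffineFiniteType_of_equations (N := Empty) ∅ F (fun T =>
    { toFun := fun _ => ⟨fun n => n.elim, by simp⟩
      invFun := fun _ => (h T).default
      left_inv := fun x => ((h T).uniq x).symm
      right_inv := fun v => by ext n; exact n.elim }) ?_
  intro S T f x n
  exact n.elim

namespace QStack

/-- The point `Spec ℂ`. -/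
def pt : QStack where
  ι := Unit
  X _ := (Functor.const _).obj Unit
  G _ := (Functor.const _).obj (GrpCat.of Unit)
  X_finite _ := (isAffineFiniteType_of_unique _ fun _ => inferInstanceAs (Unique Unit)).isFiniteType
  G_linear _ := isAffineFiniteType_of_unique _ fun _ => inferInstanceAs (Unique Unit)
  act _ _ x _ := x
  act_one _ _ _ := rfl
  act_mul _ _ _ _ _ := rfl
  act_map _ _ _ _ _ _ := rfl

/-- The product `(⊔ᵢ Xᵢ/Gᵢ) × (⊔ⱼ Yⱼ/Hⱼ) = ⊔ᵢⱼ (Xᵢ × Yⱼ)/(Gᵢ × Hⱼ)`. -/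
def prod (𝔛 𝔜 : QStack) : QStack where
  ι := 𝔛.ι × 𝔜.ι
  X i :=
    { obj := fun T => (𝔛.X i.1).obj T × (𝔜.X i.2).obj T
      map := fun f => ↾ fun x => ((𝔛.X i.1).map f x.1, (𝔜.X i.2).map f x.2)
      map_id := fun _ => by ext x <;> simp
      map_comp := fun _ _ => by ext x <;> simp }
  G i :=
    { obj := fun T => GrpCat.of ((𝔛.G i.1).obj T × (𝔜.G i.2).obj T)
      map := fun f => GrpCat.ofHom (((𝔛.G i.1).map f).hom.prodMap ((𝔜.G i.2).map f).hom)
      map_id := fun _ => by ext x <;> simp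
      map_comp := fun _ _ => by ext x <;> simp }
  X_finite i := isFiniteType_prod (𝔛.X_finite i.1) (𝔜.X_finite i.2) (fun _ => Equiv.refl _)
    (fun _ _ => rfl)
  G_linear i := isAffineFiniteType_prod (𝔛.G_linear i.1) (𝔜.G_linear i.2) (fun _ => Equiv.refl _)
    (fun _ _ => rfl)
  act i _ x g := (𝔛.act i.1 x.1 g.1, 𝔜.act i.2 x.2 g.2)
  act_one i _ x := Prod.ext (𝔛.act_one i.1 x.1) (𝔜.act_one i.2 x.2)
  act_mul i _ x g h := Prod.ext (𝔛.act_mul i.1 x.1 g.1 h.1) (𝔜.act_mul i.2 x.2 g.2 h.2)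
  act_map i _ _ f x g := Prod.ext (𝔛.act_map i.1 f x.1 g.1) (𝔜.act_map i.2 f x.2 g.2)

namespace EqMap

variable {𝔛 𝔜 ℨ 𝔚 : QStack}

/-- The morphism to the point. -/
def toPt (𝔛 : QStack) : EqMap 𝔛 pt where
  idx _ := ()
  onX _ _ _ := ()
  onG _ _ _ := ()
  onX_map _ _ _ _ _ := rfl
  onG_map _ _ _ _ _ := rfl
  onG_mul _ _ _ _ := rfl
  onX_act _ _ _ _ := rfl

/-- The first projection. -/
def fst (𝔛 𝔜 : QStack) : EqMap (𝔛.prod 𝔜) 𝔛 where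
  idx i := i.1
  onX _ _ x := x.1
  onG _ _ g := g.1
  onX_map _ _ _ _ _ := rfl
  onG_map _ _ _ _ _ := rfl
  onG_mul _ _ _ _ := rfl
  onX_act _ _ _ _ := rfl

/-- The second projection. -/
def snd (𝔛 𝔜 : QStack) : EqMap (𝔛.prod 𝔜) 𝔜 where
  idx i := i.2
  onX _ _ x := x.2
  onG _ _ g := g.2
  onX_map _ _ _ _ _ := rfl
  onG_map _ _ _ _ _ := rfl
  onG_mul _ _ _ _ := rfl
  onX_act _ _ _ _ := rfl

/-- The morphism into a product with given components. -/
def lift (φ : EqMap 𝔚 𝔛) (ψ : EqMap 𝔚 𝔜) : EqMap 𝔚 (𝔛.prod 𝔜) where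
  idx i := (φ.idx i, ψ.idx i)
  onX i _ x := (φ.onX i x, ψ.onX i x)
  onG i _ g := (φ.onG i g, ψ.onG i g)
  onX_map i _ _ f x := Prod.ext (φ.onX_map i f x) (ψ.onX_map i f x)
  onG_map i _ _ f g := Prod.ext (φ.onG_map i f g) (ψ.onG_map i f g)
  onG_mul i _ g h := Prod.ext (φ.onG_mul i g h) (ψ.onG_mul i g h)
  onX_act i _ x g := Prod.ext (φ.onX_act i x g) (ψ.onX_act i x g)

/-- The transposition of the two factors. -/
def swap (𝔛 𝔜 : QStack) : EqMap (𝔛.prod 𝔜) (𝔜.prod 𝔛) :=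
  lift (snd 𝔛 𝔜) (fst 𝔛 𝔜)

/-- The associativity isomorphism of products. -/
def assoc (𝔛 𝔜 ℨ : QStack) : EqMap ((𝔛.prod 𝔜).prod ℨ) (𝔛.prod (𝔜.prod ℨ)) :=
  lift ((fst _ _).comp (fst _ _)) (lift ((fst _ _).comp (snd _ _)) (snd _ _))

end EqMap

/-- The object `x` has nonempty base and lies in the component `Xᵢ/Gᵢ`. -/
def Obj.LiesIn {𝔛 : QStack} (x : Obj 𝔛) (i : 𝔛.ι) : Prop :=
  Nonempty x.base.left ∧ ∀ a, Nonempty (x.cov a).left → x.idx a = i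

/-- A 1-morphism `u` is of finite type if the preimage of every component `Yⱼ/Hⱼ` meets only
finitely many components `Xᵢ/Gᵢ`. -/
def FiniteType {𝔛 𝔜 : QStack} (u : Mor 𝔛 𝔜) : Prop :=
  ∀ j : 𝔜.ι, {i : 𝔛.ι | ∃ x : Obj 𝔛, x.LiesIn i ∧ (u.obj x : Obj 𝔜).LiesIn j}.Finite

lemma EqMap.finiteType {𝔛 𝔜 : QStack} (φ : EqMap 𝔛 𝔜) (h : ∀ j, {i | φ.idx i = j}.Finite) :
    FiniteType φ.mor := by
  intro j
  refine (h j).subset ?_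
  rintro i ⟨x, ⟨⟨s⟩, hx⟩, -, hy⟩
  obtain ⟨a, w, -⟩ := x.surj s
  have h1 : φ.idx (x.idx a) = j := hy a ⟨w⟩
  rwa [hx a ⟨w⟩] at h1

/-- The square with sides `p : 𝔚 ⟶ 𝔛`, `q : 𝔚 ⟶ 𝔜`, `f : 𝔛 ⟶ ℨ`, `g : 𝔜 ⟶ ℨ` commutes up to a
2-isomorphism such that the induced functor to the categorical (2-)pull-back is an equivalence. -/
def IsCartesian {𝔚 𝔛 𝔜 ℨ : QStack} (p : Mor 𝔚 𝔛) (q : Mor 𝔚 𝔜) (f : Mor 𝔛 ℨ) (g : Mor 𝔜 ℨ) :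
    Prop :=
  ∃ α : p.comp f ≅ q.comp g,
    ((CategoricalPullback.CatCommSqOver.toFunctorToCategoricalPullback f.toFunctor g.toFunctor _).obj
      ⟨p.toFunctor, q.toFunctor, (BasedNatTrans.forgetful _ _).mapIso α⟩).IsEquivalence

/-- The component `Xᵢ/Gᵢ`. -/
def component (𝔛 : QStack) (i : 𝔛.ι) : QStack where
  ι := Unit
  X _ := 𝔛.X i
  G _ := 𝔛.G i
  X_finite _ := 𝔛.X_finite i
  G_linear _ := 𝔛.G_linear i
  act _ := 𝔛.act i
  act_one _ := 𝔛.act_one i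
  act_mul _ := 𝔛.act_mul i
  act_map _ := 𝔛.act_map i

/-- The inclusion of the component `Xᵢ/Gᵢ`. -/
def component.incl (𝔛 : QStack) (i : 𝔛.ι) : EqMap (𝔛.component i) 𝔛 where
  idx _ := i
  onX _ _ x := x
  onG _ _ g := g
  onX_map _ _ _ _ _ := rfl
  onG_map _ _ _ _ _ := rfl
  onG_mul _ _ _ _ := rfl
  onX_act _ _ _ _ := rfl

/-- A family of `Gᵢ`-invariant subfunctors of the `Xᵢ`. -/
structure Sub (𝔛 : QStack) where
  mem : ∀ (i : 𝔛.ι) (T : SchC), Set ((𝔛.X i).obj (op T))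
  map_mem : ∀ (i : 𝔛.ι) {S T : SchC} (f : S ⟶ T) (x : (𝔛.X i).obj (op T)),
    x ∈ mem i T → (𝔛.X i).map f.op x ∈ mem i S
  act_mem : ∀ (i : 𝔛.ι) {T : SchC} (x : (𝔛.X i).obj (op T)) (g : (𝔛.G i).obj (op T)),
    x ∈ mem i T → 𝔛.act i x g ∈ mem i T

namespace Sub

variable {𝔛 : QStack} (Z : Sub 𝔛)

/-- The functor of points of the `i`-th member of the family. -/
def functor (i : 𝔛.ι) : SchCᵒᵖ ⥤ Type where
  obj T := {x : (𝔛.X i).obj T // x ∈ Z.mem i T.unop}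
  map f := ↾ fun x => ⟨(𝔛.X i).map f x.1, Z.map_mem i f.unop x.1 x.2⟩
  map_id _ := by ext x; simp
  map_comp _ _ := by ext x; simp

/-- The substack `⊔ᵢ Zᵢ/Gᵢ`, if the `Zᵢ` are schemes of finite type. -/
def toQStack (h : ∀ i, IsFiniteType (Z.functor i)) : QStack where
  ι := 𝔛.ι
  X := Z.functor
  G := 𝔛.G
  X_finite := h
  G_linear := 𝔛.G_linear
  act i _ x g := ⟨𝔛.act i x.1 g, Z.act_mem i x.1 g x.2⟩
  act_one i _ x := Subtype.ext (𝔛.act_one i x.1)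
  act_mul i _ x g h := Subtype.ext (𝔛.act_mul i x.1 g h)
  act_map i _ _ f x g := Subtype.ext (𝔛.act_map i f x.1 g)

/-- The inclusion `⊔ᵢ Zᵢ/Gᵢ ⟶ ⊔ᵢ Xᵢ/Gᵢ`. -/
def incl (h : ∀ i, IsFiniteType (Z.functor i)) : EqMap (Z.toQStack h) 𝔛 where
  idx i := i
  onX _ _ x := x.1
  onG _ _ g := g
  onX_map _ _ _ _ _ := rfl
  onG_map _ _ _ _ _ := rfl
  onG_mul _ _ _ _ := rfl
  onX_act _ _ _ _ := rfl

lemma finiteType_incl (h : ∀ i, IsFiniteType (Z.functor i)) : FiniteType (Z.incl h).mor :=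
  EqMap.finiteType _ fun j => Set.finite_singleton j

/-- All the `Zᵢ` are closed subschemes of `Xᵢ`. -/
def IsClosed : Prop :=
  ∀ i : 𝔛.ι, ∃ (Y W : SchC) (r : (𝔛.X i).RepresentableBy Y) (c : W ⟶ Y),
    IsClosedImmersion c.left ∧
      ∀ {T : SchC} (t : T ⟶ Y), r.homEquiv t ∈ Z.mem i T ↔ ∃ s : T ⟶ W, s ≫ c = t

/-- `Uᵢ` is the open complement of `Zᵢ`: its points are those points `t : T ⟶ Xᵢ` whose image
does not meet `Zᵢ`. -/
def IsComplement (U : Sub 𝔛) : Prop :=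
  ∀ (i : 𝔛.ι) {T : SchC} (t : (𝔛.X i).obj (op T)), t ∈ U.mem i T ↔
    ∀ {S : SchC} (f : S ⟶ T), Nonempty S.left → (𝔛.X i).map f.op t ∉ Z.mem i S

end Sub

end QStack

open QStack

universe u

/-- A motivic theory on disjoint unions of quotient stacks: abelian groups `R(𝔛)` with pull-backs
along all 1-morphisms and push-forwards along those of finite type, both functorial and depending
only on the 2-isomorphism class, and an exterior product `⊠` which is associative, symmetric and
has a unit in `R(Spec ℂ)`, such that: restriction to components is an isomorphism onto the product
(`components`), base change holds for cartesian squares, pull-back and push-forward commute with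
`⊠` (for `w = f × g`, which is characterised up to 2-isomorphism by its two components), and the
motivic property holds for a closed substack and its open complement. The operations `σⁿ` on
schemes, which such a theory may carry in addition, are not part of this structure. -/
structure StackyMotivicTheory where
  obj : QStack → Type u
  [group : ∀ 𝔛, AddCommGroup (obj 𝔛)]
  pull : ∀ {𝔛 𝔜 : QStack}, Mor 𝔛 𝔜 → (obj 𝔜 →+ obj 𝔛)
  push : ∀ {𝔛 𝔜 : QStack} (f : Mor 𝔛 𝔜), FiniteType f → (obj 𝔛 →+ obj 𝔜)
  boxtimes : ∀ {𝔛 𝔜 : QStack}, obj 𝔛 →+ obj 𝔜 →+ obj (𝔛.prod 𝔜)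
  one : obj pt
  pull_iso : ∀ {𝔛 𝔜 : QStack} {f g : Mor 𝔛 𝔜}, Nonempty (f ≅ g) → pull f = pull g
  push_iso : ∀ {𝔛 𝔜 : QStack} {f g : Mor 𝔛 𝔜} (hf : FiniteType f) (hg : FiniteType g),
    Nonempty (f ≅ g) → push f hf = push g hg
  pull_id : ∀ (𝔛 : QStack) (a : obj 𝔛), pull (BasedFunctor.id 𝔛.toStack) a = a
  push_id : ∀ (𝔛 : QStack) (h : FiniteType (BasedFunctor.id 𝔛.toStack)) (a : obj 𝔛),
    push (BasedFunctor.id 𝔛.toStack) h a = a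
  pull_comp : ∀ {𝔛 𝔜 ℨ : QStack} (f : Mor 𝔛 𝔜) (g : Mor 𝔜 ℨ) (a : obj ℨ),
    pull (f.comp g) a = pull f (pull g a)
  push_comp : ∀ {𝔛 𝔜 ℨ : QStack} (f : Mor 𝔛 𝔜) (g : Mor 𝔜 ℨ) (hf : FiniteType f)
    (hg : FiniteType g) (hfg : FiniteType (f.comp g)) (a : obj 𝔛),
    push (f.comp g) hfg a = push g hg (push f hf a)
  boxtimes_assoc : ∀ {𝔛 𝔜 ℨ : QStack} (a : obj 𝔛) (b : obj 𝔜) (c : obj ℨ),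
    pull (EqMap.assoc 𝔛 𝔜 ℨ).mor (boxtimes a (boxtimes b c)) = boxtimes (boxtimes a b) c
  boxtimes_symm : ∀ {𝔛 𝔜 : QStack} (a : obj 𝔛) (b : obj 𝔜),
    pull (EqMap.swap 𝔛 𝔜).mor (boxtimes b a) = boxtimes a b
  one_boxtimes : ∀ {𝔛 : QStack} (a : obj 𝔛), boxtimes one a = pull (EqMap.snd pt 𝔛).mor a
  components : ∀ 𝔛 : QStack, Function.Bijective fun (a : obj 𝔛) (i : 𝔛.ι) =>
    pull (component.incl 𝔛 i).mor a
  base_change : ∀ {𝔚 𝔛 𝔜 ℨ : QStack} (p : Mor 𝔚 𝔛) (q : Mor 𝔚 𝔜) (f : Mor 𝔛 ℨ) (g : Mor 𝔜 ℨ),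
    IsCartesian p q f g → ∀ (hf : FiniteType f) (hq : FiniteType q) (a : obj 𝔛),
    pull g (push f hf a) = push q hq (pull p a)
  pull_boxtimes : ∀ {𝔛 𝔜 𝔛' 𝔜' : QStack} (f : Mor 𝔛 𝔛') (g : Mor 𝔜 𝔜')
    (w : Mor (𝔛.prod 𝔜) (𝔛'.prod 𝔜')),
    Nonempty (w.comp (EqMap.fst 𝔛' 𝔜').mor ≅ (EqMap.fst 𝔛 𝔜).mor.comp f) →
    Nonempty (w.comp (EqMap.snd 𝔛' 𝔜').mor ≅ (EqMap.snd 𝔛 𝔜).mor.comp g) →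
    ∀ (a : obj 𝔛') (b : obj 𝔜'), pull w (boxtimes a b) = boxtimes (pull f a) (pull g b)
  push_boxtimes : ∀ {𝔛 𝔜 𝔛' 𝔜' : QStack} (f : Mor 𝔛 𝔛') (g : Mor 𝔜 𝔜')
    (w : Mor (𝔛.prod 𝔜) (𝔛'.prod 𝔜')) (hf : FiniteType f) (hg : FiniteType g)
    (hw : FiniteType w),
    Nonempty (w.comp (EqMap.fst 𝔛' 𝔜').mor ≅ (EqMap.fst 𝔛 𝔜).mor.comp f) →
    Nonempty (w.comp (EqMap.snd 𝔛' 𝔜').mor ≅ (EqMap.snd 𝔛 𝔜).mor.comp g) →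
    ∀ (a : obj 𝔛) (b : obj 𝔜), push w hw (boxtimes a b) = boxtimes (push f hf a) (push g hg b)
  motivic : ∀ {𝔛 : QStack} (Z U : Sub 𝔛) (hZ : ∀ i, IsFiniteType (Z.functor i))
    (hU : ∀ i, IsFiniteType (U.functor i)), Z.IsClosed → Z.IsComplement U →
    (∀ a, pull (Z.incl hZ).mor (push (Z.incl hZ).mor (Z.finiteType_incl hZ) a) = a) ∧
    (∀ a, pull (U.incl hU).mor (push (U.incl hU).mor (U.finiteType_incl hU) a) = a) ∧
    (∀ a, pull (U.incl hU).mor (push (Z.incl hZ).mor (Z.finiteType_incl hZ) a) = 0) ∧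
    (∀ a, pull (Z.incl hZ).mor (push (U.incl hU).mor (U.finiteType_incl hU) a) = 0) ∧
    ∀ a, push (Z.incl hZ).mor (Z.finiteType_incl hZ) (pull (Z.incl hZ).mor a) +
      push (U.incl hU).mor (U.finiteType_incl hU) (pull (U.incl hU).mor a) = a

lemma isAffineFiniteType_gl {I : Type} [Finite I] (n : I → ℕ)
    (Z : ∀ i, Fin (n i) → Fin (n i) → Prop) (F : SchCᵒᵖ ⥤ Type)
    (e : ∀ T : SchC, F.obj (op T) ≃ {g : ∀ i, GL (Fin (n i)) (Reg T) // ∀ i a b, Z i a b →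
      (g i).val a b = 0 ∧ (g i)⁻¹.val a b = 0})
    (he : ∀ {S T : SchC} (f : S ⟶ T) (x : F.obj (op T)) (i : I),
      (e S (F.map f.op x)).1 i = Matrix.GeneralLinearGroup.map (funMap f) ((e T x).1 i)) :
    IsAffineFiniteType F := by
  let N : Type := Σ i, Bool × Fin (n i) × Fin (n i)
  let P : ∀ i, Bool → Matrix (Fin (n i)) (Fin (n i)) (MvPolynomial N ℂ) :=
    fun i c => Matrix.of fun a b => .X ⟨i, c, a, b⟩
  let E : Set (MvPolynomial N ℂ) :=
    {p | ∃ i c a b, p = (P i c * P i (!c) - 1) a b} ∪ {p | ∃ i c a b, Z i a b ∧ p = P i c a b}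
  have hE : ∀ (T : SchC) (v : N → Reg T), (∀ p ∈ E, MvPolynomial.eval₂ (scalars T) v p = 0) ↔
      (∀ i c, (Matrix.of fun a b => v ⟨i, c, a, b⟩ : Matrix (Fin (n i)) (Fin (n i)) (Reg T)) *
        (Matrix.of fun a b => v ⟨i, !c, a, b⟩) = 1) ∧
      ∀ i c a b, Z i a b → v ⟨i, c, a, b⟩ = 0 := by
    intro T v
    have h1 : ∀ i c a b, MvPolynomial.eval₂ (scalars T) v ((P i c * P i (!c) - 1) a b) = 0 ↔
        ((Matrix.of fun a b => v ⟨i, c, a, b⟩ : Matrix (Fin (n i)) (Fin (n i)) (Reg T)) *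
        (Matrix.of fun a b => v ⟨i, !c, a, b⟩)) a b =
          (1 : Matrix (Fin (n i)) (Fin (n i)) (Reg T)) a b := by
      intro i c a b
      have : MvPolynomial.eval₂ (scalars T) v ((1 : Matrix (Fin (n i)) (Fin (n i))
          (MvPolynomial N ℂ)) a b) = (1 : Matrix (Fin (n i)) (Fin (n i)) (Reg T)) a b := by
        rw [Matrix.one_apply, Matrix.one_apply]; split_ifs <;> simp
      rw [Matrix.sub_apply, MvPolynomial.eval₂_sub, this, sub_eq_zero, Matrix.mul_apply,
        MvPolynomial.eval₂_sum, Matrix.mul_apply]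
      simp [P]
    constructor
    · intro h
      refine ⟨fun i c => ?_, fun i c a b hZ => ?_⟩
      · ext a b
        exact (h1 i c a b).1 (h _ (Or.inl ⟨i, c, a, b, rfl⟩))
      · simpa [P] using h _ (Or.inr ⟨i, c, a, b, hZ, rfl⟩)
    · rintro ⟨h, h'⟩ p (⟨i, c, a, b, rfl⟩ | ⟨i, c, a, b, hZ, rfl⟩)
      · exact (h1 i c a b).2 (by rw [h i c])
      · simpa [P] using h' i c a b hZ
  refine isAffineFiniteType_of_equations (N := N) E F (fun T => (e T).trans
    { toFun := fun g => ⟨fun ν => if ν.2.1 then (g.1 ν.1).val ν.2.2.1 ν.2.2.2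
          else (g.1 ν.1)⁻¹.val ν.2.2.1 ν.2.2.2, by
        rw [hE]
        refine ⟨fun i c => ?_, fun i c a b hZ => ?_⟩
        · cases c
          · exact (g.1 i).inv_mul
          · exact (g.1 i).mul_inv
        · cases c
          · exact (g.2 i a b hZ).2
          · exact (g.2 i a b hZ).1⟩
      invFun := fun v => ⟨fun i => ⟨Matrix.of fun a b => v.1 ⟨i, true, a, b⟩,
          Matrix.of fun a b => v.1 ⟨i, false, a, b⟩, ((hE T v.1).1 v.2).1 i true,
          ((hE T v.1).1 v.2).1 i false⟩,
        fun i a b hZ => ⟨((hE T v.1).1 v.2).2 i true a b hZ, ((hE T v.1).1 v.2).2 i false a b hZ⟩⟩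
      left_inv := fun g => by
        refine Subtype.ext (funext fun i => Units.ext ?_)
        rfl
      right_inv := fun v => by
        refine Subtype.ext (funext ?_)
        rintro ⟨i, _ | _, a, b⟩ <;> rfl }) ?_
  rintro S T f x ⟨i, c, a, b⟩
  have h := he f x i
  cases c
  · change ((e S (F.map f.op x)).1 i)⁻¹.val a b = funMap f (((e T x).1 i)⁻¹.val a b)
    rw [h, ← Matrix.GeneralLinearGroup.map_inv]
    rfl
  · change ((e S (F.map f.op x)).1 i).val a b = funMap f (((e T x).1 i).val a b)
    rw [h]
    rfl

lemma isAffineFiniteType_matrices {I : Type} [Finite I] (m n : I → ℕ)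
    (Z : ∀ i, Fin (m i) → Fin (n i) → Prop) (F : SchCᵒᵖ ⥤ Type)
    (e : ∀ T : SchC, F.obj (op T) ≃ {M : ∀ i, Matrix (Fin (m i)) (Fin (n i)) (Reg T) //
      ∀ i a b, Z i a b → M i a b = 0})
    (he : ∀ {S T : SchC} (f : S ⟶ T) (x : F.obj (op T)) (i : I),
      (e S (F.map f.op x)).1 i = ((e T x).1 i).map (funMap f)) :
    IsAffineFiniteType F := by
  let N : Type := Σ i, Fin (m i) × Fin (n i)
  let E : Set (MvPolynomial N ℂ) := {p | ∃ i a b, Z i a b ∧ p = .X ⟨i, a, b⟩}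
  have hE : ∀ (T : SchC) (v : N → Reg T), (∀ p ∈ E, MvPolynomial.eval₂ (scalars T) v p = 0) ↔
      ∀ i a b, Z i a b → v ⟨i, a, b⟩ = 0 := by
    intro T v
    constructor
    · intro h i a b hZ
      simpa using h _ ⟨i, a, b, hZ, rfl⟩
    · rintro h p ⟨i, a, b, hZ, rfl⟩
      simpa using h i a b hZ
  refine isAffineFiniteType_of_equations (N := N) E F (fun T => (e T).trans
    { toFun := fun M => ⟨fun ν => M.1 ν.1 ν.2.1 ν.2.2, (hE T _).2 M.2⟩
      invFun := fun v => ⟨fun i => Matrix.of fun a b => v.1 ⟨i, a, b⟩, (hE T _).1 v.2⟩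
      left_inv := fun M => rfl
      right_inv := fun v => rfl }) ?_
  rintro S T f x ⟨i, a, b⟩
  change (e S (F.map f.op x)).1 i a b = funMap f ((e T x).1 i a b)
  rw [he]
  rfl

section Quiver

/-- The space `X_d` of representations of dimension vector `d`, with coefficients in `R`. -/
abbrev RepSpace (Q : Type) [Quiver.{0} Q] (d : Q → ℕ) (R : Type) : Type :=
  ∀ i j : Q, (i ⟶ j) → Matrix (Fin (d j)) (Fin (d i)) R

/-- The group `G_d = ∏ᵢ GL(dᵢ)`. -/
abbrev GaugeGroup {Q : Type} (d : Q → ℕ) (R : Type) [CommRing R] : Type :=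
  ∀ i : Q, GL (Fin (d i)) R

variable {Q : Type} [Quiver.{0} Q]

/-- The right action of `G_d` on `X_d` by conjugation. -/
def conj {d : Q → ℕ} {R : Type} [CommRing R] (M : RepSpace Q d R) (g : GaugeGroup d R) :
    RepSpace Q d R :=
  fun i j α => (g j)⁻¹.val * M i j α * (g i).val

/-- Change of coefficients. -/
def RepSpace.map {d : Q → ℕ} {R S : Type} [CommRing R] [CommRing S] (f : R →+* S)
    (M : RepSpace Q d R) : RepSpace Q d S :=
  fun i j α => (M i j α).map f

/-- Change of coefficients. -/
def GaugeGroup.map {Q : Type} {d : Q → ℕ} {R S : Type} [CommRing R] [CommRing S] (f : R →+* S) :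
    GaugeGroup d R →* GaugeGroup d S where
  toFun g := fun i => Matrix.GeneralLinearGroup.map f (g i)
  map_one' := by ext1 i; simp
  map_mul' g h := by ext1 i; simp

lemma conj_one {d : Q → ℕ} {R : Type} [CommRing R] (M : RepSpace Q d R) : conj M 1 = M := by
  funext i j α; simp [conj]

lemma conj_mul {d : Q → ℕ} {R : Type} [CommRing R] (M : RepSpace Q d R) (g h : GaugeGroup d R) :
    conj M (g * h) = conj (conj M g) h := by
  funext i j α
  simp only [conj, Pi.mul_apply, mul_inv_rev, Units.val_mul, Matrix.mul_assoc]

lemma map_conj {d : Q → ℕ} {R S : Type} [CommRing R] [CommRing S] (f : R →+* S)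
    (M : RepSpace Q d R) (g : GaugeGroup d R) :
    (conj M g).map f = conj (M.map f) (GaugeGroup.map f g) := by
  funext i j α
  simp only [conj, RepSpace.map, Matrix.map_mul]
  rfl

/-- The linear map `M : R^{m'} ⊕ R^{n'} → R^m ⊕ R^n` maps `R^{m'}` into `R^m`. -/
def IsBlockUpper {m n m' n' : ℕ} {R : Type} [CommRing R]
    (M : Matrix (Fin (m + n)) (Fin (m' + n')) R) : Prop :=
  ∀ a b, M (Fin.natAdd m a) (Fin.castAdd n' b) = 0

lemma IsBlockUpper.mul {m n m' n' m'' n'' : ℕ} {R : Type} [CommRing R]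
    {M : Matrix (Fin (m + n)) (Fin (m' + n')) R} {N : Matrix (Fin (m' + n')) (Fin (m'' + n'')) R}
    (hM : IsBlockUpper M) (hN : IsBlockUpper N) : IsBlockUpper (M * N) := by
  intro a b
  rw [Matrix.mul_apply, Fin.sum_univ_add]
  simp [hM a, fun c => hN c b]

lemma IsBlockUpper.one {m n : ℕ} {R : Type} [CommRing R] :
    IsBlockUpper (1 : Matrix (Fin (m + n)) (Fin (m + n)) R) := by
  intro a b
  refine Matrix.one_apply_ne fun h => ?_
  have := congrArg Fin.val h
  have hb := b.2
  simp only [Fin.val_natAdd, Fin.val_castAdd] at this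
  omega

lemma IsBlockUpper.map {m n m' n' : ℕ} {R S : Type} [CommRing R] [CommRing S] (f : R →+* S)
    {M : Matrix (Fin (m + n)) (Fin (m' + n')) R} (hM : IsBlockUpper M) :
    IsBlockUpper (M.map f) := by
  intro a b
  rw [Matrix.map_apply, hM, map_zero]

/-- The induced map `R^{m'} → R^m` on the subspaces. -/
def subBlock {m n m' n' : ℕ} {R : Type} (M : Matrix (Fin (m + n)) (Fin (m' + n')) R) :
    Matrix (Fin m) (Fin m') R :=
  M.submatrix (Fin.castAdd n) (Fin.castAdd n')

/-- The induced map `R^{n'} → R^n` on the quotients. -/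
def quotBlock {m n m' n' : ℕ} {R : Type} (M : Matrix (Fin (m + n)) (Fin (m' + n')) R) :
    Matrix (Fin n) (Fin n') R :=
  M.submatrix (Fin.natAdd m) (Fin.natAdd m')

lemma subBlock_mul {m n m' n' m'' n'' : ℕ} {R : Type} [CommRing R]
    (M : Matrix (Fin (m + n)) (Fin (m' + n')) R) {N : Matrix (Fin (m' + n')) (Fin (m'' + n'')) R}
    (hN : IsBlockUpper N) : subBlock (M * N) = subBlock M * subBlock N := by
  ext a b
  simp [subBlock, Matrix.mul_apply, Fin.sum_univ_add, fun c => hN c b]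

lemma quotBlock_mul {m n m' n' m'' n'' : ℕ} {R : Type} [CommRing R]
    {M : Matrix (Fin (m + n)) (Fin (m' + n')) R} (N : Matrix (Fin (m' + n')) (Fin (m'' + n'')) R)
    (hM : IsBlockUpper M) : quotBlock (M * N) = quotBlock M * quotBlock N := by
  ext a b
  simp [quotBlock, Matrix.mul_apply, Fin.sum_univ_add, hM a]

lemma subBlock_one {m n : ℕ} {R : Type} [CommRing R] :
    subBlock (1 : Matrix (Fin (m + n)) (Fin (m + n)) R) = 1 := by
  ext a b; simp [subBlock, Matrix.one_apply]

lemma quotBlock_one {m n : ℕ} {R : Type} [CommRing R] :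
    quotBlock (1 : Matrix (Fin (m + n)) (Fin (m + n)) R) = 1 := by
  ext a b; simp [quotBlock, Matrix.one_apply]

/-- The subgroup `G_{d,d'}` of `G_{d+d'}` of all elements preserving the standard flag. -/
def flagSubgroup {Q : Type} (d d' : Q → ℕ) (R : Type) [CommRing R] :
    Subgroup (GaugeGroup (d + d') R) where
  carrier := {g | ∀ i, IsBlockUpper (m := d i) (n := d' i) (m' := d i) (n' := d' i) (g i).val ∧
    IsBlockUpper (m := d i) (n := d' i) (m' := d i) (n' := d' i) (g i)⁻¹.val}
  one_mem' i := ⟨IsBlockUpper.one, by simpa using IsBlockUpper.one⟩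
  mul_mem' {g h} hg hh i := ⟨(hg i).1.mul (hh i).1, by
    have : ((g * h) i)⁻¹.val = (h i)⁻¹.val * (g i)⁻¹.val := by simp
    rw [this]
    exact (hh i).2.mul (hg i).2⟩
  inv_mem' {g} hg i := ⟨(hg i).2, by simpa using (hg i).1⟩

/-- The space `X_{d,d'}` of representations in `X_{d+d'}` preserving the standard flag. -/
def FlagRepSpace (Q : Type) [Quiver.{0} Q] (d d' : Q → ℕ) (R : Type) [CommRing R] : Type :=
  {M : RepSpace Q (d + d') R // ∀ i j (α : i ⟶ j),
    IsBlockUpper (m := d j) (n := d' j) (m' := d i) (n' := d' i) (M i j α)}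

lemma conj_flag {d d' : Q → ℕ} {R : Type} [CommRing R] (M : FlagRepSpace Q d d' R)
    (g : flagSubgroup d d' R) (i j : Q) (α : i ⟶ j) :
    IsBlockUpper (m := d j) (n := d' j) (m' := d i) (n' := d' i) (conj M.1 g.1 i j α) :=
  ((g.2 j).2.mul (M.2 i j α)).mul (g.2 i).1

variable [Finite Q] [∀ i j : Q, Finite (i ⟶ j)]

variable (Q)

/-- The moduli stack `𝔐 = ⊔_d X_d/G_d` of representations of the quiver `Q`. -/
def moduli : QStack where
  ι := Q → ℕ
  X d :=
    { obj := fun T => RepSpace Q d (Reg T.unop)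
      map := fun f => ↾ fun M => M.map (funMap f.unop)
      map_id := fun T => by
        ext M i j α a b; exact funMap_id T.unop _
      map_comp := fun f g => by
        ext M i j α a b; exact funMap_comp g.unop f.unop _ }
  G d :=
    { obj := fun T => GrpCat.of (GaugeGroup d (Reg T.unop))
      map := fun f => GrpCat.ofHom (GaugeGroup.map (funMap f.unop))
      map_id := fun T => by
        ext g i a b; exact funMap_id T.unop _
      map_comp := fun f g => by
        ext x i a b; exact funMap_comp g.unop f.unop _ }
  X_finite d := IsAffineFiniteType.isFiniteType
    (isAffineFiniteType_matrices (I := Σ i j : Q, (i ⟶ j)) (fun α => d α.2.1) (fun α => d α.1)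
      (fun _ _ _ => False) _ (fun T =>
        { toFun := fun M => ⟨fun α => M α.1 α.2.1 α.2.2, fun _ _ _ h => h.elim⟩
          invFun := fun M i j α => M.1 ⟨i, j, α⟩
          left_inv := fun _ => rfl
          right_inv := fun _ => rfl }) (fun _ _ _ => rfl))
  G_linear d := isAffineFiniteType_gl d (fun _ _ _ => False) _ (fun T =>
    { toFun := fun g => ⟨g, fun _ _ _ h => h.elim⟩
      invFun := fun g => g.1
      left_inv := fun _ => rfl
      right_inv := fun _ => rfl }) (fun _ _ _ => rfl)
  act _ _ M g := conj M g
  act_one _ _ M := conj_one M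
  act_mul _ _ M g h := conj_mul M g h
  act_map _ _ _ f M g := map_conj (funMap f) M g

/-- The stack `⊔_{d,d'} X_{d,d'}/G_{d,d'}` of short exact sequences of representations, where `d` is
the dimension vector of the first and `d'` that of the third term. -/
def exactSeq : QStack where
  ι := (Q → ℕ) × (Q → ℕ)
  X d :=
    { obj := fun T => FlagRepSpace Q d.1 d.2 (Reg T.unop)
      map := fun f => ↾ fun M => ⟨M.1.map (funMap f.unop), fun i j α => (M.2 i j α).map _⟩
      map_id := fun T => by
        ext M; refine Subtype.ext ?_; funext i j α; ext a b; exact funMap_id T.unop _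
      map_comp := fun f g => by
        ext M; refine Subtype.ext ?_; funext i j α; ext a b
        exact funMap_comp g.unop f.unop _ }
  G d :=
    { obj := fun T => GrpCat.of (flagSubgroup d.1 d.2 (Reg T.unop))
      map := fun f => GrpCat.ofHom
        (((GaugeGroup.map (funMap f.unop)).comp (Subgroup.subtype _)).codRestrict _
          fun g i => ⟨(g.2 i).1.map _, (g.2 i).2.map _⟩)
      map_id := fun T => by
        ext g i a b; exact funMap_id T.unop _
      map_comp := fun f g => by
        ext x i a b
        exact funMap_comp g.unop f.unop _ }
  X_finite d := IsAffineFiniteType.isFiniteType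
    (isAffineFiniteType_matrices (I := Σ i j : Q, (i ⟶ j)) (fun α => d.1 α.2.1 + d.2 α.2.1)
      (fun α => d.1 α.1 + d.2 α.1)
      (fun α a b => (∃ a', a = Fin.natAdd _ a') ∧ ∃ b', b = Fin.castAdd _ b') _ (fun T =>
        { toFun := fun M => ⟨fun α => M.1 α.1 α.2.1 α.2.2, by
            rintro α _ _ ⟨⟨a, rfl⟩, b, rfl⟩
            exact M.2 _ _ _ a b⟩
          invFun := fun M => ⟨fun i j α => M.1 ⟨i, j, α⟩, fun i j α a b =>
            M.2 _ _ _ ⟨⟨a, rfl⟩, b, rfl⟩⟩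
          left_inv := fun _ => rfl
          right_inv := fun _ => rfl }) (fun _ _ _ => rfl))
  G_linear d := isAffineFiniteType_gl (d.1 + d.2)
    (fun i a b => (∃ a' : Fin (d.2 i), a = Fin.natAdd (d.1 i) a') ∧
      ∃ b' : Fin (d.1 i), b = Fin.castAdd (d.2 i) b') _ (fun T =>
    { toFun := fun g => ⟨g.1, by
        rintro i _ _ ⟨⟨a, rfl⟩, b, rfl⟩
        exact ⟨(g.2 i).1 a b, (g.2 i).2 a b⟩⟩
      invFun := fun g => ⟨g.1, fun i => ⟨fun a b => (g.2 i _ _ ⟨⟨a, rfl⟩, b, rfl⟩).1,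
        fun a b => (g.2 i _ _ ⟨⟨a, rfl⟩, b, rfl⟩).2⟩⟩
      left_inv := fun _ => rfl
      right_inv := fun _ => rfl }) (fun _ _ _ => rfl)
  act _ _ M g := ⟨conj M.1 g.1, conj_flag M g⟩
  act_one _ _ M := Subtype.ext (conj_one M.1)
  act_mul _ _ M g h := Subtype.ext (conj_mul M.1 g.1 h.1)
  act_map _ _ _ f M g := Subtype.ext (map_conj (funMap f) M.1 g.1)

variable {Q}

/-- The morphism mapping a short exact sequence to its second term. -/
def π₂ : EqMap (exactSeq Q) (moduli Q) where
  idx d := d.1 + d.2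
  onX _ _ M := M.1
  onG _ _ g := g.1
  onX_map _ _ _ _ _ := rfl
  onG_map _ _ _ _ _ := rfl
  onG_mul _ _ _ _ := rfl
  onX_act _ _ _ _ := rfl

/-- The morphism mapping a short exact sequence to its first term. -/
def π₁ : EqMap (exactSeq Q) (moduli Q) where
  idx d := d.1
  onX d _ M := fun i j α => subBlock (n := d.2 j) (n' := d.2 i) (M.1 i j α)
  onG d _ g := fun i =>
    { val := subBlock (n := d.2 i) (n' := d.2 i) (g.1 i).val
      inv := subBlock (n := d.2 i) (n' := d.2 i) (g.1 i)⁻¹.val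
      val_inv := by rw [← subBlock_mul _ (g.2 i).2, Units.mul_inv]; exact subBlock_one
      inv_val := by rw [← subBlock_mul _ (g.2 i).1, Units.inv_mul]; exact subBlock_one }
  onX_map _ _ _ _ _ := rfl
  onG_map _ _ _ _ _ := by funext i; ext a b; rfl
  onG_mul _ _ g h := by
    funext i; apply Units.ext; exact subBlock_mul _ (h.2 i).1
  onX_act _ _ M g := by
    funext i j α
    exact (subBlock_mul _ (g.2 i).1).trans (congrArg (· * _) (subBlock_mul _ (M.2 i j α)))

/-- The morphism mapping a short exact sequence to its third term. -/
def π₃ : EqMap (exactSeq Q) (moduli Q) where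
  idx d := d.2
  onX d _ M := fun i j α => quotBlock (m := d.1 j) (m' := d.1 i) (M.1 i j α)
  onG d _ g := fun i =>
    { val := quotBlock (m := d.1 i) (m' := d.1 i) (g.1 i).val
      inv := quotBlock (m := d.1 i) (m' := d.1 i) (g.1 i)⁻¹.val
      val_inv := by rw [← quotBlock_mul _ (g.2 i).1, Units.mul_inv]; exact quotBlock_one
      inv_val := by rw [← quotBlock_mul _ (g.2 i).2, Units.inv_mul]; exact quotBlock_one }
  onX_map _ _ _ _ _ := rfl
  onG_map _ _ _ _ _ := by funext i; ext a b; rfl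
  onG_mul _ _ g h := by
    funext i; apply Units.ext; exact quotBlock_mul _ (g.2 i).1
  onX_act _ _ M g := by
    funext i j α
    exact (quotBlock_mul _ ((g.2 j).2.mul (M.2 i j α))).trans
      (congrArg (· * _) (quotBlock_mul _ (g.2 j).2))

/-- The morphism `0 : Spec ℂ ⟶ 𝔐` given by the zero representation. -/
def zeroRep : EqMap pt (moduli Q) where
  idx _ := (0 : Q → ℕ)
  onX _ _ _ := fun _ _ _ => 0
  onG _ _ _ := 1
  onX_map _ _ _ _ _ := by funext i j α; ext a; exact a.elim0
  onG_map _ _ _ _ _ := map_one _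
  onG_mul _ _ _ _ := (mul_one _).symm
  onX_act _ _ _ _ := by funext i j α; ext a; exact a.elim0

lemma finiteType_π₂ : FiniteType (π₂ (Q := Q)).mor := by
  refine EqMap.finiteType _ fun (e : Q → ℕ) => ?_
  classical
  have := Fintype.ofFinite Q
  refine ((Set.finite_Icc 0 e).prod (Set.finite_Icc 0 e)).subset ?_
  rintro ⟨d, d'⟩ (h : d + d' = e)
  subst h
  exact ⟨⟨zero_le, le_self_add⟩, ⟨zero_le, le_add_self⟩⟩

lemma finiteType_zeroRep : FiniteType (zeroRep (Q := Q)).mor :=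
  EqMap.finiteType _ fun _ => Set.toFinite (α := Unit) _

end Quiver

attribute [instance] StackyMotivicTheory.group

namespace StackyMotivicTheory

variable (R : StackyMotivicTheory.{u})

/-- The product of `R(Spec ℂ)`. -/
def mulPt (r s : R.obj pt) : R.obj pt :=
  R.pull (EqMap.lift (EqMap.id pt) (EqMap.id pt)).mor (R.boxtimes r s)

/-- The action of `R(Spec ℂ)` on `R(𝔛)` by exterior products, using `Spec ℂ × 𝔛 ≅ 𝔛`. -/
def smul {𝔛 : QStack} (r : R.obj pt) (a : R.obj 𝔛) : R.obj 𝔛 :=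
  R.pull (EqMap.lift (EqMap.toPt 𝔛) (EqMap.id 𝔛)).mor (R.boxtimes r a)

variable {Q : Type} [Quiver.{0} Q] [Finite Q] [∀ i j : Q, Finite (i ⟶ j)]

/-- The Ringel-Hall product `a ∗ b = π₂_! (π₁ × π₃)^* (a ⊠ b)`. -/
def hall (a b : R.obj (moduli Q)) : R.obj (moduli Q) :=
  R.push π₂.mor finiteType_π₂ (R.pull (EqMap.lift π₁ π₃).mor (R.boxtimes a b))

variable (Q)

/-- The element `1₀ = 0_!(1)`. -/
def hallOne : R.obj (moduli Q) :=
  R.push zeroRep.mor finiteType_zeroRep R.one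

end StackyMotivicTheory


end

end RingelHall

open CategoryTheory AlgebraicGeometry Opposite Limits

namespace RingelHall

noncomputable section

/-! ### Equivariant maps compose strictly; morphisms over isomorphisms are invertible. -/

namespace QStack

variable {𝔛 𝔜 ℨ 𝔚 : QStack}

/-! Everything is a formal consequence of base change, functoriality and the compatibility of the
exterior product with pull-back and push-forward. The geometric input consists of a handful of
2-cartesian squares of quotient stacks.

For associativity let `filtStack` be the stack of representations with a filtration `V₁ ⊆ V₂ ⊆ V`.
Giving such a filtration is the same as giving `V₂ ⊆ V` together with `V₁ ⊆ V₂`, and also the same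
as giving `V₁ ⊆ V` together with `V₂/V₁ ⊆ V/V₁`. Hence it is the fibre product of `π₁ × π₃` with `π₂
× id` (`filtStack.isStrictPullback`) and also with `id × π₂` (`filtStack.isStrictPullback'`). Base
change turns both `(a * b) * c` and `a * (b * c)` into the same expression: pull `a ⊠ (b ⊠ c)` back
along the associated graded object and push it forward along the underlying representation.

The unit laws use that an exact sequence with vanishing first or third term is just a
representation: the fibre product of `π₁ × π₃` with `0 × id` or `id × 0` is the moduli stack itself,
and its map to the middle term is the identity. Linearity over `R(Spec ℂ)` uses the square saying
that `𝔛 ≅ Spec ℂ × 𝔛` is natural in `𝔛`.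

The work lies in showing that these squares are 2-cartesian. All maps come from equivariant maps of
presentations, and the corner is the fibre product of indices, spaces and groups
(`IsStrictPullback`). Such a fibre product of presentations need not present the 2-fibre product: an
object of the latter also contains an isomorphism `θ` between the two images, and this need not be
an identity. If one of the group homomorphisms is surjective on points, the local group elements of
`θ` can be lifted and absorbed into a change of trivialisation on that side, after which the two
images agree strictly. Here the homomorphism is `G_{d,d'} → G_d × G_{d'}`, which is surjective
because block diagonal matrices split it (`lift_π₁_π₃_surj`). The general criterion is
`IsStrictPullback.isCartesian`; full faithfulness is checked on group elements, and essential
surjectivity is the gluing construction `Refinement.glue`. -/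

lemma Hom.hext {x x' y y' : Obj 𝔛} (hx : x = x') (hy : y = y') (f : Hom x y) (f' : Hom x' y')
    (hbase : HEq f.base f'.base) (hk : HEq (@f.k) (@f'.k)) : HEq f f' := by
  subst hx hy
  refine heq_of_eq (Hom.ext' f f' (eq_of_heq hbase) fun ha hb T u v hT h h' => ?_)
  obtain ⟨fb, _, fk, _, _, _, _⟩ := f
  obtain ⟨gb, _, gk, _, _, _, _⟩ := f'
  obtain rfl : fb = gb := eq_of_heq hbase
  obtain rfl : @fk = @gk := eq_of_heq hk
  rfl

namespace EqMap

/-- Base, covering, indices and sections agree by unfolding. Only the transition elements contain a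
transport along an equality of indices, performed once on one side and in two stages on the other,
and it disappears when that equality is `rfl`. -/
lemma mapObj_comp (φ : EqMap 𝔛 𝔜) (ψ : EqMap 𝔜 ℨ) (x : Obj 𝔛) :
    (φ.comp ψ).mapObj x = ψ.mapObj (φ.mapObj x) := by
  have : @Obj.tr _ ((φ.comp ψ).mapObj x) = @Obj.tr _ (ψ.mapObj (φ.mapObj x)) := by
    funext i a b ha hb T u v hT h
    cases ha
    rfl
  unfold mapObj at this ⊢
  congr 1

/-- An equality of functors, not just a 2-isomorphism. This lets identities between equivariant maps
be rewritten inside `pull` and `push` without any coherence data. -/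
lemma comp_mor (φ : EqMap 𝔛 𝔜) (ψ : EqMap 𝔜 ℨ) : (φ.comp ψ).mor = φ.mor.comp ψ.mor := by
  have : (φ.comp ψ).mor.toFunctor = (φ.mor.comp ψ.mor).toFunctor := by
    refine CategoryTheory.Functor.hext (fun x => mapObj_comp φ ψ x) fun x y f => ?_
    refine Hom.hext (mapObj_comp φ ψ x) (mapObj_comp φ ψ y) _ _ HEq.rfl (heq_of_eq ?_)
    funext i a b ha hb T u v hT h
    cases ha
    rfl
  -- A based functor is its underlying functor together with a proof, so equality of the underlying
  -- functors suffices.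
  generalize (φ.comp ψ).mor = F at *
  generalize φ.mor.comp ψ.mor = G at *
  cases F; cases G; congr

lemma mapObj_id (x : Obj 𝔛) : (EqMap.id 𝔛).mapObj x = x := by
  have : @Obj.tr _ ((EqMap.id 𝔛).mapObj x) = @Obj.tr _ x := by
    funext i a b ha hb T u v hT h
    cases ha
    rfl
  obtain ⟨⟩ := x
  unfold mapObj at this ⊢
  congr 1

lemma id_mor : (EqMap.id 𝔛).mor = BasedFunctor.id 𝔛.toStack := by
  have : (EqMap.id 𝔛).mor.toFunctor = (BasedFunctor.id 𝔛.toStack).toFunctor := by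
    refine CategoryTheory.Functor.hext (fun x => mapObj_id x) fun x y f => ?_
    refine Hom.hext (mapObj_id x) (mapObj_id y) _ _ HEq.rfl (heq_of_eq ?_)
    funext i a b ha hb T u v hT h
    cases ha
    rfl
  generalize (EqMap.id 𝔛).mor = F at *
  generalize BasedFunctor.id 𝔛.toStack = G at *
  cases F; cases G; congr

end EqMap

/-- A morphism of descent data over an isomorphism of schemes is invertible. -/
lemma isIso_of_isIso_base {x y : Obj 𝔛} (f : x ⟶ y) (g : y.base ⟶ x.base)
    (h₁ : Hom.base f ≫ g = 𝟙 _) (h₂ : g ≫ Hom.base f = 𝟙 _) : IsIso f := by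
  have aux : ∀ {a : x.A} {b : y.A} {T : SchC} (u : T ⟶ y.cov b) (v : T ⟶ x.cov a),
      u ≫ y.proj b ≫ g = v ≫ x.proj a → v ≫ x.proj a ≫ Hom.base f = u ≫ y.proj b := by
    intro a b T u v h
    rw [← reassoc_of% h, h₂, Category.comp_id]
  -- The inverse needs no gluing: the elements of `f` are given on all overlaps of the two
  -- coverings, so it is enough to exchange the two charts and invert. The left and right
  -- compatibilities with transition elements exchange their roles. Only the two composites have to
  -- be compared étale locally.
  let l : Hom y x :=
    { base := g
      idx_eq := fun u v hT h => (Hom.idx_eq f v u hT (aux u v h)).symm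
      k := fun ha hb _ u v hT h => (Hom.k f hb ha v u hT (aux u v h))⁻¹
      k_map := fun ha hb _ _ p u v hS hT h => by
        rw [map_inv, Hom.k_map f _ _ _ _ _ hS]
      act_k := fun {i a b} ha hb T u v hT h => by
        rw [← Hom.act_k f hb ha v u hT (aux u v h), ← 𝔛.act_mul, mul_inv_cancel, 𝔛.act_one]
      tr_k := fun {i a a' b} ha ha' hb T u u' v hT h h' => by
        rw [← Hom.k_tr f hb ha ha' v u u' hT (aux u v (by rw [reassoc_of% h, h'])) h]
        simp
      k_tr := fun {i a b b'} ha hb hb' T u v v' hT h h' => by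
        rw [← Hom.tr_k f hb hb' ha v v' u hT h' (aux u v' (h.trans h'))]
        simp }
  refine ⟨l, ?_, ?_⟩
  · refine Hom.ext' _ _ h₁ fun {i a c} ha hc T u w hT h h' => ?_
    have e : u ≫ x.proj a = w ≫ x.proj c := by
      have h'' : u ≫ x.proj a ≫ 𝟙 _ = w ≫ x.proj c := h'
      simpa using h''
    refine glue_eq (y := y) (u ≫ x.proj a ≫ Hom.base f) _ _ fun {b Z} p v hZ hp => ?_
    have hb : y.idx b = i := by
      rw [← ha]; exact (Hom.idx_eq f (p ≫ u) v hZ (by simpa using hp)).symm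
    have e1 : (p ≫ u) ≫ x.proj a ≫ Hom.base f = v ≫ y.proj b := by simpa using hp
    have e1' : (p ≫ w) ≫ x.proj c ≫ Hom.base f = v ≫ y.proj b := by
      rw [← e1, Category.assoc, Category.assoc, reassoc_of% e]
    have e2 : v ≫ y.proj b ≫ g = (p ≫ w) ≫ x.proj c := by
      rw [← reassoc_of% e1', h₁, Category.comp_id]; simp
    refine ((compHom f l).k_map ha hc p u w hZ hT h).trans
      (Eq.trans ?_ ((idHom x).k_map ha hc p u w hZ hT h').symm)
    rw [compHom_k f l ha hb hc (p ≫ u) v (p ≫ w) hZ e1 e2]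
    change Hom.k f _ _ _ _ _ _ * (Hom.k f _ _ _ _ _ _)⁻¹ = x.tr _ _ _ _ _ _
    rw [← Hom.tr_k f ha hc hb (p ≫ u) (p ≫ w) v hZ (by simp [e]) e1']
    simp
  · refine Hom.ext' _ _ h₂ fun {i a c} ha hc T u w hT h h' => ?_
    have e : u ≫ y.proj a = w ≫ y.proj c := by
      have h'' : u ≫ y.proj a ≫ 𝟙 _ = w ≫ y.proj c := h'
      simpa using h''
    refine glue_eq (y := x) (u ≫ y.proj a ≫ g) _ _ fun {b Z} p v hZ hp => ?_
    have e1 : (p ≫ u) ≫ y.proj a ≫ g = v ≫ x.proj b := by simpa using hp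
    have e2 : v ≫ x.proj b ≫ Hom.base f = (p ≫ u) ≫ y.proj a := aux _ _ e1
    have e2' : v ≫ x.proj b ≫ Hom.base f = (p ≫ w) ≫ y.proj c := by rw [e2]; simp [e]
    have hb : x.idx b = i := by
      rw [← ha]; exact Hom.idx_eq f v (p ≫ u) hZ e2
    refine ((compHom l f).k_map ha hc p u w hZ hT h).trans
      (Eq.trans ?_ ((idHom y).k_map ha hc p u w hZ hT h').symm)
    rw [compHom_k l f ha hb hc (p ≫ u) v (p ≫ w) hZ e1 e2']
    change (Hom.k f _ _ _ _ _ _)⁻¹ * Hom.k f _ _ _ _ _ _ = y.tr _ _ _ _ _ _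
    rw [← Hom.k_tr f hb ha hc v (p ≫ u) (p ≫ w) hZ e2 (by simp [e])]
    simp

end QStack

/-! ### Fibre products of presentations: the comparison functor is fully faithful. -/

namespace QStack

variable {𝔛 𝔜 ℨ 𝔚 : QStack}

lemma Obj.tr_self (x : Obj 𝔛) {i : 𝔛.ι} {a : x.A} (ha hb : x.idx a = i) {T : SchC}
    (u : T ⟶ x.cov a) (hT : Nonempty T.left) (h : u ≫ x.proj a = u ≫ x.proj a) :
    x.tr ha hb u u hT h = 1 := by
  have := x.tr_mul ha hb hb u u u hT rfl rfl
  simpa using this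

lemma Obj.tr_congr (x : Obj 𝔛) {i : 𝔛.ι} {a b : x.A} (ha : x.idx a = i) (hb : x.idx b = i)
    {T : SchC} {u u' : T ⟶ x.cov a} {v v' : T ⟶ x.cov b} (hu : u = u') (hv : v = v')
    (hT : Nonempty T.left) (h : u ≫ x.proj a = v ≫ x.proj b)
    (h' : u' ≫ x.proj a = v' ≫ x.proj b) : x.tr ha hb u v hT h = x.tr ha hb u' v' hT h' := by
  subst hu hv; rfl

lemma Hom.k_congr {x y : Obj 𝔛} {f g : Hom x y} (e : f = g) {i : 𝔛.ι} {a : x.A} {b : y.A}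
    (ha : x.idx a = i) (hb : y.idx b = i) {T : SchC} (u : T ⟶ x.cov a) (v : T ⟶ y.cov b)
    (hT : Nonempty T.left) (h : u ≫ x.proj a ≫ f.base = v ≫ y.proj b) :
    f.k ha hb u v hT h = g.k ha hb u v hT (by rw [← e]; exact h) := by
  subst e; rfl

lemma res_comp {j i : 𝔛.ι} (h : j = i) {U T S : SchC} (f : S ⟶ T) (u : T ⟶ U)
    (x : (𝔛.X j).obj (op U)) : (𝔛.X i).map f.op (𝔛.res h u x) = 𝔛.res h (f ≫ u) x := by
  simp [res]

namespace EqMap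

lemma onG_one (φ : EqMap 𝔛 𝔜) (i : 𝔛.ι) (T : SchC) :
    φ.onG i (1 : (𝔛.G i).obj (op T)) = 1 := by
  have := φ.onG_mul i (1 : (𝔛.G i).obj (op T)) 1
  simpa using this

lemma onG_inv (φ : EqMap 𝔛 𝔜) (i : 𝔛.ι) {T : SchC} (g : (𝔛.G i).obj (op T)) :
    φ.onG i g⁻¹ = (φ.onG i g)⁻¹ := by
  rw [eq_inv_iff_mul_eq_one, ← φ.onG_mul, inv_mul_cancel, onG_one]

lemma onX_res (φ : EqMap 𝔛 𝔜) {i j : 𝔛.ι} (h : i = j) {T U : SchC} (u : T ⟶ U)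
    (x : (𝔛.X i).obj (op U)) :
    φ.onX j (𝔛.res h u x) = 𝔜.res (congrArg φ.idx h) u (φ.onX i x) := by
  subst h; exact (φ.onX_map i u x).symm

end EqMap

/-- The presentation `𝔚` is the fibre product of the presentations of `𝔛` and `𝔜` over that of
`ℨ`, and `ψ` is surjective on the groups of `T`-points. -/
structure IsStrictPullback (p : EqMap 𝔚 𝔛) (q : EqMap 𝔚 𝔜) (φ : EqMap 𝔛 ℨ) (ψ : EqMap 𝔜 ℨ) :
    Prop where
  idx_comm : ∀ l, φ.idx (p.idx l) = ψ.idx (q.idx l)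
  onX_comm : ∀ (l) {T : SchC} (z : (𝔚.X l).obj (op T)),
    ℨ.res (idx_comm l) (𝟙 T) (φ.onX _ (p.onX l z)) = ψ.onX _ (q.onX l z)
  onG_comm : ∀ (l) {T : SchC} (g : (𝔚.G l).obj (op T)),
    φ.onG' (idx_comm l) (p.onG l g) = ψ.onG _ (q.onG l g)
  idx_inj : ∀ l l', p.idx l = p.idx l' → q.idx l = q.idx l' → l = l'
  idx_surj : ∀ i j, φ.idx i = ψ.idx j → ∃ l, p.idx l = i ∧ q.idx l = j
  onX_inj : ∀ (l) {T : SchC} (z z' : (𝔚.X l).obj (op T)),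
    p.onX l z = p.onX l z' → q.onX l z = q.onX l z' → z = z'
  onX_surj : ∀ (l) {T : SchC} (x : (𝔛.X (p.idx l)).obj (op T)) (y : (𝔜.X (q.idx l)).obj (op T)),
    ℨ.res (idx_comm l) (𝟙 T) (φ.onX _ x) = ψ.onX _ y → ∃ z, p.onX l z = x ∧ q.onX l z = y
  onG_inj : ∀ (l) {T : SchC} (g g' : (𝔚.G l).obj (op T)),
    p.onG l g = p.onG l g' → q.onG l g = q.onG l g' → g = g'
  onG_surj : ∀ (l) {T : SchC} (g : (𝔛.G (p.idx l)).obj (op T)) (h : (𝔜.G (q.idx l)).obj (op T)),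
    φ.onG' (idx_comm l) g = ψ.onG _ h → ∃ c, p.onG l c = g ∧ q.onG l c = h
  lift_onG : ∀ (j) {T : SchC} (k : (ℨ.G (ψ.idx j)).obj (op T)), ∃ h, ψ.onG j h = k

namespace IsStrictPullback

variable {p : EqMap 𝔚 𝔛} {q : EqMap 𝔚 𝔜} {φ : EqMap 𝔛 ℨ} {ψ : EqMap 𝔜 ℨ}
  (H : IsStrictPullback p q φ ψ)

include H

lemma onG'_comm {l : 𝔚.ι} {j : ℨ.ι} (h : φ.idx (p.idx l) = j) (h' : ψ.idx (q.idx l) = j)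
    {T : SchC} (g : (𝔚.G l).obj (op T)) :
    φ.onG' h (p.onG l g) = ψ.onG' h' (q.onG l g) := by
  subst h'; exact H.onG_comm l g

lemma res_comm {l : 𝔚.ι} {j : ℨ.ι} (h : φ.idx (p.idx l) = j) (h' : ψ.idx (q.idx l) = j)
    {T U : SchC} (u : T ⟶ U) (z : (𝔚.X l).obj (op U)) :
    ℨ.res h u (φ.onX _ (p.onX l z)) = ℨ.res h' u (ψ.onX _ (q.onX l z)) := by
  subst h'
  have := congrArg ((ℨ.X _).map u.op) (H.onX_comm l z)
  rw [res_comp, Category.comp_id] at this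
  exact this

lemma mapTr_comm (w : Obj 𝔚) {j : ℨ.ι} {a b : w.A} (h : φ.idx (p.idx (w.idx a)) = j)
    (h' : ψ.idx (q.idx (w.idx a)) = j) {T : SchC} (u : T ⟶ w.cov a) (v : T ⟶ w.cov b)
    (hT : Nonempty T.left) (e : u ≫ w.proj a = v ≫ w.proj b) :
    φ.mapTr (p.mapObj w) h u v hT e = ψ.mapTr (q.mapObj w) h' u v hT e :=
  H.onG'_comm h h' _

/-- The 2-isomorphism of the square. -/
def sqHom (w : Obj 𝔚) : Hom (φ.mapObj (p.mapObj w)) (ψ.mapObj (q.mapObj w)) where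
  base := 𝟙 _
  idx_eq u v hT h := (congrArg (fun i => φ.idx (p.idx i))
    (w.idx_eq u v hT (by simpa [EqMap.mapObj] using h))).trans (H.idx_comm _)
  k ha _ _ u v hT h := φ.mapTr (p.mapObj w) ha u v hT (by simpa [EqMap.mapObj] using h)
  k_map ha hb _ _ f u v hS hT h :=
    (φ.mapObj (p.mapObj w)).tr_map ha ((H.idx_comm _).trans hb) f u v hS hT _
  act_k ha hb _ u v hT h :=
    ((φ.mapObj (p.mapObj w)).act_tr ha ((H.idx_comm _).trans hb) u v hT _).trans
      (H.res_comm _ _ _ _)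
  tr_k ha ha' hb _ u u' v hT h h' :=
    (φ.mapObj (p.mapObj w)).tr_mul ha ha' ((H.idx_comm _).trans hb) u u' v hT h _
  k_tr ha hb hb' _ u v v' hT h h' :=
    (congrArg (_ * ·) (H.mapTr_comm w ((H.idx_comm _).trans hb) hb v v' hT h').symm).trans
    ((φ.mapObj (p.mapObj w)).tr_mul ha ((H.idx_comm _).trans hb) ((H.idx_comm _).trans hb')
      u v v' hT _ h')

/-- The two images of `w` have the same covering, and on one chart the element of `sqHom` is the
transition element of that chart with itself, hence `1` by `Obj.tr_self`. So `sqHom` does not change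
group elements when a chart of `w` serves as intermediate chart; `sqHom_comp_k` is the same on the
other side. -/
lemma comp_sqHom_k {x : Obj ℨ} {w : Obj 𝔚} (f : Hom x (φ.mapObj (p.mapObj w))) {i : ℨ.ι} {a : x.A}
    {b : w.A} (ha : x.idx a = i) (hb : ψ.idx (q.idx (w.idx b)) = i)
    (hb' : φ.idx (p.idx (w.idx b)) = i) {T : SchC} (u : T ⟶ x.cov a) (v : T ⟶ w.cov b)
    (hT : Nonempty T.left) (h : u ≫ x.proj a ≫ (compHom f (H.sqHom w)).base = v ≫ w.proj b)
    (h' : u ≫ x.proj a ≫ f.base = v ≫ w.proj b) :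
    (compHom f (H.sqHom w)).k ha hb u v hT h = f.k ha hb' u v hT h' := by
  rw [compHom_k f (H.sqHom w) ha hb' hb u v v hT h' (by simp [sqHom, EqMap.mapObj]) h]
  have : (H.sqHom w).k hb' hb v v hT (by simp [sqHom, EqMap.mapObj]) = 1 :=
    (φ.mapObj (p.mapObj w)).tr_self hb' hb' v hT rfl
  rw [this, mul_one]

lemma sqHom_comp_k {x : Obj ℨ} {w : Obj 𝔚} (f : Hom (ψ.mapObj (q.mapObj w)) x) {i : ℨ.ι} {a : w.A}
    {b : x.A} (ha : φ.idx (p.idx (w.idx a)) = i) (ha' : ψ.idx (q.idx (w.idx a)) = i)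
    (hb : x.idx b = i) {T : SchC} (u : T ⟶ w.cov a) (v : T ⟶ x.cov b)
    (hT : Nonempty T.left) (h : u ≫ w.proj a ≫ (compHom (H.sqHom w) f).base = v ≫ x.proj b)
    (h' : u ≫ w.proj a ≫ f.base = v ≫ x.proj b) :
    (compHom (H.sqHom w) f).k ha hb u v hT h = f.k ha' hb u v hT h' := by
  rw [compHom_k (H.sqHom w) f ha ha' hb u u v hT (by simp [sqHom, EqMap.mapObj]) h' h]
  have : (H.sqHom w).k ha ha' u u hT (by simp [sqHom, EqMap.mapObj]) = 1 :=
    (φ.mapObj (p.mapObj w)).tr_self ha ha u hT rfl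
  rw [this, one_mul]

lemma sqHom_naturality {w w' : Obj 𝔚} (f : Hom w w') :
    compHom (φ.mapHom (p.mapHom f)) (H.sqHom w') =
      compHom (H.sqHom w) (ψ.mapHom (q.mapHom f)) := by
  have hbase : (compHom (φ.mapHom (p.mapHom f)) (H.sqHom w')).base = f.base := Category.comp_id _
  refine Hom.ext' _ _ (hbase.trans (Category.id_comp _).symm)
    fun {i a c} ha hc T u v hT h h' => ?_
  have hc' := (H.idx_comm _).trans hc
  have ha' := (H.idx_comm _).symm.trans ha
  have e : u ≫ w.proj a ≫ f.base = v ≫ w'.proj c := by rw [← hbase]; exact h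
  rw [H.comp_sqHom_k _ ha hc hc' u v hT h e, H.sqHom_comp_k _ ha ha' hc u v hT h' e]
  exact H.onG'_comm _ _ _

/-- The 2-isomorphism of the square. -/
def natTrans : p.mor.comp φ.mor ⟶ q.mor.comp ψ.mor where
  app w := H.sqHom w
  naturality _ _ f := H.sqHom_naturality f
  isHomLift' w := IsHomLift.map ℨ.toStack.p (a := φ.mapObj (p.mapObj w))
    (b := ψ.mapObj (q.mapObj w)) (H.sqHom w)

/-- All components lie over identities of schemes, so `isIso_of_isIso_base` makes them invertible.
-/
lemma isIso_natTrans : IsIso H.natTrans := by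
  have : ∀ w, IsIso (H.natTrans.toNatTrans.app w) := fun w =>
    isIso_of_isIso_base (𝔛 := ℨ) (H.sqHom w) (𝟙 _) (Category.comp_id _) (Category.comp_id _)
  have : IsIso (X := (p.mor.comp φ.mor).toFunctor) H.natTrans.toNatTrans :=
    NatIso.isIso_of_isIso_app _
  exact BasedNatIso.isIso_of_toNatTrans_isIso _

/-- The 2-isomorphism of the square. -/
def iso : p.mor.comp φ.mor ≅ q.mor.comp ψ.mor :=
  have := H.isIso_natTrans
  asIso H.natTrans

/-- The functor to the 2-fibre product. -/
abbrev toPullback : 𝔚.toStack.obj ⥤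
    CategoricalPullback φ.mor.toFunctor ψ.mor.toFunctor :=
  (CategoricalPullback.CatCommSqOver.toFunctorToCategoricalPullback φ.mor.toFunctor
    ψ.mor.toFunctor _).obj
      ⟨p.mor.toFunctor, q.mor.toFunctor, (BasedNatTrans.forgetful _ _).mapIso H.iso⟩

lemma mapHom_inj {w w' : Obj 𝔚} {f g : Hom w w'} (hp : p.mapHom f = p.mapHom g)
    (hq : q.mapHom f = q.mapHom g) : f = g := by
  have hb : f.base = g.base := congrArg (Hom.base (x := p.mapObj w) (y := p.mapObj w')) hp
  refine Hom.ext' _ _ hb fun {i a b} ha hb T u v hT e e' => ?_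
  subst ha
  exact H.onG_inj _ _ _ (Hom.k_congr hp rfl (congrArg p.idx hb) u v hT e)
    (Hom.k_congr hq rfl (congrArg q.idx hb) u v hT e)

/-- By `comp_sqHom_k` and `sqHom_comp_k`, the equation `hAB` evaluated on an overlap says exactly
that the elements of `A` and `B` have the same image in the group of `ℨ`. They therefore come from
the fibre product of the groups. -/
lemma exists_k {w w' : Obj 𝔚} (A : Hom (p.mapObj w) (p.mapObj w'))
    (B : Hom (q.mapObj w) (q.mapObj w'))
    (hAB : compHom (φ.mapHom A) (H.sqHom w') = compHom (H.sqHom w) (ψ.mapHom B))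
    (f : w.base ⟶ w'.base) (hA : A.base = f) (hB : B.base = f) {i : 𝔚.ι} {a : w.A} {b : w'.A}
    (ha : w.idx a = i) (hb : w'.idx b = i) {T : SchC} (u : T ⟶ w.cov a) (v : T ⟶ w'.cov b)
    (hT : Nonempty T.left) (h : u ≫ w.proj a ≫ f = v ≫ w'.proj b) :
    ∃ k : (𝔚.G i).obj (op T),
      p.onG i k = A.k (congrArg p.idx ha) (congrArg p.idx hb) u v hT (by rw [hA]; exact h) ∧
      q.onG i k = B.k (congrArg q.idx ha) (congrArg q.idx hb) u v hT (by rw [hB]; exact h) := by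
  refine H.onG_surj _ _ _ ?_
  subst ha
  have h1 : (compHom (φ.mapHom A) (H.sqHom w')).base = f := (Category.comp_id _).trans hA
  have hc : ψ.idx (q.idx (w'.idx b)) = ψ.idx (q.idx (w.idx a)) := by rw [hb]
  have hc' := (H.idx_comm _).trans hc
  have e : u ≫ w.proj a ≫ (compHom (φ.mapHom A) (H.sqHom w')).base = v ≫ w'.proj b := by
    rw [h1]; exact h
  have e' : u ≫ w.proj a ≫ B.base = v ≫ w'.proj b := by rw [hB]; exact h
  have e'' : u ≫ w.proj a ≫ A.base = v ≫ w'.proj b := by rw [hA]; exact h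
  have e1 := H.comp_sqHom_k (φ.mapHom A) (H.idx_comm _) hc hc' u v hT e e''
  have e2 := H.sqHom_comp_k (ψ.mapHom B) (H.idx_comm _) rfl hc u v hT (by rw [← hAB]; exact e) e'
  exact e1.symm.trans ((Hom.k_congr hAB _ _ u v hT e).trans e2)

/-- This is fullness. The lifted elements are determined by their two images, so the axioms of a
morphism of descent data are inherited from `A` and `B`. -/
lemma exists_hom {w w' : Obj 𝔚} (A : Hom (p.mapObj w) (p.mapObj w'))
    (B : Hom (q.mapObj w) (q.mapObj w'))
    (hAB : compHom (φ.mapHom A) (H.sqHom w') = compHom (H.sqHom w) (ψ.mapHom B)) :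
    ∃ f : Hom w w', p.mapHom f = A ∧ q.mapHom f = B := by
  obtain ⟨f, hB⟩ : ∃ f : w.base ⟶ w'.base, B.base = f := ⟨_, rfl⟩
  have hA : A.base = f := by
    have h1 : A.base ≫ 𝟙 _ = 𝟙 _ ≫ B.base := congrArg Hom.base hAB
    rwa [Category.comp_id, Category.id_comp, hB] at h1
  have hA' : ∀ {a : w.A} {b : w'.A} {T : SchC} {u : T ⟶ w.cov a} {v : T ⟶ w'.cov b},
      u ≫ w.proj a ≫ f = v ≫ w'.proj b → u ≫ w.proj a ≫ A.base = v ≫ w'.proj b := by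
    rw [hA]; exact fun h => h
  have hB' : ∀ {a : w.A} {b : w'.A} {T : SchC} {u : T ⟶ w.cov a} {v : T ⟶ w'.cov b},
      u ≫ w.proj a ≫ f = v ≫ w'.proj b → u ≫ w.proj a ≫ B.base = v ≫ w'.proj b := by
    rw [hB]; exact fun h => h
  obtain ⟨k, hp, hq⟩ : ∃ k : ∀ {i : 𝔚.ι} {a : w.A} {b : w'.A} (_ : w.idx a = i)
      (_ : w'.idx b = i) {T : SchC} (u : T ⟶ w.cov a) (v : T ⟶ w'.cov b), Nonempty T.left →
      u ≫ w.proj a ≫ f = v ≫ w'.proj b → (𝔚.G i).obj (op T),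
      (∀ {i : 𝔚.ι} {a : w.A} {b : w'.A} (ha : w.idx a = i) (hb : w'.idx b = i) {T : SchC}
        (u : T ⟶ w.cov a) (v : T ⟶ w'.cov b) (hT : Nonempty T.left)
        (h : u ≫ w.proj a ≫ f = v ≫ w'.proj b), p.onG i (k ha hb u v hT h) =
          A.k (congrArg p.idx ha) (congrArg p.idx hb) u v hT (hA' h)) ∧
      (∀ {i : 𝔚.ι} {a : w.A} {b : w'.A} (ha : w.idx a = i) (hb : w'.idx b = i) {T : SchC}
        (u : T ⟶ w.cov a) (v : T ⟶ w'.cov b) (hT : Nonempty T.left)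
        (h : u ≫ w.proj a ≫ f = v ≫ w'.proj b), q.onG i (k ha hb u v hT h) =
          B.k (congrArg q.idx ha) (congrArg q.idx hb) u v hT (hB' h)) :=
    ⟨fun ha hb _ u v hT h => (H.exists_k A B hAB f hA hB ha hb u v hT h).choose,
      fun ha hb _ u v hT h => (H.exists_k A B hAB f hA hB ha hb u v hT h).choose_spec.1,
      fun ha hb _ u v hT h => (H.exists_k A B hAB f hA hB ha hb u v hT h).choose_spec.2⟩
  have htr : ∀ {𝔛' : QStack} (p' : EqMap 𝔚 𝔛') (x : Obj 𝔚) {i : 𝔚.ι} {a b : x.A}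
      (ha : x.idx a = i) (hb : x.idx b = i) {T : SchC} (u : T ⟶ x.cov a) (v : T ⟶ x.cov b)
      (hT : Nonempty T.left) (h : u ≫ x.proj a = v ≫ x.proj b),
      p'.onG i (x.tr ha hb u v hT h) =
        (p'.mapObj x).tr (congrArg p'.idx ha) (congrArg p'.idx hb) u v hT h := by
    intro 𝔛' p' x i a b ha hb T u v hT h
    subst ha; rfl
  -- Each axiom is tested after applying `p` and `q`, which are jointly injective on indices,
  -- sections and group elements.
  let F : Hom w w' :=
    { base := f
      idx_eq := fun u v hT h => H.idx_inj _ _ (A.idx_eq u v hT (hA' h))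
        (B.idx_eq u v hT (hB' h))
      k := fun ha hb T u v hT h => k ha hb u v hT h
      k_map := fun {i a b} ha hb S T f u v hS hT h => by
        apply H.onG_inj
        · rw [hp, ← p.onG_map, hp]
          exact A.k_map _ _ f u v hS hT (hA' h)
        · rw [hq, ← q.onG_map, hq]
          exact B.k_map _ _ f u v hS hT (hB' h)
      act_k := fun {i a b} ha hb T u v hT h => by
        apply H.onX_inj
        · rw [p.onX_act, hp, p.onX_res, p.onX_res]
          exact A.act_k _ _ u v hT (hA' h)
        · rw [q.onX_act, hq, q.onX_res, q.onX_res]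
          exact B.act_k _ _ u v hT (hB' h)
      tr_k := fun {i a a' b} ha ha' hb T u u' v hT h h' => by
        apply H.onG_inj
        · rw [p.onG_mul, hp, hp, htr p]
          exact A.tr_k _ _ _ u u' v hT h (hA' h')
        · rw [q.onG_mul, hq, hq, htr q]
          exact B.tr_k _ _ _ u u' v hT h (hB' h')
      k_tr := fun {i a b b'} ha hb hb' T u v v' hT h h' => by
        apply H.onG_inj
        · rw [p.onG_mul, hp, hp, htr p]
          exact A.k_tr _ _ _ u v v' hT (hA' h) h'
        · rw [q.onG_mul, hq, hq, htr q]
          exact B.k_tr _ _ _ u v v' hT (hB' h) h' }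
  refine ⟨F, Hom.ext' _ _ hA.symm ?_, Hom.ext' _ _ hB.symm ?_⟩
  · intro i a b ha hb T u v hT h h'
    subst ha
    exact hp _ _ _ _ _ _
  · intro i a b ha hb T u v hT h h'
    subst ha
    exact hq _ _ _ _ _ _

lemma faithful : H.toPullback.Faithful where
  map_injective {w w'} _ _ h :=
    H.mapHom_inj (w := w) (w' := w') (congrArg CategoricalPullback.Hom.fst h)
      (congrArg CategoricalPullback.Hom.snd h)

lemma full : H.toPullback.Full where
  map_surjective {w w'} f := by
    obtain ⟨F, h1, h2⟩ := H.exists_hom (w := w) (w' := w') (CategoricalPullback.Hom.fst f)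
      (CategoricalPullback.Hom.snd f) (CategoricalPullback.Hom.w f)
    exact ⟨F, CategoricalPullback.Hom.ext h1 h2⟩

end IsStrictPullback

end QStack

/-- The fibre product of two schemes over `S`. -/
def overlap {U V S : SchC} (f : U ⟶ S) (g : V ⟶ S) : SchC :=
  Over.mk (pullback.fst f.left g.left ≫ U.hom)

/-- The first projection of the fibre product. -/
def overlapFst {U V S : SchC} (f : U ⟶ S) (g : V ⟶ S) : overlap f g ⟶ U :=
  Over.homMk (pullback.fst f.left g.left)

/-- The second projection of the fibre product. -/
def overlapSnd {U V S : SchC} (f : U ⟶ S) (g : V ⟶ S) : overlap f g ⟶ V :=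
  Over.homMk (pullback.snd f.left g.left) (by
    simp only [overlap, Over.mk_hom, ← Over.w g, ← pullback.condition_assoc, Over.w f])

lemma overlap_condition {U V S : SchC} (f : U ⟶ S) (g : V ⟶ S) :
    overlapFst f g ≫ f = overlapSnd f g ≫ g := by
  ext1; exact pullback.condition

lemma etale_overlapFst {U V S : SchC} (f : U ⟶ S) (g : V ⟶ S) (hg : Etale g.left) :
    Etale (overlapFst f g).left := by
  exact inferInstanceAs (Etale (pullback.fst f.left g.left))

lemma exists_overlap {U V S : SchC} (f : U ⟶ S) (g : V ⟶ S) (u : U.left) (v : V.left)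
    (h : f.left u = g.left v) : ∃ z : (overlap f g).left, (overlapFst f g).left z = u := by
  obtain ⟨z, hz, -⟩ := Scheme.Pullback.exists_preimage_pullback u v h
  exact ⟨z, hz⟩

/-! ### Essential surjectivity: gluing an object of the fibre product. -/

namespace QStack

variable {𝔛 𝔜 ℨ 𝔚 : QStack}

namespace IsStrictPullback

variable {p : EqMap 𝔚 𝔛} {q : EqMap 𝔚 𝔜} {φ : EqMap 𝔛 ℨ} {ψ : EqMap 𝔜 ℨ}
  (H : IsStrictPullback p q φ ψ) {x : Obj 𝔛} {y : Obj 𝔜} (θ : Hom (φ.mapObj x) (ψ.mapObj y))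

/-- A common refinement of the coverings of `x` and `y`, together with an index of `𝔚` and lifts of
the group elements of `θ` to `𝔜`. -/
structure Refinement where
  C : Type
  cov : C → SchC
  α : C → x.A
  β : C → y.A
  fst : ∀ c, cov c ⟶ x.cov (α c)
  snd : ∀ c, cov c ⟶ y.cov (β c)
  condition : ∀ c, fst c ≫ x.proj (α c) ≫ θ.base = snd c ≫ y.proj (β c)
  etale : ∀ c, Etale (fst c ≫ x.proj (α c)).left
  surj : ∀ s : x.base.left, ∃ c, s ∈ Set.range (fst c ≫ x.proj (α c)).left
  nonempty : ∀ c, Nonempty (cov c).left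
  idx : C → 𝔚.ι
  idx_fst : ∀ c, x.idx (α c) = p.idx (idx c)
  idx_snd : ∀ c, y.idx (β c) = q.idx (idx c)
  lift : ∀ c, (𝔜.G (q.idx (idx c))).obj (op (cov c))
  onG_lift : ∀ c, ψ.onG _ (lift c) = θ.k (i := ψ.idx (q.idx (idx c)))
    ((congrArg φ.idx (idx_fst c)).trans (H.idx_comm _)) (congrArg ψ.idx (idx_snd c))
    (fst c) (snd c) (nonempty c) (condition c)

/-- The refinement consists of the overlaps of the charts of `x` with those of `y` pulled back along
`θ`. Since `lift_onG` is surjectivity on `T`-points and not merely étale local surjectivity, the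
elements of `θ` lift on these overlaps without refining further. -/
lemma exists_refinement : Nonempty (Refinement H θ) := by
  let f : ∀ c : x.A × y.A, x.cov c.1 ⟶ y.base := fun c => x.proj c.1 ≫ θ.base
  -- Empty overlaps are discarded: on them `θ` neither compares the indices nor provides a group
  -- element.
  let C : Type := {c : x.A × y.A // Nonempty (overlap (f c) (y.proj c.2)).left}
  have cond : ∀ c : C, overlapFst (f c.1) (y.proj c.1.2) ≫ x.proj c.1.1 ≫ θ.base =
      overlapSnd (f c.1) (y.proj c.1.2) ≫ y.proj c.1.2 := fun c => overlap_condition _ _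
  have hidx : ∀ c : C, ∃ l, p.idx l = x.idx c.1.1 ∧ q.idx l = y.idx c.1.2 := fun c =>
    H.idx_surj _ _ (θ.idx_eq _ _ c.2 (cond c))
  choose l hl using hidx
  choose k hk using fun c : C => H.lift_onG (q.idx (l c)) (θ.k (i := ψ.idx (q.idx (l c)))
    ((congrArg φ.idx (hl c).1.symm).trans (H.idx_comm _)) (congrArg ψ.idx (hl c).2.symm)
    (overlapFst (f c.1) (y.proj c.1.2)) (overlapSnd (f c.1) (y.proj c.1.2)) c.2 (cond c))
  refine ⟨⟨C, fun c => overlap (f c.1) (y.proj c.1.2), fun c => c.1.1, fun c => c.1.2,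
    fun c => overlapFst _ _, fun c => overlapSnd _ _, cond, fun c => ?_, fun s => ?_, fun c => c.2,
    l, fun c => (hl c).1.symm, fun c => (hl c).2.symm, k, hk⟩⟩
  · have := x.etale c.1.1
    have := etale_overlapFst (f c.1) (y.proj c.1.2) (y.etale _)
    rw [Over.comp_left]
    infer_instance
  · obtain ⟨a, u, rfl⟩ := x.surj s
    obtain ⟨b, v, hv⟩ := y.surj (θ.base.left ((x.proj a).left u))
    obtain ⟨z, rfl⟩ := exists_overlap (f (a, b)) (y.proj b) u v hv.symm
    exact ⟨⟨(a, b), ⟨z⟩⟩, z, by simp⟩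

namespace Refinement

variable {H θ} (D : Refinement H θ)

/-- The restriction of the lifted group element. -/
def liftRes (c : D.C) {j : 𝔜.ι} (h : q.idx (D.idx c) = j) {T : SchC} (u : T ⟶ D.cov c) :
    (𝔜.G j).obj (op T) :=
  (𝔜.G j).map u.op (h ▸ D.lift c)

lemma liftRes_map (c : D.C) {j : 𝔜.ι} (h : q.idx (D.idx c) = j) {S T : SchC} (f : S ⟶ T)
    (u : T ⟶ D.cov c) : (𝔜.G j).map f.op (D.liftRes c h u) = D.liftRes c h (f ≫ u) := by
  simp [liftRes]

lemma condition' (c : D.C) {T : SchC} (u : T ⟶ D.cov c) :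
    (u ≫ D.fst c) ≫ x.proj (D.α c) ≫ θ.base = (u ≫ D.snd c) ≫ y.proj (D.β c) := by
  rw [Category.assoc, D.condition]
  exact (Category.assoc _ _ _).symm

lemma onG'_liftRes (c : D.C) {j : 𝔜.ι} {m : ℨ.ι} (h : q.idx (D.idx c) = j) (h' : ψ.idx j = m)
    (h₁ : φ.idx (x.idx (D.α c)) = m) (h₂ : ψ.idx (y.idx (D.β c)) = m) {T : SchC}
    (u : T ⟶ D.cov c) (hT : Nonempty T.left) :
    ψ.onG' h' (D.liftRes c h u) = θ.k h₁ h₂ (u ≫ D.fst c) (u ≫ D.snd c) hT (D.condition' c u) := by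
  subst h h'
  refine (ψ.onG_map _ u (D.lift c)).symm.trans ?_
  rw [D.onG_lift]
  exact θ.k_map _ _ u _ _ hT (D.nonempty c) (D.condition c)

/-- On a chart, `θ` moves the image of the section of `x` to the image of the section of `y` by the
element `k`. Moving the section of `y` by the inverse of the lift of `k` thus makes the two images
equal, and the pair becomes a section of the fibre product. -/
lemma exists_sec (c : D.C) : ∃ z : (𝔚.X (D.idx c)).obj (op (D.cov c)),
    p.onX _ z = 𝔛.res (D.idx_fst c) (D.fst c) (x.sec (D.α c)) ∧
    q.onX _ z = 𝔜.act _ (𝔜.res (D.idx_snd c) (D.snd c) (y.sec (D.β c))) (D.lift c)⁻¹ := by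
  refine H.onX_surj _ _ _ ?_
  rw [ψ.onX_act, ψ.onX_res, ψ.onG_inv, D.onG_lift]
  have h := θ.act_k (i := ψ.idx (q.idx (D.idx c)))
    ((congrArg φ.idx (D.idx_fst c)).trans (H.idx_comm _)) (congrArg ψ.idx (D.idx_snd c))
    (D.fst c) (D.snd c) (D.nonempty c) (D.condition c)
  have h' := congrArg (fun z => ℨ.act _ z (θ.k (i := ψ.idx (q.idx (D.idx c)))
    ((congrArg φ.idx (D.idx_fst c)).trans (H.idx_comm _)) (congrArg ψ.idx (D.idx_snd c))
    (D.fst c) (D.snd c) (D.nonempty c) (D.condition c))⁻¹) h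
  simp only [← ℨ.act_mul, mul_inv_cancel, ℨ.act_one] at h'
  refine Eq.trans ?_ h'
  rw [φ.onX_res]
  have aux : ∀ {i j k : ℨ.ι} (e : i = j) (e' : j = k) {U T : SchC} (u : T ⟶ U)
      (z : (ℨ.X i).obj (op U)), ℨ.res e' (𝟙 T) (ℨ.res e u z) = ℨ.res (e.trans e') u z := by
    intro i j k e e' U T u z
    subst e e'
    simp [res]
  exact aux _ _ _ _

/-- The section of `𝔚`. -/
def sec (c : D.C) : (𝔚.X (D.idx c)).obj (op (D.cov c)) := (D.exists_sec c).choose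

lemma onX_res_sec_fst (c : D.C) {i : 𝔚.ι} (hc : D.idx c = i) {T : SchC} (u : T ⟶ D.cov c) :
    p.onX i (𝔚.res hc u (D.sec c)) =
      𝔛.res ((D.idx_fst c).trans (congrArg p.idx hc)) (u ≫ D.fst c) (x.sec (D.α c)) := by
  subst hc
  rw [p.onX_res, sec, (D.exists_sec c).choose_spec.1]
  exact res_comp _ _ _ _

lemma onX_res_sec_snd (c : D.C) {i : 𝔚.ι} (hc : D.idx c = i) {T : SchC} (u : T ⟶ D.cov c) :
    q.onX i (𝔚.res hc u (D.sec c)) =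
      𝔜.act _ (𝔜.res ((D.idx_snd c).trans (congrArg q.idx hc)) (u ≫ D.snd c) (y.sec (D.β c)))
        (D.liftRes c (congrArg q.idx hc) u)⁻¹ := by
  subst hc
  rw [q.onX_res, sec, (D.exists_sec c).choose_spec.2]
  refine (𝔜.act_map _ _ _ _).trans ?_
  rw [map_inv]
  congr 1
  exact res_comp _ _ _ _

lemma overlap_snd {c d : D.C} {T : SchC} {u : T ⟶ D.cov c} {v : T ⟶ D.cov d}
    (h : u ≫ D.fst c ≫ x.proj (D.α c) = v ≫ D.fst d ≫ x.proj (D.α d)) :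
    (u ≫ D.snd c) ≫ y.proj (D.β c) = (v ≫ D.snd d) ≫ y.proj (D.β d) := by
  rw [← D.condition', ← D.condition']
  -- The type of `θ.base` mentions the bases of the images under `φ` and `ψ`, which are those of `x`
  -- and `y` only after unfolding; restating the type lets composites reassociate.
  let b : x.base ⟶ y.base := θ.base
  have h' := congrArg (· ≫ b) h
  simp only [Category.assoc] at h' ⊢
  exact h'

lemma overlap_fst {c d : D.C} {T : SchC} {u : T ⟶ D.cov c} {v : T ⟶ D.cov d}
    (h : u ≫ D.fst c ≫ x.proj (D.α c) = v ≫ D.fst d ≫ x.proj (D.α d)) :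
    (u ≫ D.fst c) ≫ x.proj (D.α c) = (v ≫ D.fst d) ≫ x.proj (D.α d) := by
  simpa using h

/-- The trivialisation of `y` has been changed by the lifts, so its transition elements are
conjugated to `l_c * tr * l_d⁻¹`. They match the transition elements of `x` in `ℨ` because `θ` is
compatible with the descent data on both sides: `φ(tr) * k_d` and `k_c * ψ(tr)` are both the element
of `θ` from the chart `c` of `x` to the chart `d` of `y`. -/
lemma exists_tr {i : 𝔚.ι} {c d : D.C} (hc : D.idx c = i) (hd : D.idx d = i) {T : SchC}
    (u : T ⟶ D.cov c) (v : T ⟶ D.cov d) (hT : Nonempty T.left)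
    (h : u ≫ D.fst c ≫ x.proj (D.α c) = v ≫ D.fst d ≫ x.proj (D.α d)) :
    ∃ g : (𝔚.G i).obj (op T),
      p.onG i g = x.tr ((D.idx_fst c).trans (congrArg p.idx hc))
        ((D.idx_fst d).trans (congrArg p.idx hd)) (u ≫ D.fst c) (v ≫ D.fst d) hT
        (D.overlap_fst h) ∧
      q.onG i g = D.liftRes c (congrArg q.idx hc) u *
        y.tr ((D.idx_snd c).trans (congrArg q.idx hc)) ((D.idx_snd d).trans (congrArg q.idx hd))
          (u ≫ D.snd c) (v ≫ D.snd d) hT (D.overlap_snd h) *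
        (D.liftRes d (congrArg q.idx hd) v)⁻¹ := by
  refine H.onG_surj _ _ _ ?_
  have hxc := (D.idx_fst c).trans (congrArg p.idx hc)
  have hxd := (D.idx_fst d).trans (congrArg p.idx hd)
  have hyc := (D.idx_snd c).trans (congrArg q.idx hc)
  have hyd := (D.idx_snd d).trans (congrArg q.idx hd)
  have hφc := (congrArg φ.idx hxc).trans (H.idx_comm i)
  have hφd := (congrArg φ.idx hxd).trans (H.idx_comm i)
  rw [ψ.onG_mul, ψ.onG_mul, ψ.onG_inv, eq_mul_inv_iff_mul_eq]
  have e1 := D.onG'_liftRes c (congrArg q.idx hc) rfl hφc (congrArg ψ.idx hyc) u hT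
  have e2 := D.onG'_liftRes d (congrArg q.idx hd) rfl hφd (congrArg ψ.idx hyd) v hT
  have e3 := φ.mapTr_eq x hφc (u ≫ D.fst c) (v ≫ D.fst d) hT (D.overlap_fst h) (H.idx_comm i)
    hxc hxd
  have e4 := ψ.mapTr_eq y (congrArg ψ.idx hyc) (u ≫ D.snd c) (v ≫ D.snd d) hT (D.overlap_snd h)
    rfl hyc hyd
  have hcomp : (u ≫ D.fst c) ≫ x.proj (D.α c) ≫ θ.base = (v ≫ D.snd d) ≫ y.proj (D.β d) :=
    (D.condition' c u).trans (D.overlap_snd h)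
  have e5 := θ.tr_k hφc hφd (congrArg ψ.idx hyd) (u ≫ D.fst c) (v ≫ D.fst d) (v ≫ D.snd d) hT
    (D.overlap_fst h) (D.condition' d v)
  have e6 := θ.k_tr hφc (congrArg ψ.idx hyc) (congrArg ψ.idx hyd) (u ≫ D.fst c) (u ≫ D.snd c)
    (v ≫ D.snd d) hT (D.condition' c u) (D.overlap_snd h)
  refine Eq.trans ?_ ((e5.trans e6.symm).trans ?_)
  · exact congrArg₂ (· * ·) e3.symm e2
  · exact congrArg₂ (· * ·) e1.symm e4

/-- The transition elements of `𝔚`. -/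
def tr {i : 𝔚.ι} {c d : D.C} (hc : D.idx c = i) (hd : D.idx d = i) {T : SchC}
    (u : T ⟶ D.cov c) (v : T ⟶ D.cov d) (hT : Nonempty T.left)
    (h : u ≫ D.fst c ≫ x.proj (D.α c) = v ≫ D.fst d ≫ x.proj (D.α d)) : (𝔚.G i).obj (op T) :=
  (D.exists_tr hc hd u v hT h).choose

lemma onG_tr_fst {i : 𝔚.ι} {c d : D.C} (hc : D.idx c = i) (hd : D.idx d = i) {T : SchC}
    (u : T ⟶ D.cov c) (v : T ⟶ D.cov d) (hT : Nonempty T.left)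
    (h : u ≫ D.fst c ≫ x.proj (D.α c) = v ≫ D.fst d ≫ x.proj (D.α d)) :
    p.onG i (D.tr hc hd u v hT h) = x.tr ((D.idx_fst c).trans (congrArg p.idx hc))
        ((D.idx_fst d).trans (congrArg p.idx hd)) (u ≫ D.fst c) (v ≫ D.fst d) hT
        (D.overlap_fst h) :=
  (D.exists_tr hc hd u v hT h).choose_spec.1

lemma onG_tr_snd {i : 𝔚.ι} {c d : D.C} (hc : D.idx c = i) (hd : D.idx d = i) {T : SchC}
    (u : T ⟶ D.cov c) (v : T ⟶ D.cov d) (hT : Nonempty T.left)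
    (h : u ≫ D.fst c ≫ x.proj (D.α c) = v ≫ D.fst d ≫ x.proj (D.α d)) :
    q.onG i (D.tr hc hd u v hT h) = D.liftRes c (congrArg q.idx hc) u *
        y.tr ((D.idx_snd c).trans (congrArg q.idx hc)) ((D.idx_snd d).trans (congrArg q.idx hd))
          (u ≫ D.snd c) (v ≫ D.snd d) hT (D.overlap_snd h) *
        (D.liftRes d (congrArg q.idx hd) v)⁻¹ :=
  (D.exists_tr hc hd u v hT h).choose_spec.2

/-- The object of `𝔚` glued from `x` and `y` along `θ`. -/
def glue : Obj 𝔚 where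
  base := x.base
  A := D.C
  cov := D.cov
  proj c := D.fst c ≫ x.proj (D.α c)
  etale := D.etale
  surj := D.surj
  idx := D.idx
  sec := D.sec
  idx_eq {c d T} u v hT h := H.idx_inj _ _
    (by rw [← D.idx_fst, ← D.idx_fst]; exact x.idx_eq _ _ hT (D.overlap_fst h))
    (by rw [← D.idx_snd, ← D.idx_snd]; exact y.idx_eq _ _ hT (D.overlap_snd h))
  tr hc hd _ u v hT h := D.tr hc hd u v hT h
  tr_map {i c d} hc hd S T f u v hS hT h := by
    apply H.onG_inj
    · rw [← p.onG_map, onG_tr_fst, onG_tr_fst, x.tr_map _ _ _ _ _ hS]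
      simp only [Category.assoc]
    · rw [← q.onG_map, onG_tr_snd, onG_tr_snd, map_mul, map_mul, map_inv, y.tr_map _ _ _ _ _ hS,
        liftRes_map, liftRes_map]
      simp only [Category.assoc]
  act_tr {i c d} hc hd T u v hT h := by
    apply H.onX_inj
    · rw [p.onX_act, onG_tr_fst, onX_res_sec_fst, onX_res_sec_fst, x.act_tr]
    -- The inverse lift built into the section over `c` cancels the lift at the left end of the
    -- transition element; the inverse lift at the right end is the one in the section over `d`.
    · rw [q.onX_act, onG_tr_snd, onX_res_sec_snd, onX_res_sec_snd, ← 𝔜.act_mul, ← mul_assoc,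
        ← mul_assoc, inv_mul_cancel, one_mul, 𝔜.act_mul, y.act_tr]
  tr_mul {i c d e} hc hd he T u v w hT h h' := by
    apply H.onG_inj
    · rw [p.onG_mul, onG_tr_fst, onG_tr_fst, onG_tr_fst, x.tr_mul]
    · rw [q.onG_mul, onG_tr_snd, onG_tr_snd, onG_tr_snd,
        ← y.tr_mul _ ((D.idx_snd d).trans (congrArg q.idx hd)) _ (u ≫ D.snd c) (v ≫ D.snd d)
          (w ≫ D.snd e) hT (D.overlap_snd h) (D.overlap_snd h')]
      simp only [mul_assoc, inv_mul_cancel_left]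

lemma fst_condition {c : D.C} {b : x.A} {T : SchC} {u : T ⟶ D.cov c} {v : T ⟶ x.cov b}
    (h : u ≫ (D.fst c ≫ x.proj (D.α c)) ≫ 𝟙 _ = v ≫ x.proj b) :
    (u ≫ D.fst c) ≫ x.proj (D.α c) = v ≫ x.proj b := by
  simpa using h

lemma snd_condition {c : D.C} {b : y.A} {T : SchC} {u : T ⟶ D.cov c} {v : T ⟶ y.cov b}
    (h : u ≫ (D.fst c ≫ x.proj (D.α c)) ≫ θ.base = v ≫ y.proj b) :
    (u ≫ D.snd c) ≫ y.proj (D.β c) = v ≫ y.proj b := by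
  rw [← h, ← D.condition']
  have aux : ∀ f : x.base ⟶ y.base, (u ≫ D.fst c) ≫ x.proj (D.α c) ≫ f =
      u ≫ (D.fst c ≫ x.proj (D.α c)) ≫ f := fun f => by simp
  exact aux _

/-- The comparison of the image of the glued object with `x`. -/
def toFst : Hom (p.mapObj D.glue) x where
  base := 𝟙 _
  idx_eq {c _ _} u v hT h := (D.idx_fst c).symm.trans
    (x.idx_eq (u ≫ D.fst c) v hT (D.fst_condition h))
  k {i c b} ha hb T u v hT h := x.tr ((D.idx_fst c).trans ha) hb (u ≫ D.fst c) v hT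
    (D.fst_condition h)
  k_map {i} {c : D.C} {b : x.A} (ha : p.idx (D.idx c) = i) hb S T f (u : T ⟶ D.cov c) v hS hT h := by
    exact (x.tr_map _ _ f _ _ hS hT (D.fst_condition h)).trans
      (x.tr_congr _ _ (Category.assoc _ _ _).symm rfl hS _ _)
  act_k {i} {c : D.C} {b : x.A} (ha : p.idx (D.idx c) = i) hb T (u : T ⟶ D.cov c) v hT h := by
    subst ha
    refine Eq.trans ?_ (x.act_tr (D.idx_fst c) hb (u ≫ D.fst c) v hT (D.fst_condition h))
    exact congrArg (𝔛.act _ · _)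
      ((p.onX_res rfl u (D.sec c)).symm.trans (D.onX_res_sec_fst c rfl u))
  tr_k {i} {c c' : D.C} {b : x.A} (ha : p.idx (D.idx c) = i)
      (ha' : p.idx (D.idx c') = i) hb T (u : T ⟶ D.cov c) (u' : T ⟶ D.cov c') v hT h h' := by
    subst ha
    have hc' : D.idx c' = D.idx c := (D.glue.idx_eq u u' hT h).symm
    refine Eq.trans ?_ (x.tr_mul (D.idx_fst c) ((D.idx_fst c').trans ha') hb (u ≫ D.fst c)
      (u' ≫ D.fst c') v hT (D.overlap_fst h) (D.fst_condition h'))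
    exact congrArg (· * _) (D.onG_tr_fst rfl hc' u u' hT h)
  k_tr {i c b b'} ha hb hb' T u v v' hT h h' := x.tr_mul _ _ _ _ _ _ hT (D.fst_condition h) h'

/-- The comparison of the image of the glued object with `y`. -/
def toSnd : Hom (q.mapObj D.glue) y where
  base := θ.base
  idx_eq {c b T} u v hT h := (D.idx_snd c).symm.trans
    (y.idx_eq (u ≫ D.snd c) v hT (D.snd_condition h))
  k {i c b} ha hb T u v hT h := D.liftRes c ha u *
    y.tr ((D.idx_snd c).trans ha) hb (u ≫ D.snd c) v hT (D.snd_condition h)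
  k_map {i} {c : D.C} {b : y.A} (ha : q.idx (D.idx c) = i) hb S T f (u : T ⟶ D.cov c) v hS hT h := by
    rw [map_mul]
    exact congrArg₂ (· * ·) (D.liftRes_map c ha f u)
      ((y.tr_map _ _ f _ _ hS hT (D.snd_condition h)).trans
        (y.tr_congr _ _ (Category.assoc _ _ _).symm rfl hS _ _))
  act_k {i} {c : D.C} {b : y.A} (ha : q.idx (D.idx c) = i) hb T (u : T ⟶ D.cov c) v hT h := by
    subst ha
    refine Eq.trans ?_ (y.act_tr (D.idx_snd c) hb (u ≫ D.snd c) v hT (D.snd_condition h))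
    rw [𝔜.act_mul]
    refine congrArg (𝔜.act _ · _) ((congrArg (𝔜.act _ · _)
      ((q.onX_res rfl u (D.sec c)).symm.trans (D.onX_res_sec_snd c rfl u))).trans ?_)
    rw [← 𝔜.act_mul, inv_mul_cancel, 𝔜.act_one]
  tr_k {i} {c c' : D.C} {b : y.A} (ha : q.idx (D.idx c) = i)
      (ha' : q.idx (D.idx c') = i) hb T (u : T ⟶ D.cov c) (u' : T ⟶ D.cov c') v hT h h' := by
    subst ha
    have hc' : D.idx c' = D.idx c := (D.glue.idx_eq u u' hT h).symm
    have e := y.tr_mul (D.idx_snd c) ((D.idx_snd c').trans ha') hb (u ≫ D.snd c)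
      (u' ≫ D.snd c') v hT (D.overlap_snd h) (D.snd_condition h')
    refine (congrArg (· * _) (D.onG_tr_snd rfl hc' u u' hT h)).trans
      (Eq.trans ?_ (congrArg (_ * ·) e))
    simp only [mul_assoc, inv_mul_cancel_left]
    rfl
  k_tr {i} {c : D.C} {b b' : y.A} (ha : q.idx (D.idx c) = i) hb hb' T (u : T ⟶ D.cov c) v v' hT h h' := by
    exact (mul_assoc _ _ _).trans (congrArg (_ * ·)
      (y.tr_mul _ _ _ _ _ _ hT (D.snd_condition h) h'))

/-- Both sides reduce to the element of `θ` from the chart of `x` to the chart `b` of `y`: on the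
right, the lift maps to the element of `θ` into the chart `D.β c`, and the transition element of `y`
continues from there to `b`. -/
lemma glue_comm : compHom (φ.mapHom D.toFst) θ = compHom (H.sqHom D.glue) (ψ.mapHom D.toSnd) := by
  refine Hom.ext' _ _ rfl fun {i c b} ha hb T u v hT h h' => ?_
  have hφ : φ.idx (x.idx (D.α c)) = i := (congrArg φ.idx (D.idx_fst c)).trans ha
  have hψ : ψ.idx (q.idx (D.idx c)) = i := (H.idx_comm _).symm.trans ha
  have hψ' : ψ.idx (y.idx (D.β c)) = i := (congrArg ψ.idx (D.idx_snd c)).trans hψ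
  have aux : ∀ f : x.base ⟶ y.base, u ≫ (D.fst c ≫ x.proj (D.α c)) ≫ 𝟙 _ ≫ f = v ≫ y.proj b →
      u ≫ (D.fst c ≫ x.proj (D.α c)) ≫ f = v ≫ y.proj b := fun f hf => by simpa using hf
  have e : u ≫ (D.fst c ≫ x.proj (D.α c)) ≫ θ.base = v ≫ y.proj b := aux _ h
  have e1 : u ≫ (D.fst c ≫ x.proj (D.α c)) ≫ 𝟙 _ = (u ≫ D.fst c) ≫ x.proj (D.α c) :=
    (congrArg (u ≫ ·) (Category.comp_id _)).trans (Category.assoc _ _ _).symm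
  have e2 : (u ≫ D.fst c) ≫ x.proj (D.α c) ≫ θ.base = v ≫ y.proj b :=
    (D.condition' c u).trans (D.snd_condition e)
  refine (compHom_k (φ.mapHom D.toFst) θ ha hφ hb u (u ≫ D.fst c) v hT e1 e2 h).trans
    (Eq.trans ?_ (H.sqHom_comp_k (ψ.mapHom D.toSnd) ha hψ hb u v hT h' e).symm)
  subst hψ
  -- With `u ≫ D.fst c` as intermediate chart, `toFst` contributes a transition element of a chart
  -- with itself, which is `1`.
  have e3 : (φ.mapHom D.toFst).k ha hφ u (u ≫ D.fst c) hT e1 = 1 := by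
    refine (congrArg (φ.onG' ha) (x.tr_self (D.idx_fst c) (D.idx_fst c) (u ≫ D.fst c) hT rfl)).trans
      ?_
    have aux1 : ∀ {j : 𝔛.ι} {m : ℨ.ι} (h : φ.idx j = m),
        φ.onG' h (1 : (𝔛.G j).obj (op T)) = 1 := by
      intro j m h; subst h; exact φ.onG_one _ _
    exact aux1 _
  rw [e3, one_mul]
  have hbq : ψ.idx (y.idx b) = ψ.idx (q.idx (D.idx c)) := hb
  have hby : y.idx b = q.idx (D.idx c) :=
    (y.idx_eq _ _ hT (D.snd_condition e)).symm.trans (D.idx_snd c)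
  refine Eq.trans ?_ (ψ.onG_mul _ (D.liftRes c rfl u)
    (y.tr (D.idx_snd c) hby (u ≫ D.snd c) v hT (D.snd_condition e))).symm
  have f1 := D.onG'_liftRes c rfl rfl hφ hψ' u hT
  have f2 := ψ.mapTr_eq y hψ' (u ≫ D.snd c) v hT (D.snd_condition e) rfl (D.idx_snd c) hby
  have f3 := θ.k_tr hφ hψ' hb (u ≫ D.fst c) (u ≫ D.snd c) v hT (D.condition' c u)
    (D.snd_condition e)
  exact f3.symm.trans (congrArg₂ (· * ·) f1.symm f2)

end Refinement

lemma essSurj : H.toPullback.EssSurj where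
  mem_essImage z := by
    obtain ⟨x, y, θ⟩ := z
    let x' : Obj 𝔛 := x
    let y' : Obj 𝔜 := y
    let f : Hom (φ.mapObj x') (ψ.mapObj y') := θ.hom
    let g : Hom (ψ.mapObj y') (φ.mapObj x') := θ.inv
    obtain ⟨D⟩ := H.exists_refinement f
    have h1 : IsIso (C := Obj 𝔛) D.toFst :=
      isIso_of_isIso_base (𝔛 := 𝔛) D.toFst (𝟙 _) (Category.comp_id _) (Category.comp_id _)
    have h2 : IsIso (C := Obj 𝔜) D.toSnd :=
      -- `toSnd` lies over `θ.base` and not over an identity; the base of the inverse of `θ` inverts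
      -- it.
      isIso_of_isIso_base (𝔛 := 𝔜) D.toSnd g.base (congrArg Hom.base θ.hom_inv_id)
        (congrArg Hom.base θ.inv_hom_id)
    exact ⟨D.glue, ⟨CategoricalPullback.mkIso (@asIso (Obj 𝔛) _ _ _ D.toFst h1)
      (@asIso (Obj 𝔜) _ _ _ D.toSnd h2) D.glue_comm⟩⟩

include H in
lemma isCartesian : IsCartesian p.mor q.mor φ.mor ψ.mor :=
  ⟨H.iso, { faithful := H.faithful, full := H.full, essSurj := H.essSurj }⟩

end IsStrictPullback

end QStack

/-! ### Products of equivariant maps and finiteness on indices. -/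

namespace QStack.EqMap

variable {𝔛 𝔜 ℨ 𝔚 : QStack}

/-- The product of two morphisms. -/
def prodMap {𝔛 𝔜 𝔛' 𝔜' : QStack} (φ : EqMap 𝔛 𝔛') (ψ : EqMap 𝔜 𝔜') :
    EqMap (𝔛.prod 𝔜) (𝔛'.prod 𝔜') :=
  lift ((fst 𝔛 𝔜).comp φ) ((snd 𝔛 𝔜).comp ψ)

/-- The inverse of the associativity isomorphism. -/
def assocInv (𝔛 𝔜 ℨ : QStack) : EqMap (𝔛.prod (𝔜.prod ℨ)) ((𝔛.prod 𝔜).prod ℨ) :=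
  lift (lift (fst _ _) ((snd _ _).comp (fst _ _))) ((snd _ _).comp (snd _ _))

/-- Only finitely many components are mapped to a given component. -/
def IdxFinite (φ : EqMap 𝔛 𝔜) : Prop := ∀ j, {i | φ.idx i = j}.Finite

/-- The condition on indices implies finite type and is visibly stable under composition and
products, so finite type of all push-forwards below is obtained without looking at objects of the
stacks. -/
lemma IdxFinite.finiteType {φ : EqMap 𝔛 𝔜} (h : φ.IdxFinite) : FiniteType φ.mor :=
  EqMap.finiteType φ h

lemma idxFinite_of_injective {φ : EqMap 𝔛 𝔜} (h : Function.Injective φ.idx) : φ.IdxFinite :=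
  fun j => (Set.finite_singleton j).preimage h.injOn

lemma idxFinite_id : (EqMap.id 𝔛).IdxFinite := idxFinite_of_injective Function.injective_id

lemma IdxFinite.comp {φ : EqMap 𝔛 𝔜} {ψ : EqMap 𝔜 ℨ} (hφ : φ.IdxFinite) (hψ : ψ.IdxFinite) :
    (φ.comp ψ).IdxFinite := fun j =>
  ((hψ j).biUnion fun i _ => hφ i).subset fun _ hl => Set.mem_biUnion (x := φ.idx _) hl rfl

lemma IdxFinite.prodMap {𝔛 𝔜 𝔛' 𝔜' : QStack} {φ : EqMap 𝔛 𝔛'} {ψ : EqMap 𝔜 𝔜'}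
    (hφ : φ.IdxFinite) (hψ : ψ.IdxFinite) : (prodMap φ ψ).IdxFinite := fun j =>
  ((hφ j.1).prod (hψ j.2)).subset fun _ hl => ⟨congrArg Prod.fst hl, congrArg Prod.snd hl⟩

end QStack.EqMap

open QStack

/-! ### Calculus of pull-back, push-forward and exterior product; the ring of scalars. -/

namespace StackyMotivicTheory

variable (R : StackyMotivicTheory.{u}) {𝔛 𝔜 ℨ 𝔚 : QStack}

lemma pull_id_mor (a : R.obj 𝔛) : R.pull (EqMap.id 𝔛).mor a = a := by
  rw [EqMap.id_mor]; exact R.pull_id 𝔛 a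

lemma pull_pull (φ : EqMap 𝔛 𝔜) (ψ : EqMap 𝔜 ℨ) (a : R.obj ℨ) :
    R.pull φ.mor (R.pull ψ.mor a) = R.pull (φ.comp ψ).mor a := by
  rw [EqMap.comp_mor]; exact (R.pull_comp _ _ a).symm

lemma push_congr {φ ψ : EqMap 𝔛 𝔜} (h : φ = ψ) (hφ : FiniteType φ.mor) (hψ : FiniteType ψ.mor)
    (a : R.obj 𝔛) : R.push φ.mor hφ a = R.push ψ.mor hψ a := by
  subst h; rfl

lemma push_id_mor (h : FiniteType (EqMap.id 𝔛).mor) (a : R.obj 𝔛) :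
    R.push (EqMap.id 𝔛).mor h a = a := by
  have h' : FiniteType (BasedFunctor.id 𝔛.toStack) := by rw [← EqMap.id_mor]; exact h
  rw [R.push_iso h h' ⟨eqToIso EqMap.id_mor⟩, R.push_id]

lemma push_push (φ : EqMap 𝔛 𝔜) (ψ : EqMap 𝔜 ℨ) (hφ : FiniteType φ.mor) (hψ : FiniteType ψ.mor)
    (h : FiniteType (φ.comp ψ).mor) (a : R.obj 𝔛) :
    R.push ψ.mor hψ (R.push φ.mor hφ a) = R.push (φ.comp ψ).mor h a := by
  have h' : FiniteType (φ.mor.comp ψ.mor) := by rw [← EqMap.comp_mor]; exact h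
  rw [← R.push_comp φ.mor ψ.mor hφ hψ h', R.push_iso h h' ⟨eqToIso (EqMap.comp_mor φ ψ)⟩]

lemma prodMap_fst {𝔛 𝔜 𝔛' 𝔜' : QStack} (φ : EqMap 𝔛 𝔛') (ψ : EqMap 𝔜 𝔜') :
    (EqMap.prodMap φ ψ).mor.comp (EqMap.fst 𝔛' 𝔜').mor = (EqMap.fst 𝔛 𝔜).mor.comp φ.mor := by
  rw [← EqMap.comp_mor, ← EqMap.comp_mor]; rfl

lemma prodMap_snd {𝔛 𝔜 𝔛' 𝔜' : QStack} (φ : EqMap 𝔛 𝔛') (ψ : EqMap 𝔜 𝔜') :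
    (EqMap.prodMap φ ψ).mor.comp (EqMap.snd 𝔛' 𝔜').mor = (EqMap.snd 𝔛 𝔜).mor.comp ψ.mor := by
  rw [← EqMap.comp_mor, ← EqMap.comp_mor]; rfl

lemma pull_prodMap {𝔛 𝔜 𝔛' 𝔜' : QStack} (φ : EqMap 𝔛 𝔛') (ψ : EqMap 𝔜 𝔜') (a : R.obj 𝔛')
    (b : R.obj 𝔜') : R.boxtimes (R.pull φ.mor a) (R.pull ψ.mor b) =
      R.pull (EqMap.prodMap φ ψ).mor (R.boxtimes a b) :=
  (R.pull_boxtimes φ.mor ψ.mor _ ⟨eqToIso (prodMap_fst φ ψ)⟩ ⟨eqToIso (prodMap_snd φ ψ)⟩ a b).symm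

lemma pull_prodMap_left {𝔛' : QStack} (φ : EqMap 𝔛 𝔛') (a : R.obj 𝔛') (b : R.obj 𝔜) :
    R.boxtimes (R.pull φ.mor a) b = R.pull (EqMap.prodMap φ (.id 𝔜)).mor (R.boxtimes a b) := by
  rw [← pull_prodMap, pull_id_mor]

lemma pull_prodMap_right {𝔜' : QStack} (ψ : EqMap 𝔜 𝔜') (a : R.obj 𝔛) (b : R.obj 𝔜') :
    R.boxtimes a (R.pull ψ.mor b) = R.pull (EqMap.prodMap (.id 𝔛) ψ).mor (R.boxtimes a b) := by
  rw [← pull_prodMap, pull_id_mor]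

/-- Moves a push-forward out of one factor of an exterior product, so that base change can be
applied to it; the other factor is pushed forward along the identity. -/
lemma push_prodMap_left {𝔛' : QStack} (φ : EqMap 𝔛 𝔛') (hφ : φ.IdxFinite) (a : R.obj 𝔛)
    (b : R.obj 𝔜) : R.boxtimes (R.push φ.mor hφ.finiteType a) b =
      R.push (EqMap.prodMap φ (.id 𝔜)).mor (hφ.prodMap EqMap.idxFinite_id).finiteType
        (R.boxtimes a b) := by
  rw [R.push_boxtimes φ.mor (EqMap.id 𝔜).mor _ hφ.finiteType EqMap.idxFinite_id.finiteType _
    ⟨eqToIso (prodMap_fst φ _)⟩ ⟨eqToIso (prodMap_snd φ _)⟩, push_id_mor]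

lemma push_prodMap_right {𝔜' : QStack} (ψ : EqMap 𝔜 𝔜') (hψ : ψ.IdxFinite) (a : R.obj 𝔛)
    (b : R.obj 𝔜) : R.boxtimes a (R.push ψ.mor hψ.finiteType b) =
      R.push (EqMap.prodMap (.id 𝔛) ψ).mor (EqMap.idxFinite_id.prodMap hψ).finiteType
        (R.boxtimes a b) := by
  rw [R.push_boxtimes (EqMap.id 𝔛).mor ψ.mor _ EqMap.idxFinite_id.finiteType hψ.finiteType _
    ⟨eqToIso (prodMap_fst _ ψ)⟩ ⟨eqToIso (prodMap_snd _ ψ)⟩, push_id_mor]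

/-- Base change in the form used below: the hypothesis concerns only points of presentations, and
`IsStrictPullback.isCartesian` supplies the 2-cartesian square. -/
lemma pull_push {p : EqMap 𝔚 𝔛} {q : EqMap 𝔚 𝔜} {φ : EqMap 𝔛 ℨ} {ψ : EqMap 𝔜 ℨ}
    (H : IsStrictPullback p q φ ψ) (hφ : FiniteType φ.mor) (hq : FiniteType q.mor) (a : R.obj 𝔛) :
    R.pull ψ.mor (R.push φ.mor hφ a) = R.push q.mor hq (R.pull p.mor a) :=
  R.base_change _ _ _ _ H.isCartesian hφ hq a

lemma boxtimes_assocInv (a : R.obj 𝔛) (b : R.obj 𝔜) (c : R.obj ℨ) :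
    R.boxtimes a (R.boxtimes b c) =
      R.pull (EqMap.assocInv 𝔛 𝔜 ℨ).mor (R.boxtimes (R.boxtimes a b) c) := by
  rw [← R.boxtimes_assoc, pull_pull]
  -- The composite of `assocInv` and `assoc` is the identity by definitional eta for pairs.
  exact (R.pull_id_mor _).symm

lemma boxtimes_one (a : R.obj 𝔛) : R.boxtimes a R.one = R.pull (EqMap.fst 𝔛 pt).mor a := by
  rw [← R.boxtimes_symm, R.one_boxtimes, pull_pull]
  rfl

lemma one_smul' (a : R.obj 𝔛) : R.smul R.one a = a := by
  rw [smul, R.one_boxtimes, pull_pull]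
  exact R.pull_id_mor a

/-- Both sides are pull-backs of `r ⊠ (s ⊠ a)` along the same map `𝔛 → pt × (pt × 𝔛)`. Over the
point, this is associativity of the multiplication. -/
lemma mulPt_smul (r s : R.obj pt) (a : R.obj 𝔛) :
    R.smul (R.mulPt r s) a = R.smul r (R.smul s a) := by
  rw [smul, smul, smul, mulPt, pull_prodMap_left, pull_prodMap_right, ← R.boxtimes_assoc,
    pull_pull, pull_pull, pull_pull]
  rfl

lemma add_smul' (r s : R.obj pt) (a : R.obj 𝔛) :
    R.smul (r + s) a = R.smul r a + R.smul s a := by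
  simp only [smul, map_add, AddMonoidHom.add_apply]

lemma smul_add' (r : R.obj pt) (a b : R.obj 𝔛) :
    R.smul r (a + b) = R.smul r a + R.smul r b := by
  simp only [smul, map_add]

/-- The diagonal of the point is invariant under the transposition. -/
lemma mulPt_comm (r s : R.obj pt) : R.mulPt r s = R.mulPt s r := by
  rw [mulPt, mulPt, ← R.boxtimes_symm, pull_pull]
  rfl

end StackyMotivicTheory

/-! ### Block matrices and three-step filtrations. -/

section Quiver

/-- The block diagonal matrix. -/
def blockDiag {m n m' n' : ℕ} {R : Type} [CommRing R] (A : Matrix (Fin m) (Fin m') R)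
    (D : Matrix (Fin n) (Fin n') R) : Matrix (Fin (m + n)) (Fin (m' + n')) R :=
  (Matrix.fromBlocks A 0 0 D).submatrix finSumFinEquiv.symm finSumFinEquiv.symm

section

variable {m n m' n' m'' n'' : ℕ} {R : Type} [CommRing R]

lemma isBlockUpper_blockDiag (A : Matrix (Fin m) (Fin m') R) (D : Matrix (Fin n) (Fin n') R) :
    IsBlockUpper (blockDiag A D) := by
  intro a b; simp [blockDiag]

lemma subBlock_blockDiag (A : Matrix (Fin m) (Fin m') R) (D : Matrix (Fin n) (Fin n') R) :
    subBlock (blockDiag A D) = A := by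
  ext a b; simp [subBlock, blockDiag]

lemma quotBlock_blockDiag (A : Matrix (Fin m) (Fin m') R) (D : Matrix (Fin n) (Fin n') R) :
    quotBlock (blockDiag A D) = D := by
  ext a b; simp [quotBlock, blockDiag]

lemma blockDiag_mul (A : Matrix (Fin m) (Fin m') R) (D : Matrix (Fin n) (Fin n') R)
    (A' : Matrix (Fin m') (Fin m'') R) (D' : Matrix (Fin n') (Fin n'') R) :
    blockDiag A D * blockDiag A' D' = blockDiag (A * A') (D * D') := by
  simp [blockDiag, Matrix.submatrix_mul_equiv, Matrix.fromBlocks_multiply]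

lemma blockDiag_one : blockDiag (1 : Matrix (Fin m) (Fin m) R) (1 : Matrix (Fin n) (Fin n) R) = 1 := by
  simp [blockDiag, Matrix.fromBlocks_one]

end

/-- Change of the bracketing of the index sets of a matrix. -/
def assocBlock {m n k m' n' k' : ℕ} {R : Type}
    (M : Matrix (Fin (m + n + k)) (Fin (m' + n' + k')) R) :
    Matrix (Fin (m + (n + k))) (Fin (m' + (n' + k'))) R :=
  M.submatrix (Fin.cast (add_assoc m n k).symm) (Fin.cast (add_assoc m' n' k').symm)

section

variable {m n k m' n' k' m'' n'' k'' : ℕ} {R : Type}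

/-- Rebracketing does not change the numerical value of an index, so the three diagonal blocks are
the same for both bracketings. This lemma and the next two record the three cases. -/
lemma subBlock_assocBlock (M : Matrix (Fin (m + n + k)) (Fin (m' + n' + k')) R) :
    subBlock (assocBlock M) = subBlock (subBlock M) := by
  ext a b
  exact congrArg₂ M (Fin.ext rfl) (Fin.ext rfl)

lemma subBlock_quotBlock_assocBlock (M : Matrix (Fin (m + n + k)) (Fin (m' + n' + k')) R) :
    subBlock (quotBlock (assocBlock M)) = quotBlock (subBlock M) := by
  ext a b
  exact congrArg₂ M (Fin.ext rfl) (Fin.ext rfl)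

lemma quotBlock_quotBlock_assocBlock (M : Matrix (Fin (m + n + k)) (Fin (m' + n' + k')) R) :
    quotBlock (quotBlock (assocBlock M)) = quotBlock M := by
  ext a b
  exact congrArg₂ M (Fin.ext (add_assoc _ _ _).symm) (Fin.ext (add_assoc _ _ _).symm)

variable [CommRing R]

/-- The matrix preserves the flag `R^m ⊆ R^(m+n) ⊆ R^(m+n+k)`. -/
def IsBiflag (M : Matrix (Fin (m + n + k)) (Fin (m' + n' + k')) R) : Prop :=
  IsBlockUpper M ∧ IsBlockUpper (subBlock M)

/-- Preserving a flag with three steps can be tested on the larger step and inside it, or on the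
smaller step and in the quotient by it. In both cases the condition is that the three blocks below
the diagonal vanish. -/
lemma isBiflag_iff_assocBlock (M : Matrix (Fin (m + n + k)) (Fin (m' + n' + k')) R) :
    IsBiflag M ↔ IsBlockUpper (assocBlock M) ∧ IsBlockUpper (quotBlock (assocBlock M)) := by
  -- `e1`, `e2` and `e3` identify the blocks in positions (3,2), (2,1) and (3,1) for the two
  -- bracketings.
  have e1 : ∀ a b, quotBlock (assocBlock M) (Fin.natAdd n a) (Fin.castAdd k' b) =
      M (Fin.natAdd (m + n) a) (Fin.castAdd k' (Fin.natAdd m' b)) := fun a b =>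
    congrArg₂ M (Fin.ext (add_assoc _ _ _).symm) (Fin.ext rfl)
  have e2 : ∀ a b, assocBlock M (Fin.natAdd m (Fin.castAdd k a)) (Fin.castAdd (n' + k') b) =
      subBlock M (Fin.natAdd m a) (Fin.castAdd n' b) := fun a b =>
    congrArg₂ M (Fin.ext rfl) (Fin.ext rfl)
  have e3 : ∀ a b, assocBlock M (Fin.natAdd m (Fin.natAdd n a)) (Fin.castAdd (n' + k') b) =
      M (Fin.natAdd (m + n) a) (Fin.castAdd k' (Fin.castAdd n' b)) := fun a b =>
    congrArg₂ M (Fin.ext (add_assoc _ _ _).symm) (Fin.ext rfl)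
  constructor
  · rintro ⟨h1, h2⟩
    refine ⟨fun a b => ?_, fun a b => (e1 a b).trans (h1 _ _)⟩
    refine Fin.addCases (fun a => ?_) (fun a => ?_) a
    · exact (e2 a b).trans (h2 a b)
    · exact (e3 a b).trans (h1 _ _)
  · rintro ⟨h1, h2⟩
    refine ⟨fun a b => ?_, fun a b => (e2 a b).symm.trans (h1 _ _)⟩
    refine Fin.addCases (fun b => ?_) (fun b => ?_) b
    · exact (e3 a b).symm.trans (h1 _ _)
    · exact (e1 a b).symm.trans (h2 a b)

lemma IsBiflag.mul {M : Matrix (Fin (m + n + k)) (Fin (m' + n' + k')) R}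
    {N : Matrix (Fin (m' + n' + k')) (Fin (m'' + n'' + k'')) R} (hM : IsBiflag M)
    (hN : IsBiflag N) : IsBiflag (M * N) :=
  ⟨hM.1.mul hN.1, by rw [subBlock_mul M hN.1]; exact hM.2.mul hN.2⟩

lemma IsBiflag.one : IsBiflag (1 : Matrix (Fin (m + n + k)) (Fin (m + n + k)) R) :=
  ⟨IsBlockUpper.one, by rw [subBlock_one]; exact IsBlockUpper.one⟩

lemma IsBiflag.map {S : Type} [CommRing S] (f : R →+* S)
    {M : Matrix (Fin (m + n + k)) (Fin (m' + n' + k')) R} (hM : IsBiflag M) :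
    IsBiflag (M.map f) :=
  ⟨hM.1.map f, hM.2.map f⟩

end

/-- The subgroup of all elements preserving the standard flag with three steps. -/
def biflagSubgroup {Q : Type} (d d' d'' : Q → ℕ) (R : Type) [CommRing R] :
    Subgroup (GaugeGroup (d + d' + d'') R) where
  carrier := {g | ∀ i, IsBiflag (m := d i) (n := d' i) (k := d'' i) (m' := d i) (n' := d' i)
      (k' := d'' i) (g i).val ∧
    IsBiflag (m := d i) (n := d' i) (k := d'' i) (m' := d i) (n' := d' i) (k' := d'' i)
      (g i)⁻¹.val}
  one_mem' i := ⟨IsBiflag.one, by simpa using IsBiflag.one⟩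
  mul_mem' {g h} hg hh i := ⟨(hg i).1.mul (hh i).1, by
    have : ((g * h) i)⁻¹.val = (h i)⁻¹.val * (g i)⁻¹.val := by simp
    rw [this]
    exact (hh i).2.mul (hg i).2⟩
  inv_mem' {g} hg i := ⟨(hg i).2, by simpa using (hg i).1⟩

/-- The space of representations preserving the standard flag with three steps. -/
def BiflagRepSpace (Q : Type) [Quiver.{0} Q] (d d' d'' : Q → ℕ) (R : Type) [CommRing R] : Type :=
  {M : RepSpace Q (d + d' + d'') R // ∀ i j (α : i ⟶ j),
    IsBiflag (m := d j) (n := d' j) (k := d'' j) (m' := d i) (n' := d' i) (k' := d'' i) (M i j α)}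

variable {Q : Type} [Quiver.{0} Q]

lemma conj_biflag {d d' d'' : Q → ℕ} {R : Type} [CommRing R] (M : BiflagRepSpace Q d d' d'' R)
    (g : biflagSubgroup d d' d'' R) (i j : Q) (α : i ⟶ j) :
    IsBiflag (m := d j) (n := d' j) (k := d'' j) (m' := d i) (n' := d' i) (k' := d'' i)
      (conj M.1 g.1 i j α) :=
  ((g.2 j).2.mul (M.2 i j α)).mul (g.2 i).1

variable [Finite Q] [∀ i j : Q, Finite (i ⟶ j)]

/-- The entries which vanish in matrices preserving the standard flag with three steps. -/
def biflagZero (m n k m' n' k' : ℕ) (a : Fin (m + n + k)) (b : Fin (m' + n' + k')) : Prop :=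
  ((∃ a', a = Fin.natAdd _ a') ∧ ∃ b', b = Fin.castAdd _ b') ∨
    ((∃ a', a = Fin.castAdd _ (Fin.natAdd m a')) ∧ ∃ b', b = Fin.castAdd _ (Fin.castAdd n' b'))

/-- Restates the condition as the vanishing of prescribed entries, the form in which
`isAffineFiniteType_matrices` and `isAffineFiniteType_gl` give representability. -/
lemma isBiflag_iff {m n k m' n' k' : ℕ} {R : Type} [CommRing R]
    (M : Matrix (Fin (m + n + k)) (Fin (m' + n' + k')) R) :
    IsBiflag M ↔ ∀ a b, biflagZero m n k m' n' k' a b → M a b = 0 := by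
  constructor
  · rintro ⟨h1, h2⟩ _ _ (⟨⟨a, rfl⟩, b, rfl⟩ | ⟨⟨a, rfl⟩, b, rfl⟩)
    · exact h1 a b
    · exact h2 a b
  · intro h
    exact ⟨fun a b => h _ _ (Or.inl ⟨⟨a, rfl⟩, b, rfl⟩),
      fun a b => h _ _ (Or.inr ⟨⟨a, rfl⟩, b, rfl⟩)⟩

variable (Q)

/-- The stack of representations with a filtration with three steps, with given dimension vectors
of the subquotients. -/
def filtStack : QStack where
  ι := (Q → ℕ) × (Q → ℕ) × (Q → ℕ)
  X d :=
    { obj := fun T => BiflagRepSpace Q d.1 d.2.1 d.2.2 (Reg T.unop)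
      map := fun f => ↾ fun M => ⟨M.1.map (funMap f.unop), fun i j α => (M.2 i j α).map _⟩
      map_id := fun T => by
        ext M; refine Subtype.ext ?_; funext i j α; ext a b; exact funMap_id T.unop _
      map_comp := fun f g => by
        ext M; refine Subtype.ext ?_; funext i j α; ext a b
        exact funMap_comp g.unop f.unop _ }
  G d :=
    { obj := fun T => GrpCat.of (biflagSubgroup d.1 d.2.1 d.2.2 (Reg T.unop))
      map := fun f => GrpCat.ofHom
        (((GaugeGroup.map (funMap f.unop)).comp (Subgroup.subtype _)).codRestrict _
          fun g i => ⟨(g.2 i).1.map _, (g.2 i).2.map _⟩)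
      map_id := fun T => by
        ext g i a b; exact funMap_id T.unop _
      map_comp := fun f g => by
        ext x i a b
        exact funMap_comp g.unop f.unop _ }
  X_finite d := IsAffineFiniteType.isFiniteType
    (isAffineFiniteType_matrices (I := Σ i j : Q, (i ⟶ j))
      (fun α => d.1 α.2.1 + d.2.1 α.2.1 + d.2.2 α.2.1) (fun α => d.1 α.1 + d.2.1 α.1 + d.2.2 α.1)
      (fun _ => biflagZero _ _ _ _ _ _) _ (fun T =>
        { toFun := fun M => ⟨fun α => M.1 α.1 α.2.1 α.2.2, fun α =>
            (isBiflag_iff _).1 (M.2 _ _ _)⟩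
          invFun := fun M => ⟨fun i j α => M.1 ⟨i, j, α⟩, fun i j α =>
            (isBiflag_iff _).2 (M.2 ⟨i, j, α⟩)⟩
          left_inv := fun _ => rfl
          right_inv := fun _ => rfl }) (fun _ _ _ => rfl))
  G_linear d := isAffineFiniteType_gl (d.1 + d.2.1 + d.2.2)
    (fun i => biflagZero (d.1 i) (d.2.1 i) (d.2.2 i) (d.1 i) (d.2.1 i) (d.2.2 i)) _ (fun T =>
    { toFun := fun g => ⟨g.1, fun i a b h =>
        ⟨(isBiflag_iff _).1 (g.2 i).1 a b h, (isBiflag_iff _).1 (g.2 i).2 a b h⟩⟩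
      invFun := fun g => ⟨g.1, fun i => ⟨(isBiflag_iff _).2 fun a b h => (g.2 i a b h).1,
        (isBiflag_iff _).2 fun a b h => (g.2 i a b h).2⟩⟩
      left_inv := fun _ => rfl
      right_inv := fun _ => rfl }) (fun _ _ _ => rfl)
  act _ _ M g := ⟨conj M.1 g.1, conj_biflag M g⟩
  act_one _ _ M := Subtype.ext (conj_one M.1)
  act_mul _ _ M g h := Subtype.ext (conj_mul M.1 g.1 h.1)
  act_map _ _ _ f M g := Subtype.ext (map_conj (funMap f) M.1 g.1)

variable {Q}

end Quiver

namespace QStack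

lemma res_rfl {𝔛 : QStack} {i : 𝔛.ι} (h : i = i) {T : SchC} (x : (𝔛.X i).obj (op T)) :
    𝔛.res h (𝟙 T) x = x := by
  simp [res]

/-- The targets of `onX` and `onG` depend on the index map, so where indices agree only
propositionally, as for `d + (d' + d'')` and `(d + d') + d''`, the values can only be compared
heterogeneously. -/
lemma EqMap.ext_heq {𝔛 𝔜 : QStack} {φ ψ : EqMap 𝔛 𝔜} (h : ∀ i, φ.idx i = ψ.idx i)
    (hX : ∀ i {T : SchC} (x : (𝔛.X i).obj (op T)), HEq (φ.onX i x) (ψ.onX i x))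
    (hG : ∀ i {T : SchC} (g : (𝔛.G i).obj (op T)), HEq (φ.onG i g) (ψ.onG i g)) : φ = ψ := by
  obtain ⟨a, X, G, _, _, _, _⟩ := φ
  obtain ⟨b, X', G', _, _, _, _⟩ := ψ
  obtain rfl : a = b := funext h
  obtain rfl : @X = @X' := by funext i T x; exact eq_of_heq (hX i x)
  obtain rfl : @G = @G' := by funext i T x; exact eq_of_heq (hG i x)
  rfl

end QStack

/-! ### The two squares behind associativity. -/

section Quiver

variable {Q : Type} [Quiver.{0} Q]

/-- Change of the index sets along equalities of dimensions. -/
def castRep {d e : Q → ℕ} (h : ∀ i, e i = d i) {R : Type} (M : RepSpace Q d R) : RepSpace Q e R :=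
  fun i j α => (M i j α).submatrix (Fin.cast (h j)) (Fin.cast (h i))

/-- Change of the index sets along equalities of dimensions. -/
def castGauge {Q : Type} {d e : Q → ℕ} (h : ∀ i, e i = d i) {R : Type} [CommRing R]
    (g : GaugeGroup d R) : GaugeGroup e R := fun i =>
  { val := (g i).val.submatrix (finCongr (h i)) (finCongr (h i))
    inv := (g i)⁻¹.val.submatrix (finCongr (h i)) (finCongr (h i))
    val_inv := by rw [Matrix.submatrix_mul_equiv, Units.mul_inv, Matrix.submatrix_one_equiv]
    inv_val := by rw [Matrix.submatrix_mul_equiv, Units.inv_mul, Matrix.submatrix_one_equiv] }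

lemma castGauge_mul {Q : Type} {d e : Q → ℕ} (h : ∀ i, e i = d i) {R : Type} [CommRing R]
    (g g' : GaugeGroup d R) : castGauge h (g * g') = castGauge h g * castGauge h g' := by
  funext i
  exact Units.ext (Matrix.submatrix_mul_equiv _ _ _ (finCongr (h i)) _).symm

lemma castRep_conj {d e : Q → ℕ} (h : ∀ i, e i = d i) {R : Type} [CommRing R]
    (M : RepSpace Q d R) (g : GaugeGroup d R) :
    castRep h (conj M g) = conj (castRep h M) (castGauge h g) := by
  funext i j α
  change _ = ((g j)⁻¹.val.submatrix (finCongr (h j)) (finCongr (h j)) *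
    (M i j α).submatrix (finCongr (h j)) (finCongr (h i))) *
    (g i).val.submatrix (finCongr (h i)) (finCongr (h i))
  rw [Matrix.submatrix_mul_equiv, Matrix.submatrix_mul_equiv]
  rfl

/-- Once the dimension vectors are identified, the cast is the identity. Unlike a transport,
`castRep` is given by explicit reindexing, so it commutes with base change and with taking blocks by
unfolding. -/
lemma heq_castRep {d e : Q → ℕ} (h : ∀ i, e i = d i) {R : Type} (M : RepSpace Q d R) :
    HEq (castRep h M) M := by
  obtain rfl : e = d := funext h
  rfl

lemma heq_castGauge {Q : Type} {d e : Q → ℕ} (h : ∀ i, e i = d i) {R : Type} [CommRing R]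
    (g : GaugeGroup d R) : HEq (castGauge h g) g := by
  obtain rfl : e = d := funext h
  refine heq_of_eq (funext fun i => Units.ext ?_)
  rfl

lemma castRep_injective {d e : Q → ℕ} (h : ∀ i, e i = d i) {R : Type} :
    Function.Injective (castRep h : RepSpace Q d R → RepSpace Q e R) := by
  intro M N hMN
  exact eq_of_heq ((heq_castRep h M).symm.trans ((heq_of_eq hMN).trans (heq_castRep h N)))

lemma castGauge_injective {Q : Type} {d e : Q → ℕ} (h : ∀ i, e i = d i) {R : Type} [CommRing R] :
    Function.Injective (castGauge h : GaugeGroup d R → GaugeGroup e R) := by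
  intro M N hMN
  exact eq_of_heq ((heq_castGauge h M).symm.trans ((heq_of_eq hMN).trans (heq_castGauge h N)))

lemma castRep_castRep {d e : Q → ℕ} (h : ∀ i, e i = d i) {R : Type} (M : RepSpace Q e R) :
    castRep h (castRep (fun i => (h i).symm) M) = M := by
  obtain rfl : e = d := funext h
  rfl

lemma castGauge_castGauge {Q : Type} {d e : Q → ℕ} (h : ∀ i, e i = d i) {R : Type} [CommRing R]
    (g : GaugeGroup e R) : castGauge h (castGauge (fun i => (h i).symm) g) = g := by
  obtain rfl : e = d := funext h
  refine funext fun i => Units.ext ?_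
  rfl

/-- Every element of `G_d × G_{d'}` lifts to `G_{d,d'}`. -/
lemma exists_flag_lift {Q : Type} (d : (Q → ℕ) × (Q → ℕ)) {R : Type} [CommRing R] (g : GaugeGroup d.1 R)
    (g' : GaugeGroup d.2 R) : ∃ k : flagSubgroup d.1 d.2 R, ∀ i,
      subBlock (m := d.1 i) (n := d.2 i) (m' := d.1 i) (n' := d.2 i) (k.1 i).val = (g i).val ∧
      quotBlock (m := d.1 i) (n := d.2 i) (m' := d.1 i) (n' := d.2 i) (k.1 i).val = (g' i).val :=
  ⟨⟨fun i =>
    { val := blockDiag (g i).val (g' i).val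
      inv := blockDiag (g i)⁻¹.val (g' i)⁻¹.val
      val_inv := by rw [blockDiag_mul, Units.mul_inv, Units.mul_inv]; exact blockDiag_one
      inv_val := by rw [blockDiag_mul, Units.inv_mul, Units.inv_mul]; exact blockDiag_one },
    fun i => ⟨isBlockUpper_blockDiag _ _, isBlockUpper_blockDiag _ _⟩⟩,
    fun i => ⟨subBlock_blockDiag _ _, quotBlock_blockDiag _ _⟩⟩

variable [Finite Q] [∀ i j : Q, Finite (i ⟶ j)]

/-- The point where the 2-fibre product becomes computable by matrices: block diagonal matrices
split `G_{d,d'} → G_d × G_{d'}`, which provides `lift_onG` for every square along `π₁ × π₃`. -/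
lemma lift_π₁_π₃_surj (d : (exactSeq Q).ι) {T : SchC}
    (k : (((moduli Q).prod (moduli Q)).G ((EqMap.lift π₁ π₃).idx d)).obj (op T)) :
    ∃ h, (EqMap.lift (π₁ (Q := Q)) π₃).onG d h = k := by
  obtain ⟨h, hh⟩ := exists_flag_lift d (R := Reg T) k.1 k.2
  exact ⟨h, Prod.ext (funext fun i => Units.ext (hh i).1) (funext fun i => Units.ext (hh i).2)⟩

namespace filtStack

/-- The filtration forgetting the first step. -/
def outer : EqMap (filtStack Q) (exactSeq Q) where
  idx d := (d.1 + d.2.1, d.2.2)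
  onX _ _ M := ⟨M.1, fun i j α => (M.2 i j α).1⟩
  onG _ _ g := ⟨g.1, fun i => ⟨(g.2 i).1.1, (g.2 i).2.1⟩⟩
  onX_map _ _ _ _ _ := rfl
  onG_map _ _ _ _ _ := rfl
  onG_mul _ _ _ _ := rfl
  onX_act _ _ _ _ := rfl

/-- The filtration of the second step of a filtration. -/
def inner : EqMap (filtStack Q) (exactSeq Q) where
  idx d := (d.1, d.2.1)
  onX d _ M := ⟨π₁.onX _ (outer.onX d M), fun i j α => (M.2 i j α).2⟩
  onG d _ g := ⟨π₁.onG _ (outer.onG d g), fun i => ⟨(g.2 i).1.2, (g.2 i).2.2⟩⟩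
  onX_map d _ _ f M := Subtype.ext ((outer.comp π₁).onX_map d f M)
  onG_map d _ _ f g := Subtype.ext ((outer.comp π₁).onG_map d f g)
  onG_mul d _ g h := Subtype.ext ((outer.comp π₁).onG_mul d g h)
  onX_act d _ M g := Subtype.ext ((outer.comp π₁).onX_act d M g)

/-- The filtration forgetting the second step. -/
def outer' : EqMap (filtStack Q) (exactSeq Q) where
  idx d := (d.1, d.2.1 + d.2.2)
  onX d _ M := ⟨castRep (fun i => (add_assoc (d.1 i) (d.2.1 i) (d.2.2 i)).symm) M.1,
    fun i j α => ((isBiflag_iff_assocBlock _).1 (M.2 i j α)).1⟩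
  onG d _ g := ⟨castGauge (fun i => (add_assoc (d.1 i) (d.2.1 i) (d.2.2 i)).symm) g.1,
    fun i => ⟨((isBiflag_iff_assocBlock _).1 (g.2 i).1).1,
      ((isBiflag_iff_assocBlock _).1 (g.2 i).2).1⟩⟩
  onX_map _ _ _ _ _ := rfl
  onG_map _ _ _ _ _ := Subtype.ext (funext fun _ => Units.ext rfl)
  onG_mul _ _ _ _ := Subtype.ext (castGauge_mul _ _ _)
  onX_act _ _ _ _ := Subtype.ext (castRep_conj _ _ _)

/-- The filtration of the quotient by the first step of a filtration. -/
def inner' : EqMap (filtStack Q) (exactSeq Q) where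
  idx d := (d.2.1, d.2.2)
  onX d _ M := ⟨π₃.onX _ (outer'.onX d M), fun i j α =>
    ((isBiflag_iff_assocBlock _).1 (M.2 i j α)).2⟩
  onG d _ g := ⟨π₃.onG _ (outer'.onG d g), fun i => ⟨((isBiflag_iff_assocBlock _).1 (g.2 i).1).2,
      ((isBiflag_iff_assocBlock _).1 (g.2 i).2).2⟩⟩
  onX_map d _ _ f M := Subtype.ext ((outer'.comp π₃).onX_map d f M)
  onG_map d _ _ f g := Subtype.ext ((outer'.comp π₃).onG_map d f g)
  onG_mul d _ g h := Subtype.ext ((outer'.comp π₃).onG_mul d g h)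
  onX_act d _ M g := Subtype.ext ((outer'.comp π₃).onX_act d M g)

/-- A representation with `V₂ ⊆ V`, a filtration of `V₂`, and the quotient `V/V₂`: the last is
determined by the first, and the first two together are a filtration with three steps. -/
lemma isStrictPullback : IsStrictPullback
    (EqMap.lift (inner (Q := Q)) (outer.comp π₃)) outer
    (EqMap.prodMap π₂ (EqMap.id (moduli Q))) (EqMap.lift π₁ π₃) where
  idx_comm _ := rfl
  onX_comm _ _ _ := res_rfl _ _
  onG_comm _ _ _ := rfl
  idx_inj := by
    rintro ⟨a, b, c⟩ ⟨a', b', c'⟩ h -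
    obtain rfl : a = a' := congrArg (fun x => x.1.1) h
    obtain rfl : b = b' := congrArg (fun x => x.1.2) h
    obtain rfl : c = c' := congrArg (fun x => x.2) h
    rfl
  idx_surj := by
    rintro ⟨⟨a, b⟩, c⟩ ⟨e, f⟩ h
    obtain ⟨rfl, rfl⟩ : a + b = e ∧ c = f := ⟨congrArg Prod.fst h, congrArg Prod.snd h⟩
    exact ⟨(a, b, c), rfl, rfl⟩
  onX_inj _ _ _ _ _ h := Subtype.ext (congrArg (fun M : FlagRepSpace Q _ _ _ => M.1) h)
  onX_surj l T x y h := by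
    have h' := (res_rfl _ _).symm.trans h
    obtain ⟨⟨A, hA⟩, N⟩ := x
    have h1 : ∀ i j α, A i j α = subBlock (m := l.1 j + l.2.1 j) (m' := l.1 i + l.2.1 i)
        (n := l.2.2 j) (n' := l.2.2 i) (y.1 i j α) := fun i j α =>
      congrFun (congrFun (congrFun (congrArg Prod.fst h') i) j) α
    -- The underlying representation is that of `y`. The missing half of the flag condition concerns
    -- its restriction to the subspace, which is the representation in `x`.
    refine ⟨⟨y.1, fun i j α => ⟨y.2 i j α, by rw [← h1]; exact hA i j α⟩⟩, ?_, rfl⟩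
    exact Prod.ext (Subtype.ext (congrArg Prod.fst h').symm) (congrArg Prod.snd h').symm
  onG_inj _ _ _ _ _ h := Subtype.ext (congrArg (fun g : flagSubgroup _ _ _ => g.1) h)
  onG_surj l T x y h := by
    obtain ⟨⟨A, hA⟩, N⟩ := x
    have h1 : A = (π₁ (Q := Q)).onG _ y := congrArg Prod.fst h
    subst h1
    exact ⟨⟨y.1, fun i => ⟨⟨(y.2 i).1, (hA i).1⟩, ⟨(y.2 i).2, (hA i).2⟩⟩⟩,
      Prod.ext rfl (congrArg Prod.snd h).symm, rfl⟩
  lift_onG := lift_π₁_π₃_surj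

/-- The mirror image: `V₁ ⊆ V` together with a filtration of `V/V₁` is again a filtration with three
steps, now with the dimension vectors bracketed to the right. -/
lemma isStrictPullback' : IsStrictPullback
    (EqMap.lift (outer'.comp π₁) (inner' (Q := Q))) outer'
    (EqMap.prodMap (EqMap.id (moduli Q)) π₂) (EqMap.lift π₁ π₃) where
  idx_comm _ := rfl
  onX_comm _ _ _ := res_rfl _ _
  onG_comm _ _ _ := rfl
  idx_inj := by
    rintro ⟨a, b, c⟩ ⟨a', b', c'⟩ h -
    obtain rfl : a = a' := congrArg (fun x => x.1) h
    obtain rfl : b = b' := congrArg (fun x => x.2.1) h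
    obtain rfl : c = c' := congrArg (fun x => x.2.2) h
    rfl
  idx_surj := by
    rintro ⟨a, b, c⟩ ⟨e, f⟩ h
    obtain ⟨rfl, rfl⟩ : a = e ∧ b + c = f := ⟨congrArg Prod.fst h, congrArg Prod.snd h⟩
    exact ⟨(a, b, c), rfl, rfl⟩
  onX_inj _ _ _ _ _ h := Subtype.ext (castRep_injective _
    (congrArg (fun M : FlagRepSpace Q _ _ _ => M.1) h))
  onX_surj l T x y h := by
    have h' := (res_rfl _ _).symm.trans h
    obtain ⟨N, ⟨A, hA⟩⟩ := x
    have h1 : ∀ i j α, A i j α = quotBlock (m := l.1 j) (m' := l.1 i)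
        (n := l.2.1 j + l.2.2 j) (n' := l.2.1 i + l.2.2 i) (y.1 i j α) := fun i j α =>
      congrFun (congrFun (congrFun (congrArg Prod.snd h') i) j) α
    obtain ⟨y, hy⟩ := y
    -- Every representation in the right-hand bracketing is a cast of one in the left-hand
    -- bracketing. After this substitution the image under `outer'` matches by `rfl`.
    obtain ⟨z, rfl⟩ : ∃ z : RepSpace Q (l.1 + l.2.1 + l.2.2) (Reg T),
        castRep (fun i => (add_assoc (l.1 i) (l.2.1 i) (l.2.2 i)).symm) z = y :=
      ⟨_, castRep_castRep _ _⟩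
    refine ⟨⟨z, fun i j α => (isBiflag_iff_assocBlock _).2 ⟨hy i j α, ?_⟩⟩, ?_, rfl⟩
    · have := hA i j α
      rw [h1] at this
      exact this
    · exact Prod.ext (congrArg Prod.fst h').symm (Subtype.ext (congrArg Prod.snd h').symm)
  onG_inj _ _ _ _ _ h := Subtype.ext (castGauge_injective _
    (congrArg (fun g : flagSubgroup _ _ _ => g.1) h))
  onG_surj l T x y h := by
    obtain ⟨N, ⟨A, hA⟩⟩ := x
    have h1 : A = (π₃ (Q := Q)).onG _ y := congrArg Prod.snd h
    subst h1
    have h2 : N = (π₁ (Q := Q)).onG _ y := congrArg Prod.fst h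
    subst h2
    obtain ⟨y, hy⟩ := y
    obtain ⟨z, rfl⟩ : ∃ z : GaugeGroup (l.1 + l.2.1 + l.2.2) (Reg T),
        castGauge (fun i => (add_assoc (l.1 i) (l.2.1 i) (l.2.2 i)).symm) z = y :=
      ⟨_, castGauge_castGauge _ _⟩
    exact ⟨⟨z, fun i => ⟨(isBiflag_iff_assocBlock _).2 ⟨(hy i).1, (hA i).1⟩,
      (isBiflag_iff_assocBlock _).2 ⟨(hy i).2, (hA i).2⟩⟩⟩, rfl, rfl⟩
  lift_onG := lift_π₁_π₃_surj

/-- Both composites forget the filtration; they differ only in the bracketing of the dimension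
vector. -/
lemma outer_comp_π₂ : (outer (Q := Q)).comp π₂ = outer'.comp π₂ :=
  EqMap.ext_heq (fun d => add_assoc d.1 d.2.1 d.2.2)
    (fun _ _ M => (heq_castRep (Q := Q) _ M.1).symm) (fun _ _ g => (heq_castGauge _ g.1).symm)

/-- Both composites send a filtration to its three subquotients in `𝔐 × (𝔐 × 𝔐)`. -/
lemma graded_eq :
    (EqMap.lift (inner (Q := Q)) (outer.comp π₃)).comp
      ((EqMap.prodMap (EqMap.lift π₁ π₃) (EqMap.id _)).comp (EqMap.assoc _ _ _)) =
    (EqMap.lift (outer'.comp π₁) (inner' (Q := Q))).comp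
      (EqMap.prodMap (EqMap.id _) (EqMap.lift π₁ π₃)) := by
  refine EqMap.ext_heq (fun _ => rfl) (fun d T M => heq_of_eq ?_) (fun d T g => heq_of_eq ?_)
  · refine Prod.ext ?_ (Prod.ext ?_ ?_) <;> funext i j α
    · exact (subBlock_assocBlock _).symm
    · exact (subBlock_quotBlock_assocBlock _).symm
    · exact (quotBlock_quotBlock_assocBlock _).symm
  · refine Prod.ext ?_ (Prod.ext ?_ ?_) <;> funext i <;> apply Units.ext
    · exact (subBlock_assocBlock _).symm
    · exact (subBlock_quotBlock_assocBlock _).symm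
    · exact (quotBlock_quotBlock_assocBlock _).symm

end filtStack

end Quiver

/-- The square expressing that `f` commutes with the identifications `𝔛 ≅ Spec ℂ × 𝔛`. -/
lemma QStack.EqMap.isStrictPullback_lift_toPt {𝔛 𝔜 : QStack} (f : EqMap 𝔛 𝔜) :
    IsStrictPullback (EqMap.lift (EqMap.toPt 𝔛) (EqMap.id 𝔛)) f
      (EqMap.prodMap (EqMap.id pt) f) (EqMap.lift (EqMap.toPt 𝔜) (EqMap.id 𝔜)) where
  idx_comm _ := rfl
  onX_comm _ _ _ := res_rfl _ _
  onG_comm _ _ _ := rfl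
  idx_inj _ _ h _ := congrArg Prod.snd h
  idx_surj := by
    rintro ⟨_, i⟩ j h
    exact ⟨i, rfl, congrArg Prod.snd h⟩
  onX_inj _ _ _ _ h _ := congrArg Prod.snd h
  -- The point has only one section and one group element over every scheme, so a pair is determined
  -- by its component in `𝔛`; the same reason settles the group conditions.
  onX_surj _ _ x _ h :=
    ⟨x.2, rfl, congrArg Prod.snd ((res_rfl _ _).symm.trans h)⟩
  onG_inj _ _ _ _ h _ := congrArg Prod.snd h
  onG_surj _ _ g _ h := ⟨g.2, rfl, congrArg Prod.snd h⟩
  lift_onG _ _ k := ⟨k.2, rfl⟩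

/-! ### The squares behind the unit, and finiteness on indices. -/

section Quiver

lemma quotBlock_submatrix_cast {n n' : ℕ} {R : Type} (h : 0 + n = n) (h' : 0 + n' = n')
    (M : Matrix (Fin n) (Fin n') R) :
    quotBlock (M.submatrix (Fin.cast h) (Fin.cast h')) = M := by
  ext a b
  exact congrArg₂ M (Fin.ext (Nat.zero_add _)) (Fin.ext (Nat.zero_add _))

lemma submatrix_cast_quotBlock {n n' : ℕ} {R : Type} (h : 0 + n = n) (h' : 0 + n' = n')
    (M : Matrix (Fin (0 + n)) (Fin (0 + n')) R) :
    (quotBlock M).submatrix (Fin.cast h) (Fin.cast h') = M := by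
  ext a b
  exact congrArg₂ M (Fin.ext (Nat.zero_add _)) (Fin.ext (Nat.zero_add _))

variable {Q : Type} [Quiver.{0} Q] [Finite Q] [∀ i j : Q, Finite (i ⟶ j)]

/-- The morphism mapping a representation `V` to the exact sequence `0 → 0 → V → V → 0`. -/
def unitLeft : EqMap (moduli Q) (exactSeq Q) where
  idx d := (0, d)
  onX d _ M := ⟨castRep (fun i => zero_add (d i)) M, fun _ _ _ _ b => b.elim0⟩
  onG d _ g := ⟨castGauge (fun i => zero_add (d i)) g,
    fun _ => ⟨fun _ b => b.elim0, fun _ b => b.elim0⟩⟩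
  onX_map _ _ _ _ _ := rfl
  onG_map _ _ _ _ _ := Subtype.ext (funext fun _ => Units.ext rfl)
  onG_mul _ _ _ _ := Subtype.ext (castGauge_mul _ _ _)
  onX_act _ _ _ _ := Subtype.ext (castRep_conj _ _ _)

/-- The morphism mapping a representation `V` to the exact sequence `0 → V → V → 0 → 0`. -/
def unitRight : EqMap (moduli Q) (exactSeq Q) where
  idx d := (d, 0)
  onX _ _ M := ⟨M, fun _ _ _ a => a.elim0⟩
  onG _ _ g := ⟨g, fun _ => ⟨fun a => a.elim0, fun a => a.elim0⟩⟩
  onX_map _ _ _ _ _ := rfl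
  onG_map _ _ _ _ _ := rfl
  onG_mul _ _ _ _ := rfl
  onX_act _ _ _ _ := rfl

lemma unitLeft_comp_π₂ : (unitLeft (Q := Q)).comp π₂ = EqMap.id _ :=
  EqMap.ext_heq (fun d => zero_add (M := Q → ℕ) d) (fun _ _ M => heq_castRep _ M)
    (fun _ _ g => heq_castGauge _ g)

/-- `d + 0` reduces to `d`, so no cast appears here, whereas `0 + d` does not reduce to `d` and
`unitLeft` has to reindex. -/
lemma unitRight_comp_π₂ : (unitRight (Q := Q)).comp π₂ = EqMap.id _ := rfl

/-- An exact sequence with zero first term is determined by its third term, which is also its second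
term up to the reindexing `0 + d = d`. The conditions on the subspace concern matrices with no rows
or columns. -/
lemma isStrictPullback_unitLeft : IsStrictPullback
    (EqMap.lift (EqMap.toPt (moduli Q)) (EqMap.id _)) unitLeft
    (EqMap.prodMap zeroRep (EqMap.id (moduli Q))) (EqMap.lift π₁ π₃) where
  idx_comm _ := rfl
  onX_comm d T M := by
    refine (res_rfl _ _).trans (Prod.ext ?_ ?_)
    · funext i j α; ext a; exact a.elim0
    · funext i j α; exact (quotBlock_submatrix_cast _ _ (M i j α)).symm
  onG_comm d T g := by
    refine Prod.ext ?_ ?_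
    · funext i; ext a; exact a.elim0
    · funext i; exact Units.ext (quotBlock_submatrix_cast (zero_add _) (zero_add _) (g i).val).symm
  idx_inj _ _ h _ := congrArg Prod.snd h
  idx_surj := by
    rintro ⟨_, d⟩ ⟨e, f⟩ h
    obtain rfl : 0 = e := congrArg Prod.fst h
    obtain rfl : d = f := congrArg Prod.snd h
    exact ⟨d, rfl, rfl⟩
  onX_inj _ _ _ _ h _ := congrArg Prod.snd h
  onX_surj d T x y h := by
    have h' : x.2 = (π₃ (Q := Q)).onX _ y := congrArg Prod.snd ((res_rfl _ _).symm.trans h)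
    refine ⟨x.2, rfl, Subtype.ext (funext fun i => funext fun j => funext fun α => ?_)⟩
    rw [h']
    exact submatrix_cast_quotBlock _ _ (y.1 i j α)
  onG_inj _ _ _ _ h _ := congrArg Prod.snd h
  onG_surj d T x y h := by
    have h' : x.2 = (π₃ (Q := Q)).onG _ y := congrArg Prod.snd h
    refine ⟨x.2, rfl, Subtype.ext (funext fun i => Units.ext ?_)⟩
    rw [h']
    exact submatrix_cast_quotBlock (zero_add _) (zero_add _) (y.1 i).val
  lift_onG := lift_π₁_π₃_surj

/-- An exact sequence with zero third term is determined by its first term, which is the whole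
representation. Equations in the quotient component hold because matrices of size zero have no
entries. -/
lemma isStrictPullback_unitRight : IsStrictPullback
    (EqMap.lift (EqMap.id _) (EqMap.toPt (moduli Q))) unitRight
    (EqMap.prodMap (EqMap.id (moduli Q)) zeroRep) (EqMap.lift π₁ π₃) where
  idx_comm _ := rfl
  onX_comm d T M := by
    refine (res_rfl _ _).trans (Prod.ext rfl ?_)
    funext i j α; ext a; exact a.elim0
  onG_comm d T g := by
    refine Prod.ext (funext fun i => Units.ext rfl) ?_
    funext i; ext a; exact a.elim0
  idx_inj _ _ h _ := congrArg Prod.fst h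
  idx_surj := by
    rintro ⟨d, _⟩ ⟨e, f⟩ h
    obtain rfl : 0 = f := congrArg Prod.snd h
    obtain rfl : d = e := congrArg Prod.fst h
    exact ⟨d, rfl, rfl⟩
  onX_inj _ _ _ _ h _ := congrArg Prod.fst h
  onX_surj d T x y h := by
    have h' : x.1 = (π₁ (Q := Q)).onX _ y := congrArg Prod.fst ((res_rfl _ _).symm.trans h)
    refine ⟨x.1, rfl, Subtype.ext ?_⟩
    rw [h']
    rfl
  onG_inj _ _ _ _ h _ := congrArg Prod.fst h
  onG_surj d T x y h := by
    have h' : x.1 = (π₁ (Q := Q)).onG _ y := congrArg Prod.fst h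
    refine ⟨x.1, rfl, Subtype.ext (funext fun i => Units.ext ?_)⟩
    rw [h']
    rfl
  lift_onG := lift_π₁_π₃_surj

lemma idxFinite_π₂ : (π₂ (Q := Q)).IdxFinite := fun (e : Q → ℕ) => by
  classical
  have := Fintype.ofFinite Q
  -- Both summands of `e` lie in the box between `0` and `e`, which is finite because `Q` has
  -- finitely many vertices.
  refine ((Set.finite_Icc 0 e).prod (Set.finite_Icc 0 e)).subset ?_
  rintro ⟨d, d'⟩ (h : d + d' = e)
  subst h
  exact ⟨⟨zero_le, le_self_add⟩, ⟨zero_le, le_add_self⟩⟩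

lemma idxFinite_zeroRep : (zeroRep (Q := Q)).IdxFinite :=
  EqMap.idxFinite_of_injective fun _ _ _ => rfl

/-- The third dimension vector is prescribed, and the first two have prescribed sum, so the fibre is
a fibre of `π₂` on indices. -/
lemma idxFinite_outer : (filtStack.outer (Q := Q)).IdxFinite := fun (e : (Q → ℕ) × (Q → ℕ)) => by
  refine ((idxFinite_π₂ e.1).image fun d => (d.1, d.2, e.2)).subset ?_
  rintro ⟨a, b, c⟩ h
  exact ⟨(a, b), congrArg Prod.fst h, by rw [← show c = e.2 from congrArg Prod.snd h]⟩

lemma idxFinite_outer' : (filtStack.outer' (Q := Q)).IdxFinite := fun (e : (Q → ℕ) × (Q → ℕ)) => by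
  refine ((idxFinite_π₂ e.2).image fun d => (e.1, d.1, d.2)).subset ?_
  rintro ⟨a, b, c⟩ h
  exact ⟨(b, c), congrArg Prod.snd h, by rw [← show a = e.1 from congrArg Prod.fst h]⟩

lemma idxFinite_unitLeft : (unitLeft (Q := Q)).IdxFinite :=
  EqMap.idxFinite_of_injective fun _ _ h => congrArg Prod.snd h

lemma idxFinite_unitRight : (unitRight (Q := Q)).IdxFinite :=
  EqMap.idxFinite_of_injective fun _ _ h => congrArg Prod.fst h

end Quiver

/-! ### The Ringel–Hall algebra. -/

namespace StackyMotivicTheory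

variable (R : StackyMotivicTheory.{u}) {Q : Type} [Quiver.{0} Q] [Finite Q]
  [∀ i j : Q, Finite (i ⟶ j)]

lemma add_hall (a b c : R.obj (moduli Q)) : R.hall (a + b) c = R.hall a c + R.hall b c := by
  simp only [hall, map_add, AddMonoidHom.add_apply]

lemma hall_add (a b c : R.obj (moduli Q)) : R.hall a (b + c) = R.hall a b + R.hall a c := by
  simp only [hall, map_add]

/-- Naturality of `𝔛 ≅ pt × 𝔛` with respect to `π₂` is a cartesian square, so base change moves the
scalar inside the push-forward. Both linearity statements are compared with this common form. -/
lemma smul_hall (r : R.obj pt) (a b : R.obj (moduli Q)) :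
    R.smul r (R.hall a b) = R.push π₂.mor finiteType_π₂
      (R.pull ((EqMap.lift (EqMap.toPt _) (EqMap.id _)).comp
        (EqMap.prodMap (EqMap.id pt) (EqMap.lift π₁ π₃))).mor
          (R.boxtimes r (R.boxtimes a b))) := by
  rw [smul, hall, R.push_prodMap_right π₂ idxFinite_π₂,
    R.pull_push (EqMap.isStrictPullback_lift_toPt π₂) _ finiteType_π₂, pull_prodMap_right,
    pull_pull]

lemma hall_smul_left (r : R.obj pt) (a b : R.obj (moduli Q)) :
    R.hall (R.smul r a) b = R.smul r (R.hall a b) := by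
  rw [smul_hall, smul, hall, pull_prodMap_left, ← R.boxtimes_assoc, pull_pull, pull_pull]
  -- Both sides are now push-forwards along `π₂` of pull-backs of `r ⊠ (a ⊠ b)` along the same map
  -- from exact sequences to `pt × (𝔐 × 𝔐)`.
  rfl

/-- As on the left, except that the scalar first has to be moved past `a`, which is where the
symmetry of the exterior product enters. -/
lemma hall_smul_right (r : R.obj pt) (a b : R.obj (moduli Q)) :
    R.hall a (R.smul r b) = R.smul r (R.hall a b) := by
  rw [smul_hall, smul, hall, pull_prodMap_right, boxtimes_assocInv, ← R.boxtimes_symm a r,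
    pull_prodMap_left, ← R.boxtimes_assoc, pull_pull, pull_pull, pull_pull, pull_pull]
  rfl

/-- Base change along the two squares of `filtStack` brings both products to the form of pulling `a
⊠ (b ⊠ c)` back along the associated graded object and pushing forward along the underlying
representation. The maps then agree by `graded_eq` and `outer_comp_π₂`. -/
lemma hall_assoc (a b c : R.obj (moduli Q)) :
    R.hall (R.hall a b) c = R.hall a (R.hall b c) := by
  have h : R.hall (R.hall a b) c = R.push (filtStack.outer.comp π₂).mor
      (idxFinite_outer.comp idxFinite_π₂).finiteType
      (R.pull ((EqMap.lift filtStack.inner (filtStack.outer.comp π₃)).comp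
        ((EqMap.prodMap (EqMap.lift π₁ π₃) (EqMap.id _)).comp (EqMap.assoc _ _ _))).mor
          (R.boxtimes a (R.boxtimes b c))) := by
    rw [hall, hall, R.push_prodMap_left π₂ idxFinite_π₂,
      R.pull_push filtStack.isStrictPullback _ idxFinite_outer.finiteType, pull_prodMap_left,
      ← R.boxtimes_assoc, pull_pull, pull_pull, push_push]
    rfl
  have h' : R.hall a (R.hall b c) = R.push (filtStack.outer'.comp π₂).mor
      (idxFinite_outer'.comp idxFinite_π₂).finiteType
      (R.pull ((EqMap.lift (filtStack.outer'.comp π₁) filtStack.inner').comp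
        (EqMap.prodMap (EqMap.id _) (EqMap.lift π₁ π₃))).mor
          (R.boxtimes a (R.boxtimes b c))) := by
    rw [hall, hall, R.push_prodMap_right π₂ idxFinite_π₂,
      R.pull_push filtStack.isStrictPullback' _ idxFinite_outer'.finiteType, pull_prodMap_right,
      pull_pull, push_push]
  rw [h, h', filtStack.graded_eq]
  exact R.push_congr filtStack.outer_comp_π₂ _ _ _

/-- Base change replaces `0_!(1) ⊠ a`, pulled back to exact sequences, by the push-forward of `a`
along `V ↦ (0 → 0 → V → V → 0)`. Its middle term is `V`, so pushing on along `π₂` gives back `a`. -/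
lemma hallOne_hall (a : R.obj (moduli Q)) : R.hall (R.hallOne Q) a = a := by
  rw [hall, hallOne, R.push_prodMap_left zeroRep idxFinite_zeroRep,
    R.pull_push isStrictPullback_unitLeft _ idxFinite_unitLeft.finiteType, R.one_boxtimes,
    pull_pull, R.push_push _ _ _ _ (idxFinite_unitLeft.comp idxFinite_π₂).finiteType,
    R.push_congr unitLeft_comp_π₂ _ EqMap.idxFinite_id.finiteType, push_id_mor]
  exact R.pull_id_mor a

lemma hall_hallOne (a : R.obj (moduli Q)) : R.hall a (R.hallOne Q) = a := by
  rw [hall, hallOne, R.push_prodMap_right zeroRep idxFinite_zeroRep,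
    R.pull_push isStrictPullback_unitRight _ idxFinite_unitRight.finiteType, boxtimes_one,
    pull_pull, R.push_push _ _ _ _ (idxFinite_unitRight.comp idxFinite_π₂).finiteType,
    R.push_congr unitRight_comp_π₂ _ EqMap.idxFinite_id.finiteType, push_id_mor]
  exact R.pull_id_mor a

end StackyMotivicTheory

end

end RingelHall

theorem mainTheorem3 {Q : Type} [Quiver.{0} Q] [Finite Q] [∀ i j : Q, Finite (i ⟶ j)]
    (R : RingelHall.StackyMotivicTheory) :
    -- `R(Spec ℂ)` is a commutative ring with unit
    ((∀ r s t : R.obj RingelHall.QStack.pt, R.mulPt (R.mulPt r s) t = R.mulPt r (R.mulPt s t)) ∧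
      (∀ r s : R.obj RingelHall.QStack.pt, R.mulPt r s = R.mulPt s r) ∧
      (∀ r : R.obj RingelHall.QStack.pt, R.mulPt R.one r = r) ∧
      (∀ r s t : R.obj RingelHall.QStack.pt,
        R.mulPt r (s + t) = R.mulPt r s + R.mulPt r t)) ∧
    -- `R(𝔐)` is a module over it
    ((∀ (r s : R.obj RingelHall.QStack.pt) (a : R.obj (RingelHall.moduli Q)),
        R.smul (R.mulPt r s) a = R.smul r (R.smul s a)) ∧
      (∀ a : R.obj (RingelHall.moduli Q), R.smul R.one a = a) ∧
      (∀ (r s : R.obj RingelHall.QStack.pt) (a : R.obj (RingelHall.moduli Q)),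
        R.smul (r + s) a = R.smul r a + R.smul s a) ∧
      (∀ (r : R.obj RingelHall.QStack.pt) (a b : R.obj (RingelHall.moduli Q)),
        R.smul r (a + b) = R.smul r a + R.smul r b)) ∧
    -- the product is bilinear over `R(Spec ℂ)`
    ((∀ a b c : R.obj (RingelHall.moduli Q), R.hall (a + b) c = R.hall a c + R.hall b c) ∧
      (∀ a b c : R.obj (RingelHall.moduli Q), R.hall a (b + c) = R.hall a b + R.hall a c) ∧
      (∀ (r : R.obj RingelHall.QStack.pt) (a b : R.obj (RingelHall.moduli Q)),
        R.hall (R.smul r a) b = R.smul r (R.hall a b)) ∧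
      (∀ (r : R.obj RingelHall.QStack.pt) (a b : R.obj (RingelHall.moduli Q)),
        R.hall a (R.smul r b) = R.smul r (R.hall a b))) ∧
    -- it is associative
    (∀ a b c : R.obj (RingelHall.moduli Q), R.hall (R.hall a b) c = R.hall a (R.hall b c)) ∧
    -- and `1₀ = 0_!(1)` is a two-sided unit
    (∀ a : R.obj (RingelHall.moduli Q),
      R.hall (R.hallOne Q) a = a ∧ R.hall a (R.hallOne Q) = a) :=
  -- Over the point, `smul` and `mulPt` coincide definitionally, since the map to the point is the
  -- identity by eta for `Unit`. The laws of the action therefore yield the ring axioms.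
  ⟨⟨fun r s t => R.mulPt_smul r s t, R.mulPt_comm, fun r => R.one_smul' r,
      fun r s t => R.smul_add' r s t⟩,
    ⟨fun r s a => R.mulPt_smul r s a, fun a => R.one_smul' a, fun r s a => R.add_smul' r s a,
      fun r a b => R.smul_add' r a b⟩,
    ⟨R.add_hall, R.hall_add, R.hall_smul_left, R.hall_smul_right⟩, R.hall_assoc,
    fun a => ⟨R.hallOne_hall a, R.hall_hallOne a⟩⟩
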